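/- Let $g\ge 2$, let $[a,b]:=b^{-1}a^{-1}ba$, and let $$\Gamma_g=\pi_1(\Sigma_g)=\langle a_1,b_1,\dots,a_g,b_g \mid [a_g,b_g]\cdots[a_1,b_1]=1\rangle$$ be the fundamental group of the closed oriented surface of genus $g$. Let $\mathrm{Homeo}^+(S^1)$ be the group of orientation-preserving homeomorphisms of the circle with the compact-open topology, and give $\mathrm{Hom}(\Gamma_g,\mathrm{Homeo}^+(S^1))$ the topology of pointwise convergence on $\Gamma_g$. Two representations are called $\chi$-equivalent if they define the same point of the largest Hausdorff quotient of $\mathrm{Hom}(\Gamma_g,\mathrm{Homeo}^+(S^1))/\mathrm{Homeo}^+(S^1)$ (quotient by conjugation). A representation $\rho$ is path-rigid if its path component in $\mathrm{Hom}(\Gamma_g,\mathrm{Homeo}^+(S^1))$ is contained in a single $\chi$-equivalence class, and minimal if every orbit of $\rho(\Gamma_g)$ on $S^1$ is dense. For $f\in\mathrm{Homeo}^+(S^1)$ let $\mathrm{Per}(f)=\{x\in S^1 : f^n(x)=x \text{ for some } n\ge 1\}$. A pair $a,b\in\Gamma_g$ consists of standard generators of a one-holed torus (written $i(a,b)=\pm1$)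 if it is one of the pairs $(x_i,y_i)$ of a standard generating system of $\Gamma_g$, i.e. of elements $x_1,y_1,\dots,x_g,y_g$ for which $a_j\mapsto x_j$, $b_j\mapsto y_j$ defines an automorphism of $\Gamma_g$. (Geometrically: $a$ and $b$ are represented by simple based loops that meet only at the base point and cross there.) For $k\ge1$ let $\mathrm{PSL}^k(2,\mathbb R)\subset\mathrm{Homeo}^+(S^1)$ be the group of all lifts of elements of $\mathrm{PSL}(2,\mathbb R)$, acting on $\mathbb{RP}^1\cong S^1$, to the $k$-fold cover of $\mathbb{RP}^1$; such a lift is hyperbolic if its projection to $\mathrm{PSL}(2,\mathbb R)$ is hyperbolic. For a representation $\rho$, say that $S_k(a,b)$ holds if $i(a,b)=\pm1$, each of $\rho(a)$ and $\rho(b)$ is (separately) conjugate in $\mathrm{Homeo}^+(S^1)$ to a hyperbolic element of $\mathrm{PSL}^k(2,\mathbb R)$, and the periodic points alternate: any two distinct points of $\mathrm{Per}(\rho(a))$ are separated by $\mathrm{Per}(\rho(b))$ (each of the two open arcs between them contains a point of $\mathrm{Per}(\rho(b))$), and vice versa. **Theorem.** Let $\rho\colon\Gamma_g\to\mathrm{Homeo}^+(S^1)$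 be path-rigid and minimal, and let $a,b\in\Gamma_g$ satisfy $i(a,b)=\pm1$. If $\mathrm{Per}(\rho(a))\cap\mathrm{Per}(\rho(b))=\emptyset$, then there is an integer $k\ge1$ such that $S_k(a,b)$ holds. -/

import Mathlib

open scoped Matrix MatrixGroups

noncomputable section

namespace CircleAction

/-! ## Orientation-preserving homeomorphisms of the circle -/

/-- The circle `S¹ = ℝ / ℤ`. -/
abbrev S1 : Type := AddCircle (1 : ℝ)

/-- The group `Homeo⁺(S¹)`: the homeomorphisms of `ℝ / ℤ` that are induced by an increasing
homeomorphism of `ℝ` commuting with the translation by `1`. -/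
def HomeoPlus : Subgroup (S1 ≃ₜ S1) where
  carrier := {f | ∃ F : ℝ ≃o ℝ, (∀ x, F (x + 1) = F x + 1) ∧
    ∀ x : ℝ, f (x : S1) = ((F x : ℝ) : S1)}
  one_mem' := ⟨1, fun _ => rfl, fun _ => rfl⟩
  mul_mem' := by
    rintro f g ⟨F, hF, hf⟩ ⟨G, hG, hg⟩
    refine ⟨F * G, fun x => ?_, fun x => ?_⟩
    · change F (G (x + 1)) = F (G x) + 1
      rw [hG, hF]
    · change f (g (x : S1)) = ((F (G x) : ℝ) : S1)
      rw [hg, hf]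
  inv_mem' := by
    rintro f ⟨F, hF, hf⟩
    refine ⟨F.symm, fun x => ?_, fun x => ?_⟩
    · apply F.injective
      rw [hF, F.apply_symm_apply, F.apply_symm_apply]
    · change f.symm (x : S1) = ((F.symm x : ℝ) : S1)
      rw [Homeomorph.symm_apply_eq, hf, F.apply_symm_apply]

/-- The compact-open topology on `Homeo⁺(S¹)`. -/
instance : TopologicalSpace HomeoPlus :=
  TopologicalSpace.induced (fun f => (⟨f.1, f.1.continuous⟩ : C(S1, S1))) inferInstance

/-- The set `Per(f)` of periodic points of `f`. -/
def Per (f : HomeoPlus) : Set S1 := Function.periodicPts (f : S1 ≃ₜ S1)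

/-! ## Representation spaces, character spaces, path-rigidity -/

section Representations

variable {Γ : Type*} [Group Γ] {G : Type*} [Group G] [TopologicalSpace G]

/-- The topology of `Hom(Γ, G)` for a discrete group `Γ`: the compact-open topology, that is,
the topology of pointwise convergence on `Γ`. -/
instance homTopology : TopologicalSpace (Γ →* G) :=
  TopologicalSpace.induced (fun ρ : Γ →* G => (ρ : Γ → G)) inferInstance

variable (Γ G) in
/-- The orbit relation of the conjugation action of `G` on `Hom(Γ, G)`. -/
def conjSetoid : Setoid (Γ →* G) where
  r ρ₁ ρ₂ := ∃ g : G, ∀ γ : Γ, ρ₂ γ = g * ρ₁ γ * g⁻¹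
  iseqv :=
    { refl := fun ρ => ⟨1, fun γ => by simp⟩
      symm := by
        rintro ρ₁ ρ₂ ⟨g, h⟩
        exact ⟨g⁻¹, fun γ => by rw [h]; group⟩
      trans := by
        rintro ρ₁ ρ₂ ρ₃ ⟨g, h⟩ ⟨g', h'⟩
        exact ⟨g' * g, fun γ => by rw [h', h]; group⟩ }

variable (Γ G) in
/-- The character space `X(Γ, G)`: the largest Hausdorff quotient of `Hom(Γ, G) / G`. -/
abbrev CharacterSpace : Type _ := T2Quotient (Quotient (conjSetoid Γ G))

/-- The point of the character space `X(Γ, G)` that a representation defines. -/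
def character (ρ : Γ →* G) : CharacterSpace Γ G :=
  T2Quotient.mk (Quotient.mk (conjSetoid Γ G) ρ)

/-- `χ`-equivalence of representations. -/
def ChiEquiv (ρ₁ ρ₂ : Γ →* G) : Prop := character ρ₁ = character ρ₂

/-- `ρ` is path-rigid if its path component in `Hom(Γ, G)` lies in one `χ`-equivalence class
(which is then the class of `ρ`, as `ρ` belongs to its path component). -/
def PathRigid (ρ : Γ →* G) : Prop := pathComponent ρ ⊆ {ρ' | ChiEquiv ρ ρ'}

/-- A representation into `Homeo⁺(S¹)` is minimal if every orbit on the circle is dense. -/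
def IsMinimalRep (ρ : Γ →* HomeoPlus) : Prop :=
  ∀ x : S1, Dense (Set.range fun γ : Γ => (ρ γ : S1 ≃ₜ S1) x)

end Representations

/-! ## Surface groups -/

/-- The commutator in the convention `[a, b] = b⁻¹ a⁻¹ b a`. -/
def comm {H : Type*} [Group H] (a b : H) : H := b⁻¹ * a⁻¹ * b * a

/-- The word `[a_g, b_g] ⋯ [a_1, b_1]` (the `i`-th pair being `a (i-1)`, `b (i-1)`). -/
def surfaceWord {H : Type*} [Group H] {g : ℕ} (a b : Fin g → H) : H :=
  (List.ofFn fun i : Fin g => comm (a i.rev) (b i.rev)).prod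

/-- The fundamental group `Γ_g` of the closed oriented surface of genus `g`, by its standard
presentation `⟨a_1, b_1, …, a_g, b_g | [a_g, b_g] ⋯ [a_1, b_1] = 1⟩`. -/
abbrev SurfaceGroup (g : ℕ) : Type :=
  PresentedGroup
    ({surfaceWord (fun i => FreeGroup.of (Sum.inl i)) (fun i => FreeGroup.of (Sum.inr i))} :
      Set (FreeGroup (Fin g ⊕ Fin g)))

/-- A standard generating system of `Γ_g`: elements `a_1, b_1, …, a_g, b_g` which give the
standard presentation of `Γ_g`, that is, sending the `i`-th pair of standard generators to
`(a_i, b_i)` defines an isomorphism of `Γ_g`. These are the based homotopy classes of the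
images, under homeomorphisms of the surface fixing the base point, of a standard
system of loops. -/
def IsStandardSystem {g : ℕ} (a b : Fin g → SurfaceGroup g) : Prop :=
  ∃ φ : SurfaceGroup g ≃* SurfaceGroup g,
    (∀ i, φ (PresentedGroup.of (Sum.inl i)) = a i) ∧
    (∀ i, φ (PresentedGroup.of (Sum.inr i)) = b i)

/-- `i(a, b) = ±1`: `a` and `b` are standard generators of a one-holed torus in the surface,
that is, `(a, b)` is one of the pairs of a standard generating system. -/
def IsStandardPair {g : ℕ} (a b : SurfaceGroup g) : Prop :=
  ∃ x y : Fin g → SurfaceGroup g, IsStandardSystem x y ∧ ∃ i, x i = a ∧ y i = b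

/-! ## The groups `PSL^k(2, ℝ)` and the property `S_k` -/

/-- A vector spanning the line of slope angle `π t`. Sending `t` to this line
identifies `ℝ / ℤ` with the projective line `ℝP¹`. -/
def lineDir (t : ℝ) : Fin 2 → ℝ := ![Real.cos (Real.pi * t), Real.sin (Real.pi * t)]

/-- `f` is a lift of the projective transformation defined by `A` under the `k`-fold covering
`ℝ / ℤ → ℝ / ℤ ≅ ℝP¹` which sends `s` to the line spanned by `lineDir (k * s)`: if `f s = t`,
then `A` sends the line below `s` to the line below `t`. -/
def Lifts (k : ℕ) (f : HomeoPlus) (A : SL(2, ℝ)) : Prop :=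
  ∀ s t : ℝ, (f : S1 ≃ₜ S1) (s : S1) = (t : S1) →
    ∃ c : ℝ, (A : Matrix (Fin 2) (Fin 2) ℝ) *ᵥ lineDir (k * s) = c • lineDir (k * t)

/-- Membership in `PSL^k(2, ℝ)`, the `k`-fold cyclic extension of `PSL(2, ℝ)` acting on the
circle (`k ≥ 1`): the group of all lifts of elements of `PSL(2, ℝ)` to the `k`-fold cover of
`ℝP¹`. -/
def PSLk (k : ℕ) : Subgroup HomeoPlus where
  carrier := {f | ∃ A : SL(2, ℝ), Lifts k f A}
  one_mem' := by
    refine ⟨1, fun s t h => ?_⟩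
    have h' : (s : S1) = (t : S1) := h
    obtain ⟨n, hn⟩ := AddSubgroup.mem_zmultiples_iff.mp (QuotientAddGroup.eq.mp h')
    have ht : t = s + n := by simp at hn; linarith
    refine ⟨Real.cos (((k * n : ℤ) : ℝ) * Real.pi), ?_⟩
    have e : Real.pi * (k * t) = Real.pi * (k * s) + ((k * n : ℤ) : ℝ) * Real.pi := by
      rw [ht]; push_cast; ring
    have hs := Real.sin_int_mul_pi (k * n : ℤ)
    have hc : Real.cos (((k * n : ℤ) : ℝ) * Real.pi) *
        Real.cos (((k * n : ℤ) : ℝ) * Real.pi) = 1 := by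
      have := Real.sin_sq_add_cos_sq (((k * n : ℤ) : ℝ) * Real.pi)
      rw [hs] at this; nlinarith
    simp only [lineDir, e, Real.cos_add, Real.sin_add, hs]
    ext i
    fin_cases i
    · simp only [Matrix.SpecialLinearGroup.coe_one, Matrix.one_mulVec, Fin.zero_eta,
        Matrix.cons_val_zero, Pi.smul_apply, smul_eq_mul]
      linear_combination (-Real.cos (Real.pi * (k * s))) * hc
    · simp only [Matrix.SpecialLinearGroup.coe_one, Matrix.one_mulVec, Fin.mk_one,
        Matrix.cons_val_one, Matrix.cons_val_fin_one, Pi.smul_apply, smul_eq_mul]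
      linear_combination (-Real.sin (Real.pi * (k * s))) * hc
  mul_mem' := by
    rintro f g ⟨A, hA⟩ ⟨B, hB⟩
    refine ⟨A * B, fun s t h => ?_⟩
    obtain ⟨u, hu⟩ := QuotientAddGroup.mk_surjective ((g : S1 ≃ₜ S1) (s : S1))
    obtain ⟨c, hc⟩ := hB s u hu.symm
    have h' : (f : S1 ≃ₜ S1) (u : S1) = (t : S1) := by
      rw [← h]; exact congrArg (f : S1 ≃ₜ S1) hu
    obtain ⟨d, hd⟩ := hA u t h'
    refine ⟨c * d, ?_⟩
    rw [Matrix.SpecialLinearGroup.coe_mul, ← Matrix.mulVec_mulVec, hc, Matrix.mulVec_smul, hd,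
      smul_smul]
  inv_mem' := by
    rintro f ⟨A, hA⟩
    refine ⟨A⁻¹, fun s t h => ?_⟩
    have h' : (f : S1 ≃ₜ S1) (t : S1) = (s : S1) := by
      rw [← h]; exact (f : S1 ≃ₜ S1).apply_symm_apply _
    obtain ⟨c, hc⟩ := hA t s h'
    have key : lineDir (k * t) =
        c • ((A⁻¹ : SL(2, ℝ)) : Matrix (Fin 2) (Fin 2) ℝ) *ᵥ lineDir (k * s) := by
      rw [← Matrix.mulVec_smul, ← hc, Matrix.mulVec_mulVec,
        ← Matrix.SpecialLinearGroup.coe_mul, inv_mul_cancel, Matrix.SpecialLinearGroup.coe_one,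
        Matrix.one_mulVec]
    have hc0 : c ≠ 0 := by
      rintro rfl
      rw [zero_smul] at key
      have h0 := congrFun key 0
      have h1 := congrFun key 1
      simp only [lineDir, Matrix.cons_val_zero, Matrix.cons_val_one, Matrix.cons_val_fin_one,
        Pi.zero_apply] at h0 h1
      have := Real.sin_sq_add_cos_sq (Real.pi * (k * t))
      rw [h0, h1] at this
      norm_num at this
    exact ⟨c⁻¹, by rw [key, smul_smul, inv_mul_cancel₀ hc0, one_smul]⟩

/-- The hyperbolic elements of `PSL^k(2, ℝ)`: those whose projection to `PSL(2, ℝ)` is hyperbolic,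
that is, the class of a matrix with two distinct real eigenvalues. -/
def IsHyperbolicPSLk (k : ℕ) (f : PSLk k) : Prop :=
  ∃ A : SL(2, ℝ), Lifts k (f : HomeoPlus) A ∧ (A : Matrix (Fin 2) (Fin 2) ℝ).IsHyperbolic

/-- Any two distinct points of `P` are separated by `Q`: each of the two open arcs between them
contains a point of `Q` (take both `(x, y)` and `(y, x)`; `sbtw x z y` says that `x, z, y` are
distinct and in positive cyclic order). -/
def SeparatedBy (P Q : Set S1) : Prop :=
  ∀ x ∈ P, ∀ y ∈ P, x ≠ y → ∃ z ∈ Q, sbtw x z y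

/-- The property `S_k(a, b)` of the representation `ρ`. -/
def PropertyS {g : ℕ} (ρ : SurfaceGroup g →* HomeoPlus) (k : ℕ) (a b : SurfaceGroup g) : Prop :=
  IsStandardPair a b ∧
  (∃ f : PSLk k, IsHyperbolicPSLk k f ∧ IsConj (f : HomeoPlus) (ρ a)) ∧
  (∃ f : PSLk k, IsHyperbolicPSLk k f ∧ IsConj (f : HomeoPlus) (ρ b)) ∧
  SeparatedBy (Per (ρ a)) (Per (ρ b)) ∧ SeparatedBy (Per (ρ b)) (Per (ρ a))

end CircleAction

end

noncomputable section
namespace CircleAction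
open Filter Topology Set

/-! ## Lifts of circle homeomorphisms to the line -/

/-! Rotation numbers are continuous and conjugation invariant, hence constant on χ-classes. Along a
path of representations that starts at a path-rigid ρ, the translation numbers of all words in lifts
of the generators are therefore constant. Equality of all translation numbers makes the end of the
path semi-conjugate to ρ, and minimality of ρ makes the semi-conjugacy continuous
(`exists_semiconj_of_family`). The paths used are bendings: if F is joined to the identity inside
the centralizer of a lift A of ρ(a), then replacing a lift B of ρ(b) by F B changes neither the
commutator nor the surface relation. So (A, F B) is semi-conjugate to (A, B), and the roles of A and
B may be exchanged (`bend_of_isStandardPair`). Everything else is extracted from this.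

Rationality (`exists_ratLift`). Suppose A has irrational translation number, and let F be a
semi-conjugacy from A to a translation. It is not injective: otherwise the centralizer of A would
contain a path from the identity to the unit translation, and bending along it would change the
translation number of B. Bending also forces every partner b' of a to permute the fibres of F. Since
a and its partners generate the group (`eq_top_of_partners`), the action preserves a nontrivial
partition into intervals and points, which a minimal action cannot do.

Now let P and Q be the periodic points of A and B, seen as fixed points of return maps; they are
disjoint. On the gaps of P there is a coordinate in which A is a translation by 1 or -1, so every κ
commuting with integer translations acts in that coordinate as a bending. Taking κ to be the
translation by n and letting n tend to infinity shows that the return map of B moves the two ends of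
a gap of P meeting Q in opposite directions (`BendPair.ends`), and that B maps inward gaps into
inward gaps (`BendPair.contr_step`). Taking instead a κ that contracts strongly (`exists_collapse`)
makes the periodic point of F B in an inward gap unique, and the semi-conjugacy turns this into
uniqueness for B. Outward gaps are inward for the inverse of B. So each gap of P contains at most
one point of Q (`BendPair.eq_of_gap`), and symmetrically.

Hence P and Q interlace, with the same finite number N of points per period. Each gap of Q contains
a point of P, so the return map of A moves consecutive points of Q in opposite directions. Its
displacement thus alternates over the gaps of P, so N = 2k is even. Sending the points of P to
multiples of 1/N and the coordinate u of a gap to the angle with tangent exp(u) conjugates A to a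
lift of a diagonal matrix (`exists_conj_hyperbolic`); the same works for B. -/

/-- The increasing homeomorphisms of the line commuting with the unit translation. -/
def liftSubgroup : Subgroup (ℝ ≃o ℝ) where
  carrier := {F | ∀ x, F (x + 1) = F x + 1}
  one_mem' := fun _ => rfl
  mul_mem' := by
    intro F G hF hG x
    change F (G (x + 1)) = F (G x) + 1
    rw [hG, hF]
  inv_mem' := by
    intro F hF x
    apply F.injective
    change F (F.symm (x + 1)) = F (F.symm x + 1)
    rw [hF, F.apply_symm_apply, F.apply_symm_apply]

/-- The group of lifts of orientation-preserving circle homeomorphisms to the line. -/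
def Lft : Type := liftSubgroup

namespace Lft

instance : Group Lft := inferInstanceAs (Group liftSubgroup)

/-- The underlying order isomorphism of a lift. -/
def iso (F : Lft) : ℝ ≃o ℝ := F.1

instance : FunLike Lft ℝ ℝ where
  coe F := F.iso
  coe_injective _ _ h := Subtype.ext (RelIso.ext (congrFun h))

variable (F G : Lft)

@[simp] theorem mul_apply (x : ℝ) : (F * G) x = F (G x) := rfl
@[simp] theorem one_apply (x : ℝ) : (1 : Lft) x = x := rfl
@[simp] theorem inv_apply_self (x : ℝ) : F⁻¹ (F x) = x := F.iso.symm_apply_apply x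
@[simp] theorem apply_inv_self (x : ℝ) : F (F⁻¹ x) = x := F.iso.apply_symm_apply x

@[simp] theorem map_add_one (x : ℝ) : F (x + 1) = F x + 1 := F.2 x

theorem strictMono : StrictMono F := F.iso.strictMono
theorem monotone : Monotone F := F.iso.monotone
theorem injective : Function.Injective F := F.iso.injective
theorem surjective : Function.Surjective F := F.iso.surjective
theorem continuous : Continuous F := F.iso.continuous
@[simp] theorem lt_iff {x y : ℝ} : F x < F y ↔ x < y := F.strictMono.lt_iff_lt
@[simp] theorem le_iff {x y : ℝ} : F x ≤ F y ↔ x ≤ y := F.strictMono.le_iff_le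
@[simp] theorem eq_iff {x y : ℝ} : F x = F y ↔ x = y := F.injective.eq_iff

variable {F G} in
@[ext] theorem ext (h : ∀ x, F x = G x) : F = G := DFunLike.ext _ _ h

variable {F G} in
theorem comm_apply (h : Commute F G) (x : ℝ) : F (G x) = G (F x) := by
  rw [← mul_apply, h.eq, mul_apply]

/-- A lift as a degree one monotone map. -/
def toDeg1 : Lft →* CircleDeg1Lift where
  toFun F := ⟨⟨F, F.monotone⟩, F.map_add_one⟩
  map_one' := rfl
  map_mul' _ _ := rfl

@[simp] theorem toDeg1_apply (x : ℝ) : toDeg1 F x = F x := rfl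

theorem continuous_toDeg1 : Continuous (toDeg1 F) := F.continuous

@[simp] theorem map_add_int (x : ℝ) (n : ℤ) : F (x + n) = F x + n := (toDeg1 F).map_add_int x n
@[simp] theorem map_sub_int (x : ℝ) (n : ℤ) : F (x - n) = F x - n := (toDeg1 F).map_sub_int x n

/-- The translation number of a lift. -/
def tau : ℝ := (toDeg1 F).translationNumber

/-- The translation by an integer. -/
def tr (n : ℤ) : Lft := ⟨OrderIso.addRight (n : ℝ), fun x => add_right_comm x 1 (n : ℝ)⟩

@[simp] theorem tr_apply (n : ℤ) (x : ℝ) : tr n x = x + n := rfl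
@[simp] theorem tr_inv_apply (n : ℤ) (x : ℝ) : (tr n)⁻¹ x = x - n := by
  apply (tr n).injective; simp

theorem tr_inv (n : ℤ) : (tr n)⁻¹ = tr (-n) := by ext x; simp [sub_eq_add_neg]

theorem commute_tr (n : ℤ) : Commute F (tr n) := by
  apply Lft.ext; intro x; simp

theorem commute_tr' (n : ℤ) : Commute (tr n) F := (F.commute_tr n).symm

/-- A strictly increasing surjection of degree one as a lift. -/
def ofSurj (f : ℝ → ℝ) (hm : StrictMono f) (hs : Function.Surjective f)
    (h1 : ∀ x, f (x + 1) = f x + 1) : Lft :=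
  ⟨hm.orderIsoOfSurjective f hs, h1⟩

@[simp] theorem ofSurj_apply (f : ℝ → ℝ) (hm hs h1) (x : ℝ) : ofSurj f hm hs h1 x = f x := rfl

/-- The circle homeomorphism induced by a lift. -/
def homeo : S1 ≃ₜ S1 where
  toFun := Quotient.map' F (by
    intro x y h
    rw [QuotientAddGroup.leftRel_apply] at h ⊢
    obtain ⟨n, hn⟩ := AddSubgroup.mem_zmultiples_iff.mp h
    refine AddSubgroup.mem_zmultiples_iff.mpr ⟨n, ?_⟩
    have : y = x + n := by simp at hn; linarith
    rw [this, map_add_int]; simp)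
  invFun := Quotient.map' (F⁻¹ : Lft) (by
    intro x y h
    rw [QuotientAddGroup.leftRel_apply] at h ⊢
    obtain ⟨n, hn⟩ := AddSubgroup.mem_zmultiples_iff.mp h
    refine AddSubgroup.mem_zmultiples_iff.mpr ⟨n, ?_⟩
    have : y = x + n := by simp at hn; linarith
    rw [this, map_add_int]; simp)
  left_inv := by rintro ⟨x⟩; exact congrArg _ (F.inv_apply_self x)
  right_inv := by rintro ⟨x⟩; exact congrArg _ (F.apply_inv_self x)
  continuous_toFun := F.continuous.quotient_map' _
  continuous_invFun := (F⁻¹).continuous.quotient_map' _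

/-- The projection from lifts to circle homeomorphisms. -/
def proj : Lft →* HomeoPlus where
  toFun F := ⟨F.homeo, F.iso, F.2, fun _ => rfl⟩
  map_one' := by apply Subtype.ext; ext x; induction x using QuotientAddGroup.induction_on; rfl
  map_mul' F G := by
    apply Subtype.ext; ext x; induction x using QuotientAddGroup.induction_on; rfl

@[simp] theorem proj_coe (x : ℝ) : (proj F : S1 ≃ₜ S1) (x : S1) = ((F x : ℝ) : S1) := rfl

theorem proj_surjective : Function.Surjective proj := by
  rintro ⟨f, F, h1, hf⟩
  refine ⟨⟨F, h1⟩, Subtype.ext ?_⟩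
  ext x
  induction x using QuotientAddGroup.induction_on with
  | H x => exact (hf x).symm

theorem coe_eq_coe_iff {x y : ℝ} : (x : S1) = (y : S1) ↔ ∃ n : ℤ, y = x + n := by
  rw [QuotientAddGroup.eq, AddSubgroup.mem_zmultiples_iff]
  constructor
  · rintro ⟨n, hn⟩; exact ⟨n, by simp at hn; linarith⟩
  · rintro ⟨n, rfl⟩; exact ⟨n, by simp⟩

/-- Two lifts of one homeomorphism differ by an integer translation. -/
theorem exists_tr_of_proj_eq {F G : Lft} (h : proj F = proj G) : ∃ n : ℤ, G = tr n * F := by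
  have key : ∀ x : ℝ, ∃ n : ℤ, G x = F x + n := fun x => by
    have : ((F x : ℝ) : S1) = ((G x : ℝ) : S1) := by rw [← proj_coe, ← proj_coe, h]
    exact coe_eq_coe_iff.mp this
  choose n hn using key
  have hc : Continuous fun x => ((n x : ℤ) : ℝ) := by
    have : (fun x => ((n x : ℤ) : ℝ)) = fun x => G x - F x := by
      funext x; rw [hn]; ring
    rw [this]; exact G.continuous.sub F.continuous
  have hc' : Continuous n := by
    refine Int.isClosedEmbedding_coe_real.isInducing.continuous_iff.mpr hc
  refine ⟨n 0, ext fun x => ?_⟩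
  rw [hn, mul_apply, tr_apply, PreconnectedSpace.constant inferInstance hc' (x := x) (y := 0)]
  
end Lft
end CircleAction
end

/-! ### Translation numbers of lifts and continuity of the rotation number -/

noncomputable section
namespace CircleAction
open Filter Topology Set

namespace Lft

variable (F G : Lft)

theorem toDeg1_pow_apply (n : ℕ) (x : ℝ) : ((toDeg1 F) ^ n) x = (F ^ n) x := by
  rw [← map_pow, toDeg1_apply]

@[simp] theorem tau_tr (n : ℤ) : tau (tr n) = n :=
  (toDeg1 (tr n)).translationNumber_of_eq_add_int (x := 0) (by simp)

theorem tau_mul_of_commute {F G : Lft} (h : Commute F G) : tau (F * G) = tau F + tau G := by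
  rw [tau, map_mul, CircleDeg1Lift.translationNumber_mul_of_commute]
  · rfl
  · exact h.map toDeg1

theorem tau_tr_mul (n : ℤ) : tau (tr n * F) = tau F + n := by
  rw [tau_mul_of_commute (F.commute_tr' n), tau_tr, add_comm]

theorem tau_conj : tau (G * F * G⁻¹) = tau F := by
  have h : CircleDeg1Lift.translationNumber (toDeg1 F) =
      CircleDeg1Lift.translationNumber (toDeg1 (G * F * G⁻¹)) :=
    CircleDeg1Lift.translationNumber_eq_of_semiconj (f := toDeg1 G) fun x => by simp
  exact h.symm

theorem abs_pow_sub_tau_le (n : ℕ) : |(F ^ n) 0 - n * tau F| ≤ 1 := by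
  have := (toDeg1 F).dist_pow_map_zero_mul_translationNumber_le n
  rwa [toDeg1_pow_apply, Real.dist_eq] at this

/-- If two lifts are close at a suitable scale, then so are their translation numbers. -/
theorem exists_tau_close {ε : ℝ} (hε : 0 < ε) :
    ∃ η > 0, η < 1 / 2 ∧ ∀ G : Lft, (∀ x, |G x - F x| < η) → |tau G - tau F| < ε := by
  -- The `3` is `1` for the distance between the `n`-th iterates of `0`, plus `1` for each
  -- comparison of an iterate with `n` times its translation number.
  obtain ⟨n, hn⟩ := exists_nat_gt (3 / ε)
  have hn0 : (0 : ℝ) < n := lt_trans (by positivity) hn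
  have hc : Continuous fun η : ℝ => (fun x => η + F x)^[n] 0 := by
    induction n with
    | zero => simpa using continuous_const
    | succ k _ =>
      have : ∀ k : ℕ, Continuous fun η : ℝ => (fun x => η + F x)^[k] 0 := by
        intro k
        induction k with
        | zero => simpa using continuous_const
        | succ k ih =>
          simp only [Function.iterate_succ_apply']
          exact continuous_id.add (F.continuous.comp ih)
      exact this _
  -- `G` is squeezed between `F - η` and `F + η`, and monotonicity passes the squeeze on to `n`-th
  -- powers.
  let E : ℝ → CircleDeg1Lift := fun η =>
    (CircleDeg1Lift.translate (Multiplicative.ofAdd η) : CircleDeg1Lift) * toDeg1 F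
  have hpow : ∀ (η : ℝ), (E η ^ n) 0 = (fun x => η + F x)^[n] 0 := by
    intro η
    rw [CircleDeg1Lift.coe_pow]
    rfl
  have hz : (fun x => (0 : ℝ) + F x)^[n] 0 = (F ^ n) 0 := by
    rw [← hpow 0]
    simp only [E, ofAdd_zero, map_one, Units.val_one, one_mul, toDeg1_pow_apply]
  have hev : ∀ᶠ η in 𝓝 (0 : ℝ), |(fun x => η + F x)^[n] 0 - (F ^ n) 0| < 1 := by
    have := hc.tendsto 0
    rw [hz] at this
    have h2 := this.eventually (Metric.ball_mem_nhds _ one_pos)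
    simpa [Real.dist_eq] using h2
  obtain ⟨δ, hδ, hball⟩ := Metric.eventually_nhds_iff.mp hev
  refine ⟨min (δ / 2) (1 / 4), by positivity, by
    refine lt_of_le_of_lt (min_le_right _ _) (by norm_num), fun G hG => ?_⟩
  set η := min (δ / 2) (1 / 4) with hη
  have hη0 : 0 < η := by positivity
  have hηδ : η < δ := lt_of_le_of_lt (min_le_left _ _) (by linarith)
  have hup : (G ^ n) 0 ≤ (fun x => η + F x)^[n] 0 := by
    rw [← toDeg1_pow_apply, ← hpow η]
    refine CircleDeg1Lift.pow_mono (fun x => ?_) n 0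
    have := (abs_lt.mp (hG x)).2
    change G x ≤ η + F x
    linarith
  have hlo : (fun x => -η + F x)^[n] 0 ≤ (G ^ n) 0 := by
    rw [← toDeg1_pow_apply, ← hpow (-η)]
    refine CircleDeg1Lift.pow_mono (fun x => ?_) n 0
    have := (abs_lt.mp (hG x)).1
    change -η + F x ≤ G x
    linarith
  have h1 := abs_lt.mp (hball (y := η) (by rw [Real.dist_eq, sub_zero, abs_of_pos hη0]; exact hηδ))
  have h2 := abs_lt.mp (hball (y := -η)
    (by rw [Real.dist_eq, sub_zero, abs_neg, abs_of_pos hη0]; exact hηδ))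
  have h3 := abs_le.mp (F.abs_pow_sub_tau_le n)
  have h4 := abs_le.mp (G.abs_pow_sub_tau_le n)
  have h5 : |n * (tau G - tau F)| ≤ 3 := by
    rw [abs_le]; constructor <;> nlinarith
  rw [abs_mul, abs_of_pos hn0] at h5
  have h6 : 3 < n * ε := by rwa [div_lt_iff₀ hε] at hn
  exact lt_of_mul_lt_mul_left (lt_of_le_of_lt h5 h6) hn0.le

end Lft

open Lft

/-- A lift of a circle homeomorphism. -/
def someLift (f : HomeoPlus) : Lft := (proj_surjective f).choose

@[simp] theorem proj_someLift (f : HomeoPlus) : proj (someLift f) = f :=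
  (proj_surjective f).choose_spec

/-- The rotation number of a circle homeomorphism. -/
def rot (f : HomeoPlus) : S1 := ((tau (someLift f) : ℝ) : S1)

theorem rot_proj (F : Lft) : rot (proj F) = ((tau F : ℝ) : S1) := by
  obtain ⟨n, hn⟩ := exists_tr_of_proj_eq (proj_someLift (proj F))
  rw [rot]
  conv_rhs => rw [hn, tau_tr_mul]
  exact coe_eq_coe_iff.mpr ⟨n, rfl⟩

theorem rot_conj (f g : HomeoPlus) : rot (g * f * g⁻¹) = rot f := by
  obtain ⟨F, rfl⟩ := proj_surjective f
  obtain ⟨G, rfl⟩ := proj_surjective g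
  rw [← map_inv, ← map_mul, ← map_mul, rot_proj, rot_proj, tau_conj]

/-- For any lift `G0`, the function `G0 - F` stays within `η ≤ 1/2` of the integers. Being
continuous it cannot cross a half-integer, so one integer is nearest everywhere; subtracting it
gives the required lift. -/
theorem exists_close_lift (F : Lft) {η : ℝ} (hη : η ≤ 1 / 2) (g : HomeoPlus)
    (h : ∀ x : S1, dist ((g : S1 ≃ₜ S1) x) ((proj F : S1 ≃ₜ S1) x) < η) :
    ∃ G : Lft, proj G = g ∧ ∀ x, |G x - F x| < η := by
  obtain ⟨G0, rfl⟩ := proj_surjective g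
  have h0 : ∀ x : ℝ, |(G0 x - F x) - round (G0 x - F x)| < η := by
    intro x
    have := h (x : S1)
    rw [proj_coe, proj_coe, dist_eq_norm, ← AddCircle.coe_sub] at this
    rwa [UnitAddCircle.norm_eq] at this
  set m := round (G0 0 - F 0) with hm
  have hr : Continuous fun x => G0 x - F x - m :=
    (G0.continuous.sub F.continuous).sub continuous_const
  have hne : ∀ (x : ℝ) (e : ℝ), |e| = 1 / 2 → G0 x - F x - m ≠ e := by
    intro x e he hx
    have h1 := h0 x
    have h2 : G0 x - F x = e + m := by linarith
    rw [h2, round_add_intCast] at h1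
    push_cast at h1
    have h3 : |e - round e| < 1 / 2 := by
      refine lt_of_lt_of_le ?_ hη
      rwa [show e + m - (round e + m) = e - round e by ring] at h1
    have h4 := abs_sub_round e
    rcases abs_eq (by norm_num : (0 : ℝ) ≤ 1 / 2) |>.mp he with rfl | rfl
    · have : round (1 / 2 : ℝ) = 1 := by norm_num [round_eq]
      rw [this] at h3; norm_num at h3
    · have : round (-(1 / 2) : ℝ) = 0 := by norm_num [round_eq]
      rw [this] at h3; norm_num at h3
  have hin : ∀ x, |G0 x - F x - m| < 1 / 2 := by
    intro x
    have hz : |G0 0 - F 0 - m| < 1 / 2 := lt_of_lt_of_le (h0 0) hη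
    rw [abs_lt] at hz ⊢
    constructor
    · by_contra hcon
      obtain ⟨y, hy⟩ := mem_range_of_exists_le_of_exists_ge hr ⟨x, not_lt.mp hcon⟩ ⟨0, hz.1.le⟩
      exact hne y _ (by rw [abs_neg, abs_of_pos]; norm_num) hy
    · by_contra hcon
      obtain ⟨y, hy⟩ := mem_range_of_exists_le_of_exists_ge hr ⟨0, hz.2.le⟩ ⟨x, not_lt.mp hcon⟩
      exact hne y _ (by rw [abs_of_pos]; norm_num) hy
  refine ⟨tr (-m) * G0, ?_, fun x => ?_⟩
  · rw [map_mul]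
    have : proj (tr (-m)) = 1 := by
      apply Subtype.ext; ext x
      induction x using QuotientAddGroup.induction_on with
      | H x => exact (coe_eq_coe_iff.mpr ⟨-m, rfl⟩ : (x : S1) = ((x + ((-m : ℤ) : ℝ) : ℝ) : S1)).symm
    rw [this, one_mul]
  · have h1 := h0 x
    have h2 : round (G0 x - F x) = m := by
      have h3 := hin x
      rw [abs_lt] at h3
      have : G0 x - F x = (G0 x - F x - m) + m := by ring
      rw [this, round_add_intCast, (round_eq_zero_iff).mpr ⟨h3.1.le, h3.2⟩, zero_add]
    rw [h2] at h1
    simp only [mul_apply, tr_apply]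
    push_cast
    convert h1 using 2; ring

theorem continuous_rot : Continuous rot := by
  rw [continuous_iff_continuousAt]
  intro f
  obtain ⟨F, rfl⟩ := proj_surjective f
  rw [ContinuousAt, rot_proj]
  intro U hU
  have hU' : (fun x : ℝ => (x : S1)) ⁻¹' U ∈ 𝓝 (tau F) :=
    (AddCircle.continuous_mk' (1 : ℝ)).continuousAt hU
  obtain ⟨ε, hε, hball⟩ := Metric.mem_nhds_iff.mp hU'
  obtain ⟨η, hη0, hη, hcl⟩ := F.exists_tau_close hε
  let Φ : HomeoPlus → C(S1, S1) := fun f => ⟨f.1, f.1.continuous⟩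
  have hΦ : Continuous Φ := continuous_induced_dom
  have hev : ∀ᶠ g in 𝓝 (proj F), dist (Φ g) (Φ (proj F)) < η :=
    hΦ.continuousAt.eventually (Metric.ball_mem_nhds _ hη0)
  refine mem_map.mpr (hev.mono fun g hg => ?_)
  obtain ⟨G, rfl, hG⟩ := exists_close_lift F hη.le g fun x =>
    lt_of_le_of_lt (ContinuousMap.dist_apply_le_dist (f := Φ g) (g := Φ (proj F)) x) hg
  rw [rot_proj]
  exact hball (by rw [Metric.mem_ball, Real.dist_eq]; exact hcl G hG)

/-! ## Families of lifts -/

section Families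

variable {X : Type*} [TopologicalSpace X]

/-- Monotonicity upgrades pointwise to joint continuity: a bound at one nearby point `y` controls
all points on one side of it. -/
theorem continuous_uncurry_of_pointwise {c : X → Lft} (hc : ∀ x, Continuous fun t => c t x) :
    Continuous fun p : X × ℝ => c p.1 p.2 := by
  rw [continuous_iff_continuousAt]
  rintro ⟨t, x⟩
  refine tendsto_order.mpr ⟨fun a ha => ?_, fun a ha => ?_⟩
  · obtain ⟨z, hz1, hz2⟩ := exists_between ha
    obtain ⟨y, rfl⟩ := (c t).surjective z
    have h1 : ∀ᶠ s in 𝓝 t, a < c s y := (hc y).continuousAt.eventually (lt_mem_nhds hz1)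
    have h2 : ∀ᶠ w in 𝓝 x, y < w := lt_mem_nhds ((c t).lt_iff.mp hz2)
    exact (h1.prod_nhds h2).mono fun p hp => hp.1.trans ((c p.1).lt_iff.mpr hp.2)
  · obtain ⟨z, hz1, hz2⟩ := exists_between ha
    obtain ⟨y, rfl⟩ := (c t).surjective z
    have h1 : ∀ᶠ s in 𝓝 t, c s y < a := (hc y).continuousAt.eventually (gt_mem_nhds hz2)
    have h2 : ∀ᶠ w in 𝓝 x, w < y := gt_mem_nhds ((c t).lt_iff.mp hz1)
    exact (h1.prod_nhds h2).mono fun p hp => ((c p.1).lt_iff.mpr hp.2).trans hp.1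

variable (X) in
/-- The group of pointwise continuous families of lifts. -/
def LftFamily : Subgroup (X → Lft) where
  carrier := {c | ∀ x, Continuous fun t => c t x}
  one_mem' := fun _ => continuous_const
  mul_mem' := by
    intro c d hc hd x
    exact (continuous_uncurry_of_pointwise hc).comp (continuous_id.prodMk (hd x))
  inv_mem' := by
    intro c hc x
    rw [continuous_iff_continuousAt]
    intro t
    refine tendsto_order.mpr ⟨fun a ha => ?_, fun a ha => ?_⟩
    · have h1 : c t a < x := by
        have := (c t).lt_iff.mpr ha
        simpa using this
      refine ((hc a).continuousAt.eventually (gt_mem_nhds h1)).mono fun s hs => ?_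
      rw [← (c s).lt_iff]; simpa using hs
    · have h1 : x < c t a := by
        have := (c t).lt_iff.mpr ha
        simpa using this
      refine ((hc a).continuousAt.eventually (lt_mem_nhds h1)).mono fun s hs => ?_
      rw [← (c s).lt_iff]; simpa using hs

theorem const_mem_LftFamily (F : Lft) : (fun _ => F) ∈ LftFamily X := fun _ => continuous_const

theorem continuous_proj_of_mem {c : X → Lft} (hc : c ∈ LftFamily X) :
    Continuous fun t => proj (c t) := by
  refine continuous_induced_rng.mpr ?_
  have h1 : Continuous fun p : X × S1 => (proj (c p.1) : S1 ≃ₜ S1) p.2 := by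
    have hq : IsOpenQuotientMap (Prod.map (id : X → X) (fun x : ℝ => (x : S1))) :=
      IsOpenQuotientMap.id.prodMap QuotientAddGroup.isOpenQuotientMap_mk
    rw [hq.isQuotientMap.continuous_iff]
    exact (AddCircle.continuous_mk' (1 : ℝ)).comp (continuous_uncurry_of_pointwise hc)
  exact (ContinuousMap.curry ⟨_, h1⟩).continuous

/-- The translation number is the limit of `(c t) ^ n 0 / n` with error at most `1 / n` for every
`t`, hence a uniform limit of continuous functions. -/
theorem continuous_tau_of_mem {c : X → Lft} (hc : c ∈ LftFamily X) :
    Continuous fun t => tau (c t) := by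
  have h1 : TendstoUniformly (fun (n : ℕ) t => ((c t) ^ n) 0 / n) (fun t => tau (c t)) atTop := by
    rw [Metric.tendstoUniformly_iff]
    intro ε hε
    obtain ⟨N, hN⟩ := exists_nat_gt (1 / ε)
    filter_upwards [eventually_ge_atTop N] with n hn t
    have hn' : 1 / ε < n := lt_of_lt_of_le hN (by exact_mod_cast hn)
    have hn0 : (0 : ℝ) < n := lt_trans (by positivity) hn'
    have h2 := (c t).abs_pow_sub_tau_le n
    rw [Real.dist_eq, abs_sub_comm]
    have h3 : ((c t) ^ n) 0 / n - tau (c t) = (((c t) ^ n) 0 - n * tau (c t)) / n := by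
      field_simp
    rw [h3, abs_div, abs_of_pos hn0, div_lt_iff₀ hn0]
    rw [div_lt_iff₀ hε] at hn'
    linarith
  refine h1.continuous (Frequently.of_forall fun n => ?_)
  have : c ^ n ∈ LftFamily X := pow_mem hc n
  exact (this 0).div_const _

end Families

end CircleAction
end

/-! ### Rotation numbers on χ-classes and semi-conjugacy along paths of representations -/

open scoped unitInterval
noncomputable section
namespace CircleAction
open Filter Topology Set Lft

/-- For fixed `γ` the rotation number is a continuous conjugation-invariant function with values in
the Hausdorff space `S1`, so it factors through the largest Hausdorff quotient. -/
theorem rot_eq_of_chiEquiv {Γ : Type*} [Group Γ] {ρ₁ ρ₂ : Γ →* HomeoPlus} (h : ChiEquiv ρ₁ ρ₂)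
    (γ : Γ) : rot (ρ₁ γ) = rot (ρ₂ γ) := by
  let f : Quotient (conjSetoid Γ HomeoPlus) → S1 := Quotient.lift (fun ρ => rot (ρ γ)) (by
    rintro ρ ρ' ⟨g, hg⟩
    simp only [hg γ, rot_conj])
  have hf : Continuous f := by
    refine Continuous.quotient_lift (continuous_rot.comp ?_) _
    exact (continuous_apply γ).comp continuous_induced_dom
  have h1 := congrArg (T2Quotient.lift hf) h
  simpa only [character, T2Quotient.lift_mk] using! h1

/-- The range of `h` is invariant under integer translations and under lifts of the minimal action,
hence dense; a monotone map with dense range has no jumps. -/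
theorem denseRange_of_isMinimalRep {Γ : Type*} [Group Γ] {ρ : Γ →* HomeoPlus}
    (hmin : IsMinimalRep ρ) (h : CircleDeg1Lift)
    (hinv : ∀ γ : Γ, ∃ C D : Lft, proj D = ρ γ ∧ ∀ x, h (C x) = D (h x)) : Continuous h := by
  refine h.monotone.continuous_of_denseRange fun y => ?_
  rw [mem_closure_iff]
  intro U hU hy
  have hU' : IsOpen ((fun x : ℝ => (x : S1)) '' U) := QuotientAddGroup.isOpenMap_coe U hU
  obtain ⟨z, ⟨u, hu, rfl⟩, γ, hγ⟩ := (hmin ((h 0 : ℝ) : S1)).inter_open_nonempty _ hU' ⟨_, y, hy, rfl⟩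
  obtain ⟨C, D, hD, hCD⟩ := hinv γ
  simp only [← hD, proj_coe] at hγ
  obtain ⟨n, hn⟩ := coe_eq_coe_iff.mp hγ
  refine ⟨u, hu, C 0 + n, ?_⟩
  rw [h.map_add_int, hCD, hn]

/-- A path of representations of the surface group, through a path of lifts of the generators,
from a path-rigid minimal representation: the end point is semi-conjugate to the start. -/
theorem exists_semiconj_of_family {g : ℕ} {ρ : SurfaceGroup g →* HomeoPlus}
    (hrigid : PathRigid ρ) (hmin : IsMinimalRep ρ) (φ : SurfaceGroup g ≃* SurfaceGroup g)
    (c : Fin g ⊕ Fin g → I → Lft) (hc : ∀ s, c s ∈ LftFamily I)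
    (h0 : ∀ s, proj (c s 0) = ρ (φ (PresentedGroup.of s)))
    (hrel : ∀ t, surfaceWord (fun i => proj (c (Sum.inl i) t)) (fun i => proj (c (Sum.inr i) t)) = 1) :
    ∃ h : CircleDeg1Lift, Continuous h ∧ ∀ s x, h (c s 1 x) = c s 0 (h x) := by
  let cw : FreeGroup (Fin g ⊕ Fin g) →* (I → Lft) := FreeGroup.lift c
  have hcw : ∀ w, cw w ∈ LftFamily I := by
    intro w
    refine FreeGroup.induction_on w ?_ (fun s => ?_) (fun s h => ?_) fun x y hx hy => ?_
    · rw [map_one]; exact one_mem _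
    · rw [FreeGroup.lift_apply_of]; exact hc s
    · rw [map_inv]; exact inv_mem h
    · rw [map_mul]; exact mul_mem hx hy
  have hrel' : ∀ t, ∀ r ∈ ({surfaceWord (fun i => FreeGroup.of (Sum.inl i))
      (fun i => FreeGroup.of (Sum.inr i))} : Set (FreeGroup (Fin g ⊕ Fin g))),
      FreeGroup.lift (fun s => proj (c s t)) r = 1 := by
    intro t r hr
    rw [mem_singleton_iff] at hr
    rw [hr, ← hrel t]
    simp only [surfaceWord, map_list_prod, List.map_ofFn, Function.comp_def, comm, map_mul, map_inv,
      FreeGroup.lift_apply_of]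
  let ρt : I → (SurfaceGroup g →* HomeoPlus) := fun t =>
    (PresentedGroup.toGroup (hrel' t)).comp φ.symm.toMonoidHom
  have hρt : ∀ t w, ρt t (φ (PresentedGroup.mk _ w)) = proj (cw w t) := by
    intro t w
    simp only [ρt, MonoidHom.comp_apply, MulEquiv.toMonoidHom_eq_coe, MonoidHom.coe_coe,
      MulEquiv.symm_apply_apply]
    have h1 : (PresentedGroup.toGroup (hrel' t)).comp (PresentedGroup.mk _) =
        proj.comp ((Pi.evalMonoidHom (fun _ => Lft) t).comp cw) := by
      ext1 s
      change PresentedGroup.toGroup (hrel' t) (PresentedGroup.of s) = proj (cw (FreeGroup.of s) t)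
      rw [PresentedGroup.toGroup.of, FreeGroup.lift_apply_of]
    exact DFunLike.congr_fun h1 w
  have hsurj : ∀ γ, ∃ w, γ = φ (PresentedGroup.mk _ w) := by
    intro γ
    obtain ⟨w, hw⟩ := PresentedGroup.mk_surjective _ (φ.symm γ)
    exact ⟨w, by rw [hw, φ.apply_symm_apply]⟩
  have hρ0 : ρt 0 = ρ := by
    have h1 : (ρt 0).comp (φ.toMonoidHom) = ρ.comp φ.toMonoidHom := by
      refine PresentedGroup.ext fun s => ?_
      have := hρt 0 (FreeGroup.of s)
      simp only [cw, FreeGroup.lift_apply_of, h0] at this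
      exact this
    refine MonoidHom.ext fun γ => ?_
    have := DFunLike.congr_fun h1 (φ.symm γ)
    simpa using! this
  have hcont : Continuous ρt := by
    refine continuous_induced_rng.mpr (continuous_pi fun γ => ?_)
    obtain ⟨w, rfl⟩ := hsurj γ
    simp only [Function.comp_def, hρt]
    exact continuous_proj_of_mem (hcw w)
  -- Each `ρt t` is the end of the path `s ↦ ρt (s * t)` and so lies in the path component of `ρ`.
  have hrot : ∀ t γ, rot (ρt t γ) = rot (ρ γ) := by
    intro t γ
    refine (rot_eq_of_chiEquiv (hrigid ?_) γ).symm
    rw [← hρ0]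
    exact ⟨⟨⟨fun s => ρt (s * t), hcont.comp (continuous_id.mul continuous_const)⟩,
      by simp, by simp⟩⟩
  -- Constant rotation number means that the translation number varies by integers; by continuity it
  -- does not vary.
  have htau : ∀ w, tau (cw w 1) = tau (cw w 0) := by
    intro w
    have hct := continuous_tau_of_mem (hcw w)
    have hint : ∀ t, ∃ n : ℤ, tau (cw w t) = tau (cw w 0) + n := fun t => by
      refine coe_eq_coe_iff.mp ?_
      rw [← rot_proj, ← rot_proj, ← hρt, ← hρt, hrot, hrot]
    choose n hn using hint
    have hn' : Continuous n := by
      refine Int.isClosedEmbedding_coe_real.isInducing.continuous_iff.mpr ?_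
      have : (fun t => ((n t : ℤ) : ℝ)) = fun t => tau (cw w t) - tau (cw w 0) := by
        funext t; rw [hn]; ring
      simpa only [Function.comp_def, this] using! hct.sub continuous_const
    have h1 := hn 0
    rw [hn 1, PreconnectedSpace.constant inferInstance hn' (x := 1) (y := 0)]
    exact h1.symm
  -- The free group acts on the line by lifts at both ends of the path, so the surface relation,
  -- which the lifts need not satisfy, plays no role here. The target is the action at time `0`, the
  -- minimal one.
  obtain ⟨h, hh⟩ := CircleDeg1Lift.semiconj_of_group_action_of_forall_translationNumber_eq
    (toDeg1.comp ((Pi.evalMonoidHom (fun _ : I => Lft) 1).comp cw))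
    (toDeg1.comp ((Pi.evalMonoidHom (fun _ : I => Lft) 0).comp cw)) htau
  refine ⟨h, denseRange_of_isMinimalRep hmin h fun γ => ?_, fun s x => ?_⟩
  · obtain ⟨w, rfl⟩ := hsurj γ
    exact ⟨cw w 1, cw w 0, by rw [← hρt, hρ0], fun x => hh w x⟩
  · have := hh (FreeGroup.of s) x
    simpa [cw] using! this

/-! ## Bending -/

/-- `F` is joined to the identity by a path in the centralizer of `A`. -/
def BendPath (A F : Lft) : Prop :=
  ∃ c ∈ LftFamily I, c 0 = 1 ∧ c 1 = F ∧ ∀ t, Commute (c t) A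

/-- Replacing `B` by `F * B`, for `F` in the identity path component of the centralizer of `A`,
gives a pair which is semi-conjugate to `(A, B)`. -/
def Bend (A B : Lft) : Prop :=
  ∀ F, BendPath A F → ∃ h : CircleDeg1Lift, Continuous h ∧ (∀ x, h (A x) = A (h x)) ∧
    ∀ x, h (F (B x)) = B (h x)

theorem comm_mul_left_of_commute {H : Type*} [Group H] {f a b : H} (h : Commute f b) :
    comm (f * a) b = comm a b := by
  have h' : f⁻¹ * b * f = b := by rw [mul_assoc, ← h.eq, inv_mul_cancel_left]
  calc comm (f * a) b = b⁻¹ * a⁻¹ * (f⁻¹ * b * f) * a := by simp only [comm]; group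
    _ = comm a b := by rw [h', comm]

theorem comm_mul_right_of_commute {H : Type*} [Group H] {f a b : H} (h : Commute f a) :
    comm a (f * b) = comm a b := by
  have h' : f⁻¹ * a⁻¹ * f = a⁻¹ := by
    rw [mul_assoc, ← (h.inv_right).eq, inv_mul_cancel_left]
  calc comm a (f * b) = b⁻¹ * (f⁻¹ * a⁻¹ * f) * b * a := by simp only [comm]; group
    _ = comm a b := by rw [h', comm]

theorem surfaceWord_congr {H : Type*} [Group H] {g : ℕ} {a b a' b' : Fin g → H}
    (h : ∀ i, comm (a i) (b i) = comm (a' i) (b' i)) : surfaceWord a b = surfaceWord a' b' := by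
  simp only [surfaceWord, h]

theorem map_surfaceWord {H K : Type*} [Group H] [Group K] {g : ℕ} (f : H →* K) (a b : Fin g → H) :
    f (surfaceWord a b) = surfaceWord (fun i => f (a i)) (fun i => f (b i)) := by
  simp only [surfaceWord, map_list_prod, List.map_ofFn, Function.comp_def, comm, map_mul, map_inv]

theorem surfaceWord_of {g : ℕ} : surfaceWord (fun i => (PresentedGroup.of (Sum.inl i) : SurfaceGroup g))
    (fun i => PresentedGroup.of (Sum.inr i)) = 1 := by
  have := PresentedGroup.one_of_mem (rels := ({surfaceWord (fun i => FreeGroup.of (Sum.inl i))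
    (fun i => FreeGroup.of (Sum.inr i))} : Set (FreeGroup (Fin g ⊕ Fin g)))) (mem_singleton _)
  rw [map_surfaceWord] at this
  exact this

/-- Only one handle is deformed, and its commutator is kept fixed, so the surface word stays trivial
along the path. -/
theorem exists_semiconj_of_pair {g : ℕ} {ρ : SurfaceGroup g →* HomeoPlus}
    (hrigid : PathRigid ρ) (hmin : IsMinimalRep ρ) {a b : SurfaceGroup g} (hab : IsStandardPair a b)
    (α β : I → Lft) (hα : α ∈ LftFamily I) (hβ : β ∈ LftFamily I)
    (hα0 : proj (α 0) = ρ a) (hβ0 : proj (β 0) = ρ b)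
    (hcomm : ∀ t, comm (α t) (β t) = comm (α 0) (β 0)) :
    ∃ h : CircleDeg1Lift, Continuous h ∧ (∀ x, h (α 1 x) = α 0 (h x)) ∧
      ∀ x, h (β 1 x) = β 0 (h x) := by
  obtain ⟨x, y, ⟨φ, hx, hy⟩, i, rfl, rfl⟩ := hab
  let c : Fin g ⊕ Fin g → I → Lft := Sum.elim
    (fun j => if j = i then α else fun _ => someLift (ρ (x j)))
    (fun j => if j = i then β else fun _ => someLift (ρ (y j)))
  obtain ⟨h, hc, hh⟩ := exists_semiconj_of_family hrigid hmin φ c (by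
      rintro (j | j) <;> simp only [c, Sum.elim_inl, Sum.elim_inr] <;> split_ifs
      exacts [hα, const_mem_LftFamily _, hβ, const_mem_LftFamily _])
    (by
      rintro (j | j) <;> simp only [c, Sum.elim_inl, Sum.elim_inr] <;> split_ifs with hj
      · rw [hj, hα0, hx]
      · rw [proj_someLift, hx]
      · rw [hj, hβ0, hy]
      · rw [proj_someLift, hy])
    (by
      intro t
      have h1 : surfaceWord (fun j => ρ (x j)) (fun j => ρ (y j)) = 1 := by
        have h2 := congrArg (fun γ => ρ (φ γ)) (surfaceWord_of (g := g))
        simp only [map_one] at h2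
        rw [← h2]
        have h3 := map_surfaceWord (ρ.comp φ.toMonoidHom)
          (fun i => (PresentedGroup.of (Sum.inl i) : SurfaceGroup g))
          (fun i => PresentedGroup.of (Sum.inr i))
        simp only [MonoidHom.comp_apply, MulEquiv.toMonoidHom_eq_coe, MonoidHom.coe_coe, hx, hy] at h3
        exact h3.symm
      rw [← h1]
      refine surfaceWord_congr fun j => ?_
      simp only [c, Sum.elim_inl, Sum.elim_inr]
      split_ifs with hj
      · rw [hj, ← hα0, ← hβ0]
        have h4 := congrArg proj (hcomm t)
        simpa only [comm, map_mul, map_inv] using h4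
      · rw [proj_someLift, proj_someLift])
  refine ⟨h, hc, fun z => ?_, fun z => ?_⟩
  · simpa [c] using hh (Sum.inl i) z
  · simpa [c] using hh (Sum.inr i) z

theorem bend_of_isStandardPair {g : ℕ} {ρ : SurfaceGroup g →* HomeoPlus}
    (hrigid : PathRigid ρ) (hmin : IsMinimalRep ρ) {a b : SurfaceGroup g} (hab : IsStandardPair a b)
    {A B : Lft} (hA : proj A = ρ a) (hB : proj B = ρ b) : Bend A B ∧ Bend B A := by
  constructor
  · rintro F ⟨c, hc, hc0, rfl, hcA⟩
    obtain ⟨h, h1, h2, h3⟩ := exists_semiconj_of_pair hrigid hmin hab (fun _ => A)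
      (fun t => c t * B) (const_mem_LftFamily A)
      (mul_mem hc (const_mem_LftFamily B)) hA (by rw [hc0, one_mul, hB])
      fun t => by rw [comm_mul_right_of_commute (hcA t), hc0, one_mul]
    exact ⟨h, h1, h2, fun x => by simpa [hc0] using h3 x⟩
  · rintro F ⟨c, hc, hc0, rfl, hcA⟩
    obtain ⟨h, h1, h2, h3⟩ := exists_semiconj_of_pair hrigid hmin hab (fun t => c t * A)
      (fun _ => B) (mul_mem hc (const_mem_LftFamily A))
      (const_mem_LftFamily B) (by rw [hc0, one_mul, hA]) hB
      fun t => by rw [comm_mul_left_of_commute (hcA t), hc0, one_mul]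
    exact ⟨h, h1, h3, fun x => by simpa [hc0] using h2 x⟩

theorem BendPath.commute {A F : Lft} (h : BendPath A F) : Commute F A := by
  obtain ⟨c, -, -, rfl, hc⟩ := h
  exact hc 1

theorem BendPath.inv {A F : Lft} (h : BendPath A F) : BendPath A F⁻¹ := by
  obtain ⟨c, hc, h0, rfl, hA⟩ := h
  exact ⟨c⁻¹, inv_mem hc, by simp [h0], rfl, fun t => (hA t).inv_left⟩

/-- If `h` works for the bending of `B` by `F⁻¹`, then `h ∘ F⁻¹` works for `F * B⁻¹`, because `F *
B⁻¹` is conjugate by `F` to the inverse of `F⁻¹ * B`. -/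
theorem Bend.inv_right {A B : Lft} (H : Bend A B) : Bend A B⁻¹ := by
  intro F hF
  obtain ⟨h, hc, hA, hB⟩ := H _ hF.inv
  refine ⟨h * toDeg1 F⁻¹, hc.comp (continuous_toDeg1 _), fun x => ?_, fun x => ?_⟩
  · change h (F⁻¹ (A x)) = A (h (F⁻¹ x))
    rw [← hA, comm_apply hF.inv.commute]
  · change h (F⁻¹ (F (B⁻¹ x))) = B⁻¹ (h (F⁻¹ x))
    apply B.injective
    rw [← hB, inv_apply_self, apply_inv_self, apply_inv_self]

end CircleAction
end

open scoped unitInterval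
noncomputable section
namespace CircleAction
open Filter Topology Set Lft

/-! ## Automorphisms of surface groups -/

/-! ### Cutting the surface word into blocks -/

section DescProd

variable {H K : Type*} [Group H] [Group K]

/-- The product `c (m + k - 1) * ⋯ * c m`. -/
def descProd (c : ℕ → H) (m : ℕ) : ℕ → H
  | 0 => 1
  | k + 1 => c (m + k) * descProd c m k

theorem descProd_add (c : ℕ → H) (m k l : ℕ) :
    descProd c m (k + l) = descProd c (m + k) l * descProd c m k := by
  induction l with
  | zero => simp [descProd]
  | succ l ih => rw [← add_assoc, descProd, ih, descProd, mul_assoc, add_assoc]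

theorem descProd_congr {c d : ℕ → H} {m k : ℕ} (h : ∀ j, m ≤ j → j < m + k → c j = d j) :
    descProd c m k = descProd d m k := by
  induction k with
  | zero => rfl
  | succ k ih =>
    rw [descProd, descProd, h _ (by omega) (by omega), ih fun j h1 h2 => h j h1 (by omega)]

theorem map_descProd (f : H →* K) (c : ℕ → H) (m k : ℕ) :
    f (descProd c m k) = descProd (fun j => f (c j)) m k := by
  induction k with
  | zero => exact map_one f
  | succ k ih => rw [descProd, descProd, map_mul, ih]

theorem descProd_mem {N : Subgroup H} {c : ℕ → H} {m k : ℕ} (h : ∀ j, m ≤ j → j < m + k → c j ∈ N) :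
    descProd c m k ∈ N := by
  induction k with
  | zero => exact one_mem N
  | succ k ih => exact mul_mem (h _ (by omega) (by omega)) (ih fun j h1 h2 => h j h1 (by omega))

/-- Extension of a family by `1`. -/
def extOne {g : ℕ} (F : Fin g → H) (n : ℕ) : H := if h : n < g then F ⟨n, h⟩ else 1

theorem extOne_val {g : ℕ} (F : Fin g → H) (i : Fin g) : extOne F i = F i := by
  simp [extOne]

theorem prod_ofFn_rev {g : ℕ} (F : Fin g → H) :
    (List.ofFn fun i => F i.rev).prod = descProd (extOne F) 0 g := by
  induction g with
  | zero => rfl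
  | succ n ih =>
    rw [List.ofFn_succ, List.prod_cons, descProd]
    congr 1
    · simp [extOne, Fin.rev_zero, Fin.last]
    · have := ih (fun i => F i.castSucc)
      simp only [Fin.rev_succ]
      rw [this]
      refine descProd_congr fun j _ hj => ?_
      simp only [zero_add] at hj
      simp [extOne, hj, Nat.lt_succ_of_lt hj]

/-- The product of the commutators strictly between two positions. -/
def midWord {g : ℕ} (a b : Fin g → H) (lo hi : Fin g) : H :=
  descProd (extOne fun i => comm (a i) (b i)) (lo + 1) (hi - lo - 1)

theorem surfaceWord_split {g : ℕ} (a b : Fin g → H) {lo hi : Fin g} (h : lo < hi) :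
    surfaceWord a b = descProd (extOne fun i => comm (a i) (b i)) (hi + 1) (g - hi - 1) *
      (comm (a hi) (b hi) * midWord a b lo hi * comm (a lo) (b lo)) *
        descProd (extOne fun i => comm (a i) (b i)) 0 lo := by
  rw [surfaceWord, prod_ofFn_rev fun i => comm (a i) (b i)]
  have h1 : (lo : ℕ) < hi := h
  have h2 : (hi : ℕ) < g := hi.2
  set c := extOne fun i => comm (a i) (b i) with hc
  have e1 : descProd c 0 g = descProd c (hi + 1) (g - hi - 1) * descProd c 0 (hi + 1) := by
    have := descProd_add c 0 (hi + 1) (g - hi - 1)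
    rwa [show (hi : ℕ) + 1 + (g - hi - 1) = g by omega, zero_add] at this
  have e2 : descProd c 0 hi = descProd c (lo + 1) (hi - lo - 1) * descProd c 0 (lo + 1) := by
    have := descProd_add c 0 (lo + 1) (hi - lo - 1)
    rwa [show (lo : ℕ) + 1 + (hi - lo - 1) = hi by omega, zero_add] at this
  rw [e1, descProd, e2, descProd, zero_add, zero_add, midWord, ← hc]
  have e3 : c hi = comm (a hi) (b hi) := extOne_val _ hi
  have e4 : c lo = comm (a lo) (b lo) := extOne_val _ lo
  rw [e3, e4]
  group

theorem map_midWord {g : ℕ} (f : H →* K) (a b : Fin g → H) (lo hi : Fin g) :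
    f (midWord a b lo hi) = midWord (fun i => f (a i)) (fun i => f (b i)) lo hi := by
  rw [midWord, map_descProd]
  refine descProd_congr fun j _ _ => ?_
  rw [extOne, extOne]
  split_ifs
  · simp only [comm, map_mul, map_inv]
  · exact map_one f

theorem midWord_congr {g : ℕ} {a b a' b' : Fin g → H} {lo hi : Fin g}
    (h : ∀ j, lo < j → j < hi → a j = a' j ∧ b j = b' j) :
    midWord a b lo hi = midWord a' b' lo hi := by
  refine descProd_congr fun j h1 h2 => ?_
  have h3 := hi.2
  by_cases hj : j < g
  · obtain ⟨e1, e2⟩ := h ⟨j, hj⟩ (Fin.lt_def.mpr (by simp; omega)) (Fin.lt_def.mpr (by simp; omega))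
    simp [extOne, hj, e1, e2]
  · simp [extOne, hj]

theorem midWord_mem {g : ℕ} {N : Subgroup H} {a b : Fin g → H} {lo hi : Fin g}
    (h : ∀ j, lo < j → j < hi → a j ∈ N ∧ b j ∈ N) : midWord a b lo hi ∈ N := by
  refine descProd_mem fun j h1 h2 => ?_
  have h3 := hi.2
  by_cases hj : j < g
  · obtain ⟨e1, e2⟩ := h ⟨j, hj⟩ (Fin.lt_def.mpr (by simp; omega)) (Fin.lt_def.mpr (by simp; omega))
    simp only [extOne, hj, dif_pos, comm]
    exact mul_mem (mul_mem (mul_mem (inv_mem e2) (inv_mem e1)) e2) e1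
  · simp [extOne, hj]

/-- Reduces the surface relation, for a substitution that only touches two handles, to an identity
for the block between them. -/
theorem surfaceWord_eq_of_block {g : ℕ} {a b a' b' : Fin g → H} {lo hi : Fin g} (h : lo < hi)
    (hne : ∀ j, j ≠ lo → j ≠ hi → a' j = a j ∧ b' j = b j)
    (hb : comm (a' hi) (b' hi) * midWord a b lo hi * comm (a' lo) (b' lo) =
      comm (a hi) (b hi) * midWord a b lo hi * comm (a lo) (b lo)) :
    surfaceWord a' b' = surfaceWord a b := by
  have hm : midWord a' b' lo hi = midWord a b lo hi :=
    midWord_congr fun j h1 h2 => hne j h1.ne' h2.ne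
  have hd : ∀ m k : ℕ, (∀ j : ℕ, m ≤ j → j < m + k → j ≠ lo ∧ j ≠ hi) →
      descProd (extOne fun i => comm (a' i) (b' i)) m k =
        descProd (extOne fun i => comm (a i) (b i)) m k := by
    intro m k hk
    refine descProd_congr fun j h1 h2 => ?_
    by_cases hj : j < g
    · obtain ⟨e1, e2⟩ := hk j h1 h2
      obtain ⟨e3, e4⟩ := hne ⟨j, hj⟩ (fun e => e1 (by rw [← e])) (fun e => e2 (by rw [← e]))
      simp [extOne, hj, e3, e4]
    · simp [extOne, hj]
  have h' : (lo : ℕ) < hi := h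
  rw [surfaceWord_split a' b' h, surfaceWord_split a b h, hm, hb,
    hd _ _ fun j h1 h2 => ⟨by omega, by omega⟩, hd 0 lo fun j h1 h2 => ⟨by omega, by omega⟩]

end DescProd

/-! ### Dehn twists, handle slides and generation by partners -/

section SurfaceAut

variable {g : ℕ}

/-- The standard generators of the first kind. -/
def genA (i : Fin g) : SurfaceGroup g := PresentedGroup.of (Sum.inl i)

/-- The standard generators of the second kind. -/
def genB (i : Fin g) : SurfaceGroup g := PresentedGroup.of (Sum.inr i)

theorem surfaceWord_gen : surfaceWord (genA (g := g)) genB = 1 := surfaceWord_of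

/-- The homomorphism from a surface group with prescribed values on the generators. -/
def surfHom {H : Type*} [Group H] (a b : Fin g → H) (h : surfaceWord a b = 1) :
    SurfaceGroup g →* H :=
  PresentedGroup.toGroup (f := Sum.elim a b) (by
    intro r hr
    rw [mem_singleton_iff] at hr
    rw [hr, map_surfaceWord]
    simpa only [FreeGroup.lift_apply_of, Sum.elim_inl, Sum.elim_inr] using h)

@[simp] theorem surfHom_genA {H : Type*} [Group H] (a b : Fin g → H) (h) (i : Fin g) :
    surfHom a b h (genA i) = a i := PresentedGroup.toGroup.of _

@[simp] theorem surfHom_genB {H : Type*} [Group H] (a b : Fin g → H) (h) (i : Fin g) :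
    surfHom a b h (genB i) = b i := PresentedGroup.toGroup.of _

theorem surfHom_ext {H : Type*} [Group H] {φ ψ : SurfaceGroup g →* H}
    (hA : ∀ i, φ (genA i) = ψ (genA i)) (hB : ∀ i, φ (genB i) = ψ (genB i)) : φ = ψ := by
  refine PresentedGroup.ext ?_
  rintro (i | i)
  exacts [hA i, hB i]

/-- Two substitutions that respect the relation and undo each other on the generators are mutually
inverse automorphisms. -/
theorem exists_aut {a b a' b' : Fin g → SurfaceGroup g} (h : surfaceWord a b = 1)
    (h' : surfaceWord a' b' = 1)
    (h1 : ∀ i, surfHom a b h (a' i) = genA i ∧ surfHom a b h (b' i) = genB i)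
    (h2 : ∀ i, surfHom a' b' h' (a i) = genA i ∧ surfHom a' b' h' (b i) = genB i) :
    ∃ φ : SurfaceGroup g ≃* SurfaceGroup g, ∀ i, φ (genA i) = a i ∧ φ (genB i) = b i := by
  refine ⟨MonoidHom.toMulEquiv (surfHom a b h) (surfHom a' b' h') ?_ ?_, fun i => ?_⟩
  · exact surfHom_ext (fun i => by simp [h2]) fun i => by simp [h2]
  · exact surfHom_ext (fun i => by simp [h1]) fun i => by simp [h1]
  · simp [MonoidHom.toMulEquiv]

theorem exists_twistB (i : Fin g) : ∃ φ : SurfaceGroup g ≃* SurfaceGroup g,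
    φ (genA i) = genA i ∧ φ (genB i) = genA i * genB i := by
  have h : ∀ k : ℤ, surfaceWord (genA (g := g))
      (Function.update genB i (genA i ^ k * genB i)) = 1 := by
    intro k
    rw [← surfaceWord_gen]
    refine surfaceWord_congr fun j => ?_
    rcases eq_or_ne j i with rfl | hj
    · rw [Function.update_self, comm_mul_right_of_commute ((Commute.refl _).zpow_left k)]
    · rw [Function.update_of_ne hj]
  have hk : ∀ k l : ℤ, k + l = 0 → ∀ j, surfHom _ _ (h k) (genA j) = genA j ∧
      surfHom _ _ (h k) (Function.update genB i (genA i ^ l * genB i) j) = genB j := by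
    intro k l hkl j
    refine ⟨by simp, ?_⟩
    rcases eq_or_ne j i with rfl | hj
    · rw [Function.update_self, map_mul, map_zpow, surfHom_genA, surfHom_genB, Function.update_self,
        ← mul_assoc, ← zpow_add, show l + k = 0 by omega, zpow_zero, one_mul]
    · rw [Function.update_of_ne hj, surfHom_genB, Function.update_of_ne hj]
  obtain ⟨φ, hφ⟩ := exists_aut (h 1) (h (-1)) (hk 1 (-1) (by ring)) (hk (-1) 1 (by ring))
  exact ⟨φ, (hφ i).1, by rw [(hφ i).2, Function.update_self, zpow_one]⟩

theorem exists_twistA (i : Fin g) (k : ℤ) : ∃ φ : SurfaceGroup g ≃* SurfaceGroup g,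
    φ (genA i) = genB i ^ k * genA i ∧ (∀ j, φ (genB j) = genB j) ∧
      ∀ j, j ≠ i → φ (genA j) = genA j := by
  have h : ∀ k : ℤ, surfaceWord (Function.update (genA (g := g)) i (genB i ^ k * genA i)) genB = 1 := by
    intro k
    rw [← surfaceWord_gen]
    refine surfaceWord_congr fun j => ?_
    rcases eq_or_ne j i with rfl | hj
    · rw [Function.update_self, comm_mul_left_of_commute ((Commute.refl _).zpow_left k)]
    · rw [Function.update_of_ne hj]
  have hk : ∀ k l : ℤ, k + l = 0 → ∀ j,
      surfHom _ _ (h k) (Function.update genA i (genB i ^ l * genA i) j) = genA j ∧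
      surfHom _ _ (h k) (genB j) = genB j := by
    intro k l hkl j
    refine ⟨?_, by simp⟩
    rcases eq_or_ne j i with rfl | hj
    · rw [Function.update_self, map_mul, map_zpow, surfHom_genA, surfHom_genB, Function.update_self,
        ← mul_assoc, ← zpow_add, show l + k = 0 by omega, zpow_zero, one_mul]
    · rw [Function.update_of_ne hj, surfHom_genA, Function.update_of_ne hj]
  obtain ⟨φ, hφ⟩ := exists_aut (h k) (h (-k)) (hk k (-k) (by ring)) (hk (-k) k (by ring))
  exact ⟨φ, by rw [(hφ i).1, Function.update_self], fun j => (hφ j).2,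
    fun j hj => by rw [(hφ j).1, Function.update_of_ne hj]⟩

/-- Sliding one handle along another. -/
theorem exists_slide {lo hi : Fin g} (hlt : lo < hi) {M e : SurfaceGroup g}
    (hM : M = midWord genA genB lo hi)
    (he : e = genA hi * M * ((genB lo)⁻¹ * (genA lo)⁻¹ * genB lo) * M⁻¹) :
    ∃ φ : SurfaceGroup g ≃* SurfaceGroup g,
      φ (genA lo) = genA lo ∧ φ (genB lo) = genB lo * (M⁻¹ * e * M) ∧
      φ (genA hi) = e⁻¹ * genA hi * e ∧ φ (genB hi) = e⁻¹ * genB hi := by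
  have hne : lo ≠ hi := hlt.ne
  let a : SurfaceGroup g → Fin g → SurfaceGroup g := fun z =>
    Function.update genA hi (z⁻¹ * genA hi * z)
  let b : SurfaceGroup g → Fin g → SurfaceGroup g := fun z =>
    Function.update (Function.update genB hi (z⁻¹ * genB hi)) lo (genB lo * (M⁻¹ * z * M))
  have ahi : ∀ z, a z hi = z⁻¹ * genA hi * z := fun z => Function.update_self ..
  have ane : ∀ z j, j ≠ hi → a z j = genA j := fun z j hj => Function.update_of_ne hj ..
  have blo : ∀ z, b z lo = genB lo * (M⁻¹ * z * M) := fun z => Function.update_self ..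
  have bhi : ∀ z, b z hi = z⁻¹ * genB hi := fun z => by
    simp only [b]; rw [Function.update_of_ne hne.symm, Function.update_self]
  have bne : ∀ z j, j ≠ lo → j ≠ hi → b z j = genB j := fun z j h1 h2 => by
    simp only [b]; rw [Function.update_of_ne h1, Function.update_of_ne h2]
  -- Regrouped, the block reads `b_hi⁻¹ a_hi⁻¹ b_hi * e * M * a_lo`, and the substitution turns `e`
  -- into `z⁻¹ e z`. This changes nothing when `z` commutes with `e`; moreover `e` is then fixed, so
  -- the substitutions for `e` and `e⁻¹` are inverse to each other.
  have hrel : ∀ z, Commute z e → surfaceWord (a z) (b z) = 1 := by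
    intro z hz
    rw [← surfaceWord_gen]
    refine surfaceWord_eq_of_block hlt (fun j h1 h2 => ⟨ane z j h2, bne z j h1 h2⟩) ?_
    have hz' : z⁻¹ * e * z = e := by rw [mul_assoc, ← hz.eq, inv_mul_cancel_left]
    rw [ahi, bhi, ane z lo hne, blo, ← hM]
    calc _ = (genB hi)⁻¹ * (genA hi)⁻¹ * genB hi * (z⁻¹ * e * z) * M * genA lo := by
          rw [he]; simp only [comm]; group
      _ = _ := by rw [hz', he]; simp only [comm]; group
  have hMz : ∀ z (hz : Commute z e), surfHom _ _ (hrel z hz) M = M := by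
    intro z hz
    conv_lhs => rw [hM, map_midWord]
    rw [hM]
    refine midWord_congr fun j h1 h2 => ⟨?_, ?_⟩
    · rw [surfHom_genA, ane z j h2.ne]
    · rw [surfHom_genB, bne z j h1.ne' h2.ne]
  have hez : ∀ z (hz : Commute z e), surfHom _ _ (hrel z hz) e = e := by
    intro z hz
    have hz' : z⁻¹ * e * z = e := by rw [mul_assoc, ← hz.eq, inv_mul_cancel_left]
    conv_lhs => rw [he]
    simp only [map_mul, map_inv, hMz z hz, surfHom_genA, surfHom_genB, ahi, ane z lo hne, blo]
    calc _ = z⁻¹ * e * z := by rw [he]; group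
      _ = e := hz'
  have hzz : ∀ z (hz : Commute z e), (∀ w, w = e ∨ w = e⁻¹ → surfHom _ _ (hrel z hz) w = w) := by
    rintro z hz w (rfl | rfl)
    · exact hez z hz
    · rw [map_inv, hez z hz]
  have hinv : ∀ z (hz : Commute z e), ∀ w, w = e ∨ w = e⁻¹ → z * w = 1 → ∀ j,
      surfHom _ _ (hrel z hz) (a w j) = genA j ∧ surfHom _ _ (hrel z hz) (b w j) = genB j := by
    intro z hz w hw hzw j
    have hw' := hzz z hz w hw
    have hwz : w = z⁻¹ := (eq_inv_of_mul_eq_one_right hzw)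
    constructor
    · rcases eq_or_ne j hi with rfl | hj
      · rw [ahi, map_mul, map_mul, map_inv, hw', surfHom_genA, ahi, hwz]; group
      · rw [ane w j hj, surfHom_genA, ane z j hj]
    · rcases eq_or_ne j lo with rfl | hj
      · rw [blo, map_mul, map_mul, map_mul, map_inv, hw', hMz z hz, surfHom_genB, blo, hwz]; group
      · rcases eq_or_ne j hi with rfl | hj'
        · rw [bhi, map_mul, map_inv, hw', surfHom_genB, bhi, hwz]; group
        · rw [bne w j hj hj', surfHom_genB, bne z j hj hj']
  have c1 : Commute e e := Commute.refl e
  have c2 : Commute e⁻¹ e := c1.inv_left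
  obtain ⟨φ, hφ⟩ := exists_aut (hrel e c1) (hrel e⁻¹ c2)
    (hinv e c1 e⁻¹ (Or.inr rfl) (mul_inv_cancel e)) (hinv e⁻¹ c2 e (Or.inl rfl) (inv_mul_cancel e))
  exact ⟨φ, by rw [(hφ lo).1, ane e lo hne], by rw [(hφ lo).2, blo], by rw [(hφ hi).1, ahi],
    by rw [(hφ hi).2, bhi]⟩

/-- A subgroup containing `a_i` and all its partners in standard systems is everything. -/
theorem eq_top_of_partners {i : Fin g} {N : Subgroup (SurfaceGroup g)} (hA : genA i ∈ N)
    (hB : ∀ ψ : SurfaceGroup g ≃* SurfaceGroup g, ψ (genA i) = genA i → ψ (genB i) ∈ N) : N = ⊤ := by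
  have hBi : genB i ∈ N := hB (MulEquiv.refl _) rfl
  -- Induction on the distance between the handles `i` and `j`: the word `M` of the handles strictly
  -- between them is then already in `N`.
  have key : ∀ n : ℕ, ∀ j : Fin g, (j : ℤ) - i = n ∨ (i : ℤ) - j = n → genA j ∈ N ∧ genB j ∈ N := by
    intro n
    induction n using Nat.strong_induction_on with
    | _ n ih =>
      intro j hj
      obtain ⟨τ, hτA, hτB, hτne⟩ := exists_twistA j 1
      rw [zpow_one] at hτA
      rcases lt_trichotomy i j with hij | rfl | hij
      · set M := midWord genA genB i j with hM
        have hij' : (i : ℕ) < j := hij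
        have hMN : M ∈ N := midWord_mem fun l h1 h2 => by
          have h1' : (i : ℕ) < l := h1
          have h2' : (l : ℕ) < j := h2
          exact ih (l - i : ℕ) (by omega) l (Or.inl (by omega))
        have hτM : τ M = M := by
          have := map_midWord τ.toMonoidHom genA genB i j
          simp only [MulEquiv.toMonoidHom_eq_coe, MonoidHom.coe_coe] at this
          rw [hM, this]
          exact midWord_congr fun l h1 h2 => ⟨hτne l h2.ne, hτB l⟩
        obtain ⟨φ, h1, h2, h3, h4⟩ := exists_slide hij hM rfl
        have hu : (genB i)⁻¹ * (genA i)⁻¹ * genB i ∈ N := mul_mem (mul_mem (inv_mem hBi) (inv_mem hA)) hBi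
        have m1 := hB φ h1
        -- Following the slide by the twist `a_j ↦ b_j a_j`, which fixes `a_i` and `M`, gives a
        -- second partner of `a_i`. The two partners yield `a_j` and `b_j a_j`.
        have m2 := hB (φ.trans τ) (by simp [h1, hτne i hij.ne])
        simp only [MulEquiv.trans_apply, h2, map_mul, map_inv, hτM, hτB, hτA, hτne i hij.ne] at m1 m2
        have e1 : genA j ∈ N := by
          have : genA j = M * (genB i)⁻¹ * (genB i * (M⁻¹ * (genA j * M *
            ((genB i)⁻¹ * (genA i)⁻¹ * genB i) * M⁻¹) * M)) *
              ((genB i)⁻¹ * (genA i)⁻¹ * genB i)⁻¹ * M⁻¹ := by group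
          rw [this]
          exact mul_mem (mul_mem (mul_mem (mul_mem hMN (inv_mem hBi)) m1) (inv_mem hu)) (inv_mem hMN)
        have e2 : genB j * genA j ∈ N := by
          have : genB j * genA j = M * (genB i)⁻¹ * (genB i * (M⁻¹ * (genB j * genA j * M *
            ((genB i)⁻¹ * (genA i)⁻¹ * genB i) * M⁻¹) * M)) *
              ((genB i)⁻¹ * (genA i)⁻¹ * genB i)⁻¹ * M⁻¹ := by group
          rw [this]
          exact mul_mem (mul_mem (mul_mem (mul_mem hMN (inv_mem hBi)) m2) (inv_mem hu)) (inv_mem hMN)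
        refine ⟨e1, ?_⟩
        have := mul_mem e2 (inv_mem e1)
        rwa [mul_inv_cancel_right] at this
      · exact ⟨hA, hBi⟩
      · set M := midWord genA genB j i with hM
        have hij' : (j : ℕ) < i := hij
        have hMN : M ∈ N := midWord_mem fun l h1 h2 => by
          have h1' : (j : ℕ) < l := h1
          have h2' : (l : ℕ) < i := h2
          exact ih (i - l : ℕ) (by omega) l (Or.inr (by omega))
        have hτM : τ M = M := by
          have := map_midWord τ.toMonoidHom genA genB j i
          simp only [MulEquiv.toMonoidHom_eq_coe, MonoidHom.coe_coe] at this
          rw [hM, this]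
          exact midWord_congr fun l h1 h2 => ⟨hτne l h1.ne', hτB l⟩
        obtain ⟨e, he⟩ : ∃ e, e = genA i * M * ((genB j)⁻¹ * (genA j)⁻¹ * genB j) * M⁻¹ := ⟨_, rfl⟩
        obtain ⟨φ, h1, h2, h3, h4⟩ := exists_slide hij hM he
        have hτe : τ e = genA i * M * ((genB j)⁻¹ * (genB j * genA j)⁻¹ * genB j) * M⁻¹ := by
          rw [he]
          simp only [map_mul, map_inv, hτM, hτB, hτA, hτne i hij.ne']
        have e3 : e * (e⁻¹ * genA i * e) * e⁻¹ = genA i := by group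
        have e4 : e * (e⁻¹ * genB i) * e⁻¹ = genB i * e⁻¹ := by group
        -- As the upper handle, `a_i` is sent by the slide to `e⁻¹ a_i e`. Conjugation by `e` makes
        -- it fixed again, and the partner becomes `b_i e⁻¹`.
        have m1 := hB (φ.trans (MulAut.conj e)) (by
          simp only [MulEquiv.trans_apply, h3, MulAut.conj_apply]; exact e3)
        have m2 := hB ((φ.trans (MulAut.conj e)).trans τ) (by
          simp only [MulEquiv.trans_apply, h3, MulAut.conj_apply, e3, hτne i hij.ne'])
        simp only [MulEquiv.trans_apply, h4, MulAut.conj_apply, e4] at m1 m2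
        rw [map_mul, map_inv, hτB, hτe] at m2
        have e5 : e ∈ N := by
          have := mul_mem (inv_mem hBi) m1
          rw [inv_mul_cancel_left] at this
          exact inv_mem_iff.mp this
        have e6 : genA i * M * ((genB j)⁻¹ * (genB j * genA j)⁻¹ * genB j) * M⁻¹ ∈ N := by
          have := mul_mem (inv_mem hBi) m2
          rw [inv_mul_cancel_left] at this
          exact inv_mem_iff.mp this
        have e7 : (genB j)⁻¹ * (genA j)⁻¹ * genB j ∈ N := by
          have := mul_mem (mul_mem (inv_mem (mul_mem hA hMN)) (he ▸ e5)) hMN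
          convert this using 1
          group
        have e8 : (genB j)⁻¹ * (genA j)⁻¹ ∈ N := by
          have := mul_mem (mul_mem (inv_mem (mul_mem hA hMN)) e6) hMN
          convert this using 1
          group
        have e9 : genB j ∈ N := by
          have := mul_mem (inv_mem e8) e7
          rwa [inv_mul_cancel_left] at this
        refine ⟨?_, e9⟩
        have := mul_mem e9 e8
        rw [mul_inv_cancel_left] at this
        exact inv_mem_iff.mp this
  have hall : ∀ j : Fin g, genA j ∈ N ∧ genB j ∈ N := fun j =>
    key ((j : ℤ) - i).natAbs j (by omega)
  refine top_le_iff.mp fun γ _ => ?_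
  exact PresentedGroup.generated_by _ N (by rintro (j | j); exacts [(hall j).1, (hall j).2]) γ

theorem IsStandardPair.of_aut (φ ψ : SurfaceGroup g ≃* SurfaceGroup g) (i : Fin g) :
    IsStandardPair (φ (ψ (genA i))) (φ (ψ (genB i))) :=
  ⟨fun j => φ (ψ (genA j)), fun j => φ (ψ (genB j)),
    ⟨ψ.trans φ, fun _ => rfl, fun _ => rfl⟩, i, rfl, rfl⟩

theorem IsStandardPair.exists_aut {a b : SurfaceGroup g} (h : IsStandardPair a b) :
    ∃ (φ : SurfaceGroup g ≃* SurfaceGroup g) (i : Fin g), φ (genA i) = a ∧ φ (genB i) = b := by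
  obtain ⟨x, y, ⟨φ, hx, hy⟩, i, rfl, rfl⟩ := h
  exact ⟨φ, i, hx i, hy i⟩

/-- Puts the second member of a pair, up to inversion, in first position, so that results on `a`
apply to `b`. -/
theorem IsStandardPair.swap {a b : SurfaceGroup g} (h : IsStandardPair a b) :
    IsStandardPair b⁻¹ (a * b) := by
  obtain ⟨φ, i, rfl, rfl⟩ := h.exists_aut
  obtain ⟨α, hα1, hα2⟩ := exists_twistB i
  obtain ⟨β, hβ1, hβ2, -⟩ := exists_twistA i (-1)
  have := IsStandardPair.of_aut φ (β.trans α) i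
  convert this using 1
  · simp [hβ1, hα1, hα2]
  · simp [hβ2, hα2]

theorem IsStandardPair.eq_top {a b : SurfaceGroup g} (h : IsStandardPair a b)
    {N : Subgroup (SurfaceGroup g)} (ha : a ∈ N) (hb : ∀ b', IsStandardPair a b' → b' ∈ N) :
    N = ⊤ := by
  obtain ⟨φ, i, rfl, rfl⟩ := h.exists_aut
  have : N.comap φ.toMonoidHom = ⊤ := eq_top_of_partners (i := i) ha fun ψ hψ => by
    have := IsStandardPair.of_aut φ ψ i
    rw [hψ] at this
    exact hb _ this
  refine top_le_iff.mp fun γ _ => ?_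
  have h1 : φ.symm γ ∈ N.comap φ.toMonoidHom := this ▸ Subgroup.mem_top _
  simpa using! h1

end SurfaceAut
end CircleAction
end

open scoped unitInterval
noncomputable section
namespace CircleAction
open Filter Topology Set Lft

/-! ## Lifts with irrational translation number -/

/-- `F` is a continuous semi-conjugacy from `A` to the translation by the irrational `α`. -/
structure IrrSemiconj (A : Lft) (α : ℝ) (F : CircleDeg1Lift) : Prop where
  continuous : Continuous F
  irrational : Irrational α
  semiconj : ∀ x, F (A x) = F x + α

theorem exists_nat_int_between {α : ℝ} (hα : Irrational α) {a b : ℝ} (hab : a < b) :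
    ∃ (n : ℕ) (m : ℤ), a < n * α + m ∧ n * α + m < b := by
  have h1 : DenseRange fun k : ℤ => k • (α : AddCircle (1 : ℝ)) :=
    AddCircle.denseRange_zsmul_coe_iff.mpr (by simpa using! hα)
  have h2 : DenseRange fun k : ℕ => k • (α : AddCircle (1 : ℝ)) := denseRange_zsmul_iff_nsmul.mp h1
  have hU : IsOpen ((fun x : ℝ => (x : S1)) '' Ioo a b) := QuotientAddGroup.isOpenMap_coe _ isOpen_Ioo
  obtain ⟨n, x, hx, hn⟩ := h2.exists_mem_open hU ((nonempty_Ioo.mpr hab).image _)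
  obtain ⟨m, hm⟩ := coe_eq_coe_iff.mp
    (show ((n * α : ℝ) : S1) = (x : S1) by
      rw [show (x : S1) = n • (α : S1) from hn, ← AddCircle.coe_nsmul, nsmul_eq_mul])
  exact ⟨n, m, hm ▸ hx.1, hm ▸ hx.2⟩

theorem zpow_apply_semiconj {A : Lft} {F : CircleDeg1Lift} {α : ℝ} (h : ∀ x, F (A x) = F x + α)
    (n : ℤ) (x : ℝ) : F ((A ^ n) x) = F x + n * α := by
  induction n generalizing x with
  | zero => simp
  | succ n ih =>
    rw [zpow_add_one, mul_apply, ih, h]; push_cast; ring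
  | pred n ih =>
    rw [zpow_sub_one, mul_apply, ih]
    have := h (A⁻¹ x)
    rw [apply_inv_self] at this
    push_cast; linarith

/-- Equality of translation numbers gives a semi-conjugacy to the translation. Its range contains
the points `F 0 + n α + m`, which are dense, so it is continuous. -/
theorem exists_irrSemiconj {A : Lft} (hA : Irrational (tau A)) :
    ∃ F, IrrSemiconj A (tau A) F := by
  obtain ⟨F, hF⟩ := CircleDeg1Lift.semiconj_of_bijective_of_translationNumber_eq
    (f₁ := toDeg1 A) (f₂ := (CircleDeg1Lift.translate (Multiplicative.ofAdd (tau A)) : CircleDeg1Lift))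
    ⟨A.injective, A.surjective⟩
    ⟨fun x y h => by simpa using h, fun y => ⟨-tau A + y, by simp⟩⟩
    (by rw [CircleDeg1Lift.translationNumber_translate]; rfl)
  have hs : ∀ x, F (A x) = F x + tau A := fun x => by
    have := hF x
    rw [toDeg1_apply, CircleDeg1Lift.translate_apply] at this
    rw [this, add_comm]
  refine ⟨F, F.monotone.continuous_of_denseRange fun y => ?_, hA, hs⟩
  rw [mem_closure_iff_nhds]
  intro U hU
  obtain ⟨ε, hε, hb⟩ := Metric.mem_nhds_iff.mp hU
  obtain ⟨n, m, h1, h2⟩ := exists_nat_int_between hA (show y - F 0 - ε < y - F 0 + ε by linarith)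
  refine ⟨F ((A ^ (n : ℤ)) 0 + m), hb ?_, _, rfl⟩
  rw [Metric.mem_ball, Real.dist_eq, F.map_add_int, zpow_apply_semiconj hs, abs_lt]
  push_cast
  constructor <;> linarith

theorem irrational_tau_of_forall {A : Lft}
    (h : ∀ (q : ℕ) (s : ℤ) (x : ℝ), 0 < q → (A ^ q) x ≠ x + s) : Irrational (tau A) := by
  rintro ⟨r, hr⟩
  have h1 : CircleDeg1Lift.translationNumber (toDeg1 A) = (r.num : ℝ) / r.den := by
    change tau A = _
    rw [← hr]
    exact Rat.cast_def r
  rw [CircleDeg1Lift.translationNumber_eq_rat_iff _ (continuous_toDeg1 A) r.den_pos] at h1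
  obtain ⟨x, hx⟩ := h1
  rw [toDeg1_pow_apply] at hx
  exact h _ _ x r.den_pos hx

namespace IrrSemiconj

variable {A : Lft} {α : ℝ} {F : CircleDeg1Lift}

/-- The periodic function `φ - F` does not increase along `A`. Its maximum, attained at `x₀`, is
therefore attained along the whole backward orbit of `x₀`, whose `F`-values are dense modulo
integers. Monotonicity of `φ` then carries the maximal value to every point. -/
theorem eq_add_const (hF : IrrSemiconj A α F) {φ : CircleDeg1Lift} (hc : Continuous φ)
    (hφ : ∀ x, φ (A x) ≤ φ x + α) : ∃ c, ∀ x, φ x = F x + c := by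
  have hper : ∀ (x : ℝ) (n : ℤ), φ (x + n) - F (x + n) = φ x - F x := fun x n => by
    rw [φ.map_add_int, F.map_add_int]; ring
  obtain ⟨x₀, -, hx₀⟩ := isCompact_Icc.exists_isMaxOn (nonempty_Icc.mpr zero_le_one)
    ((hc.sub hF.continuous).continuousOn (s := Icc (0 : ℝ) 1))
  have hmax : ∀ x, φ x - F x ≤ φ x₀ - F x₀ := fun x => by
    have h1 := hx₀ (show Int.fract x ∈ Icc (0 : ℝ) 1 from ⟨Int.fract_nonneg x, (Int.fract_lt_one x).le⟩)
    have h2 := hper x (-⌊x⌋)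
    simp only [mem_ofPred_eq, Pi.sub_apply] at h1
    rw [show x + ((-⌊x⌋ : ℤ) : ℝ) = Int.fract x by rw [Int.fract]; push_cast; ring] at h2
    linarith
  have hback : ∀ n : ℕ, φ ((A ^ (-n : ℤ)) x₀) - F ((A ^ (-n : ℤ)) x₀) = φ x₀ - F x₀ := by
    intro n
    refine le_antisymm (hmax _) ?_
    induction n with
    | zero => simp
    | succ n ih =>
      refine ih.trans ?_
      have e : (A ^ (-n : ℤ)) x₀ = A ((A ^ (-(n + 1 : ℕ) : ℤ)) x₀) := by
        rw [← mul_apply, ← zpow_one_add]; congr 2; push_cast; ring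
      rw [e, hF.semiconj]
      linarith [hφ ((A ^ (-(n + 1 : ℕ) : ℤ)) x₀)]
  refine ⟨φ x₀ - F x₀, fun y => le_antisymm (by linarith [hmax y]) ?_⟩
  refine le_of_forall_pos_le_add fun ε hε => ?_
  obtain ⟨n, m, h1, h2⟩ := exists_nat_int_between hF.irrational
    (show F x₀ - F y < F x₀ - F y + ε by linarith)
  have e1 : F ((A ^ (-n : ℤ)) x₀ - m) = F x₀ - n * α - m := by
    rw [F.map_sub_int, zpow_apply_semiconj hF.semiconj]; push_cast; ring
  have e2 : φ ((A ^ (-n : ℤ)) x₀ - m) = F x₀ - n * α - m + (φ x₀ - F x₀) := by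
    have h3 := hper ((A ^ (-n : ℤ)) x₀) (-m)
    have h4 := hback n
    push_cast at h3
    rw [← sub_eq_add_neg, e1, h4] at h3
    linarith
  have h5 : (A ^ (-n : ℤ)) x₀ - m ≤ y := by
    by_contra hcon
    have := F.monotone (not_le.mp hcon).le
    rw [e1] at this
    linarith
  have := φ.monotone h5
  rw [e2] at this
  linarith

/-- Bending forwards along `B` does not change the semi-conjugacy of `A`. -/
theorem comp_eq (hF : IrrSemiconj A α F) {B H : Lft} (hBA : Bend B A) (hH : BendPath B H)
    (hge : ∀ x, x ≤ H x) (x : ℝ) : F (H x) = F x := by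
  obtain ⟨h, hc, -, h2⟩ := hBA H hH
  have hφ : ∀ x, (F * h) (H (A x)) = (F * h) x + α := fun x => by
    change F (h (H (A x))) = F (h x) + α
    rw [h2, hF.semiconj]
  -- `F ∘ h` is translated by `α` under `H * A`, hence by at most `α` under `A`, since `H` moves
  -- points forwards. So `F ∘ h` is `F` plus a constant, and the equality for `H * A` becomes one
  -- for `F`.
  obtain ⟨c, hcst⟩ := hF.eq_add_const (φ := F * h) (hF.continuous.comp hc) fun x =>
    (hφ x) ▸ (F * h).monotone (hge (A x))
  have h3 := hφ (A⁻¹ x)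
  have h4 := hF.semiconj (A⁻¹ x)
  rw [apply_inv_self] at h3 h4
  rw [hcst, hcst] at h3
  linarith

/-- An injective `F` would conjugate `A` to a translation. The path of translations from the
identity to `tr 1`, conjugated back, centralizes `A`, yet bending `B` by `tr 1` raises its
translation number by `1`. -/
theorem not_injective (hF : IrrSemiconj A α F) {B : Lft} (hAB : Bend A B) :
    ¬ Function.Injective F := by
  intro hinj
  have hsurj := F.continuous_iff_surjective.mp hF.continuous
  let Φ : Lft := ofSurj F (F.monotone.strictMono_of_injective hinj) hsurj F.map_add_one
  let T : I → Lft := fun t => ofSurj (fun x => x + t) (fun _ _ h => by simpa using h)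
    (fun y => ⟨y - t, by ring⟩) fun x => by ring
  have hT : T ∈ LftFamily I := fun x => continuous_const.add continuous_subtype_val
  have hT' : ∀ t x, T t x = x + t := fun _ _ => rfl
  have hΦ : ∀ x, Φ x = F x := fun _ => rfl
  have hbp : BendPath A (tr 1) := by
    refine ⟨fun t => Φ⁻¹ * T t * Φ,
      mul_mem (mul_mem (const_mem_LftFamily _) hT) (const_mem_LftFamily _), ?_, ?_, fun t => ?_⟩
    · ext x
      apply Φ.injective
      simp [hT']
    · ext x
      apply Φ.injective
      simp [hT']
    · apply Lft.ext
      intro x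
      apply Φ.injective
      have h5 : ∀ z, F (Φ⁻¹ z) = z := fun z => by rw [← hΦ, apply_inv_self]
      simp only [mul_apply, hT', hΦ, hF.semiconj, h5]; ring
  obtain ⟨h, -, -, h2⟩ := hAB (tr 1) hbp
  have h3 : tau (tr 1 * B) = tau B := CircleDeg1Lift.translationNumber_eq_of_semiconj (f := h) h2
  rw [tau_tr_mul] at h3
  norm_num at h3

/-- Points in the interior of a fibre can be moved forwards arbitrarily within that fibre by the
identity component of the centralizer. -/
theorem exists_bump (hF : IrrSemiconj A α F) {u v x y : ℝ} (huv : F u = F v) (hux : u < x)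
    (hxy : x < y) (hyv : y < v) : ∃ H, BendPath A H ∧ (∀ z, z ≤ H z) ∧ y ≤ H x := by
  -- The slopes of the affine maps fixing `u`, respectively `v`, and sending `x` to `y`. The minimum
  -- of these maps lies above the identity only inside `(u, v)`.
  set s1 := (y - u) / (x - u) with hs1
  set s2 := (v - y) / (v - x) with hs2
  have hs1' : 1 < s1 := by rw [hs1, lt_div_iff₀ (by linarith)]; linarith
  have hs2p : 0 < s2 := div_pos (by linarith) (by linarith)
  have hs2' : s2 < 1 := by rw [hs2, div_lt_iff₀ (by linarith)]; linarith
  let η : ℝ → ℝ := fun z => max z (min (u + (z - u) * s1) (v - (v - z) * s2))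
  have hηc : Continuous η := by fun_prop
  have hηm : StrictMono η := by
    intro a b hab
    have h1 := mul_lt_mul_of_pos_right (sub_lt_sub_right hab u) (by linarith : 0 < s1)
    have h2 := mul_lt_mul_of_pos_right (sub_lt_sub_left hab v) hs2p
    exact max_lt_max hab (min_lt_min (by linarith) (by linarith))
  have hη_ge : ∀ z, z ≤ η z := fun z => le_max_left _ _
  have hη_lo : ∀ z ≤ u, η z = z := fun z hz => max_eq_left ((min_le_left _ _).trans (by nlinarith))
  have hη_hi : ∀ z, v ≤ z → η z = z := fun z hz =>
    max_eq_left ((min_le_right _ _).trans (by nlinarith))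
  have hηx : η x = y := by
    have e1 : u + (x - u) * s1 = y := by
      rw [hs1, mul_div_cancel₀ _ (by linarith)]; ring
    have e2 : v - (v - x) * s2 = y := by
      rw [hs2, mul_div_cancel₀ _ (by linarith)]; ring
    simp only [η, e1, e2, min_self, max_eq_right hxy.le]
  let e : I → ℝ → ℝ := fun t z => (1 - t) * z + t * η z
  have he_m : ∀ t, StrictMono (e t) := by
    intro t a b hab
    have h1 := hηm hab
    have h2 := t.2.1
    have h3 := t.2.2
    rcases h2.eq_or_lt with h4 | h4
    · simp only [e, ← h4]; linarith
    · change (1 - (t : ℝ)) * a + t * η a < (1 - t) * b + t * η b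
      nlinarith
  have he_ge : ∀ t z, z ≤ e t z := fun t z => by
    have := mul_le_mul_of_nonneg_left (hη_ge z) t.2.1
    simp only [e]; linarith
  have he_lo : ∀ t, ∀ z ≤ u, e t z = z := fun t z hz => by simp only [e, hη_lo z hz]; ring
  have he_hi : ∀ t z, v ≤ z → e t z = z := fun t z hz => by simp only [e, hη_hi z hz]; ring
  have he_s : ∀ t, Function.Surjective (e t) := fun t w => by
    have hcont : Continuous (e t) := by simp only [e]; fun_prop
    refine mem_range_of_exists_le_of_exists_ge hcont ⟨min w u, ?_⟩ ⟨w, he_ge t w⟩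
    rw [he_lo t _ (min_le_right _ _)]; exact min_le_left _ _
  have hfib : ∀ z ∈ Icc u v, F z = F u := fun z hz =>
    le_antisymm (huv ▸ F.monotone hz.2) (F.monotone hz.1)
  have he_F : ∀ t z, F (e t z) = F z := by
    intro t z
    rcases le_total z u with h | h
    · rw [he_lo t z h]
    rcases le_total v z with h' | h'
    · rw [he_hi t z h']
    rw [hfib z ⟨h, h'⟩, hfib]
    exact ⟨h.trans (he_ge t z), (he_hi t v le_rfl) ▸ (he_m t).monotone h'⟩
  let K : ℤ × ℤ → Lft := fun p => tr p.2 * A ^ p.1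
  have hK : ∀ p z, F (K p z) = F z + p.1 * α + p.2 := fun p z => by
    simp only [K, mul_apply, tr_apply, F.map_add_int, zpow_apply_semiconj hF.semiconj]
  let cls : ℝ → ℤ × ℤ → Prop := fun z p => F z = F u + p.1 * α + p.2
  have huniq : ∀ z p p', cls z p → cls z p' → p = p' := by
    rintro z ⟨n, m⟩ ⟨n', m'⟩ h1 h2
    have h3 : ((n - n' : ℤ) : ℝ) * α = ((m' - m : ℤ) : ℝ) := by
      simp only [cls] at h1 h2; push_cast; linarith
    by_cases hn : n - n' = 0
    · rw [hn] at h3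
      have h4 : m' - m = 0 := by exact_mod_cast (by simpa using h3.symm : ((m' - m : ℤ) : ℝ) = 0)
      exact Prod.ext (by simpa using sub_eq_zero.mp hn) (sub_eq_zero.mp h4).symm
    · exact absurd h3 ((hF.irrational.intCast_mul hn).ne_int _)
  classical
  -- The bump on the fibre of `u` is transported to all its images under the group generated by `A`
  -- and the unit translation. Irrationality makes these fibres distinct for distinct group
  -- elements, so the extension is well defined and commutes with `A`.
  let f : I → ℝ → ℝ := fun t z =>
    if h : ∃ p, cls z p then K h.choose (e t ((K h.choose)⁻¹ z)) else z
  have hf_pos : ∀ t z p, cls z p → f t z = K p (e t ((K p)⁻¹ z)) := by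
    intro t z p hp
    have hex : ∃ p, cls z p := ⟨p, hp⟩
    have : hex.choose = p := huniq z _ _ hex.choose_spec hp
    simp only [f, dif_pos hex, this]
  have hf_neg : ∀ t z, (¬ ∃ p, cls z p) → f t z = z := fun t z h => by simp only [f, dif_neg h]
  have hf_F : ∀ t z, F (f t z) = F z := by
    intro t z
    by_cases h : ∃ p, cls z p
    · obtain ⟨p, hp⟩ := h
      rw [hf_pos t z p hp, hK, he_F]
      have := hK p ((K p)⁻¹ z)
      rw [apply_inv_self] at this
      exact this.symm
    · rw [hf_neg t z h]
  have hf_m : ∀ t, StrictMono (f t) := by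
    intro t a b hab
    rcases (F.monotone hab.le).lt_or_eq with h | h
    · by_contra hcon
      have := F.monotone (not_lt.mp hcon)
      rw [hf_F, hf_F] at this
      linarith
    · by_cases hp : ∃ p, cls a p
      · obtain ⟨p, hp⟩ := hp
        rw [hf_pos t a p hp, hf_pos t b p (by simp only [cls] at hp ⊢; rw [← h, hp]), lt_iff]
        exact he_m t ((lt_iff _).mpr hab)
      · rw [hf_neg t a hp, hf_neg t b (by simp only [cls] at hp ⊢; rwa [← h])]
        exact hab
  have hf_s : ∀ t, Function.Surjective (f t) := by
    intro t w
    by_cases hp : ∃ p, cls w p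
    · obtain ⟨p, hp⟩ := hp
      obtain ⟨z, hz⟩ := he_s t ((K p)⁻¹ w)
      refine ⟨K p z, ?_⟩
      have h1 : cls (K p z) p := by
        simp only [cls] at hp ⊢
        rw [← hp, hK, ← he_F t z, hz, ← hK, apply_inv_self]
      rw [hf_pos t _ p h1, inv_apply_self, hz, apply_inv_self]
    · exact ⟨w, hf_neg t w hp⟩
  have hf_comm : ∀ t z (k : ℤ × ℤ), f t (K k z) = K k (f t z) := by
    intro t z k
    have hKadd : ∀ p w, K (p + k) w = K k (K p w) := fun p w => by
      simp only [K, mul_apply, tr_apply, Prod.snd_add, Prod.fst_add, map_add_int]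
      rw [add_comm p.1, zpow_add, mul_apply]; push_cast; ring
    by_cases hp : ∃ p, cls z p
    · obtain ⟨p, hp⟩ := hp
      have h1 : cls (K k z) (p + k) := by
        simp only [cls] at hp ⊢
        rw [hK, hp]; simp only [Prod.snd_add, Prod.fst_add]; push_cast; ring
      rw [hf_pos t z p hp, hf_pos t _ _ h1, hKadd]
      congr 3
      apply (K (p + k)).injective
      rw [apply_inv_self, hKadd, apply_inv_self]
    · rw [hf_neg t z hp, hf_neg]
      rintro ⟨p, h1⟩
      refine hp ⟨p - k, ?_⟩
      simp only [cls] at h1 ⊢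
      rw [hK] at h1
      simp only [Prod.snd_sub, Prod.fst_sub]; push_cast; linarith
  have hf1 : ∀ t z, f t (z + 1) = f t z + 1 := fun t z => by
    simpa [K] using hf_comm t z (0, 1)
  have hfx : f 1 x = y := by
    have h1 : cls x (0, 0) := by simpa [cls] using hfib x ⟨hux.le, (hxy.trans hyv).le⟩
    rw [hf_pos 1 x _ h1]
    have : K (0, 0) = 1 := by ext; simp [K]
    rw [this]; simp [e, hηx]
  have hf_ge : ∀ t z, z ≤ f t z := by
    intro t z
    by_cases hp : ∃ p, cls z p
    · obtain ⟨p, hp⟩ := hp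
      rw [hf_pos t z p hp]
      calc z = K p ((K p)⁻¹ z) := (apply_inv_self _ _).symm
        _ ≤ _ := (le_iff _).mpr (he_ge t _)
    · rw [hf_neg t z hp]
  refine ⟨ofSurj (f 1) (hf_m 1) (hf_s 1) (hf1 1),
    ⟨fun t => ofSurj (f t) (hf_m t) (hf_s t) (hf1 t), fun z => ?_, ?_, rfl, fun t => ?_⟩,
    hf_ge 1, hfx.ge⟩
  · simp only [ofSurj_apply]
    by_cases hp : ∃ p, cls z p
    · obtain ⟨p, hp⟩ := hp
      simp only [hf_pos _ z p hp]
      refine (K p).continuous.comp ?_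
      simp only [e]
      fun_prop
    · simp only [hf_neg _ z hp]; exact continuous_const
  · ext z
    rw [ofSurj_apply, one_apply]
    by_cases hp : ∃ p, cls z p
    · obtain ⟨p, hp⟩ := hp
      simp [hf_pos _ z p hp, e]
    · rw [hf_neg _ z hp]
  · apply Lft.ext
    intro z
    simpa [K] using hf_comm t z (1, 0)

end IrrSemiconj

end CircleAction
end

open scoped unitInterval
noncomputable section
namespace CircleAction
open Filter Topology Set Lft

/-! ## Gaps of a periodic closed set -/

/-- The closed nonempty subsets of the line which are invariant under the unit translation. -/
structure PerSet (P : Set ℝ) : Prop where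
  closed : IsClosed P
  nonempty : P.Nonempty
  add_one : ∀ x, x + 1 ∈ P ↔ x ∈ P

/-- The last point of `P` up to `x`. -/
def lo (P : Set ℝ) (x : ℝ) : ℝ := sSup (P ∩ Iic x)

/-- The first point of `P` from `x` on. -/
def hi (P : Set ℝ) (x : ℝ) : ℝ := sInf (P ∩ Ici x)

namespace PerSet

variable {P : Set ℝ} (hP : PerSet P)
include hP

theorem add_int (x : ℝ) (n : ℤ) : x + n ∈ P ↔ x ∈ P := by
  induction n with
  | zero => simp
  | succ n ih => rw [← ih, ← hP.add_one (x + ((n : ℤ) : ℝ))]; push_cast; rw [add_assoc]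
  | pred n ih => rw [← ih, ← hP.add_one (x + _)]; push_cast; ring_nf

theorem exists_le (x : ℝ) : ∃ p ∈ P, p ≤ x := by
  obtain ⟨p, hp⟩ := hP.nonempty
  refine ⟨p + (-⌈p - x⌉ : ℤ), (hP.add_int _ _).mpr hp, ?_⟩
  push_cast
  linarith [Int.le_ceil (p - x)]

theorem exists_ge (x : ℝ) : ∃ p ∈ P, x ≤ p := by
  obtain ⟨p, hp⟩ := hP.nonempty
  refine ⟨p + (⌈x - p⌉ : ℤ), (hP.add_int _ _).mpr hp, ?_⟩
  linarith [Int.le_ceil (x - p)]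

theorem lo_mem' (x : ℝ) : lo P x ∈ P ∩ Iic x :=
  (hP.closed.inter isClosed_Iic).csSup_mem
    (by obtain ⟨p, h, h'⟩ := hP.exists_le x; exact ⟨p, h, h'⟩) ⟨x, fun _ h => h.2⟩

theorem hi_mem' (x : ℝ) : hi P x ∈ P ∩ Ici x :=
  (hP.closed.inter isClosed_Ici).csInf_mem
    (by obtain ⟨p, h, h'⟩ := hP.exists_ge x; exact ⟨p, h, h'⟩) ⟨x, fun _ h => h.2⟩

theorem lo_mem (x : ℝ) : lo P x ∈ P := (hP.lo_mem' x).1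
theorem hi_mem (x : ℝ) : hi P x ∈ P := (hP.hi_mem' x).1
theorem lo_le (x : ℝ) : lo P x ≤ x := (hP.lo_mem' x).2
theorem le_hi (x : ℝ) : x ≤ hi P x := (hP.hi_mem' x).2

omit hP in
theorem le_lo {p x : ℝ} (hp : p ∈ P) (h : p ≤ x) : p ≤ lo P x :=
  le_csSup ⟨x, fun _ h => h.2⟩ ⟨hp, h⟩

omit hP in
theorem hi_le {p x : ℝ} (hp : p ∈ P) (h : x ≤ p) : hi P x ≤ p :=
  csInf_le ⟨x, fun _ h => h.2⟩ ⟨hp, h⟩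

theorem lo_lt {x : ℝ} (hx : x ∉ P) : lo P x < x :=
  (hP.lo_le x).lt_of_ne fun h => hx (h ▸ hP.lo_mem x)

theorem lt_hi {x : ℝ} (hx : x ∉ P) : x < hi P x :=
  (hP.le_hi x).lt_of_ne fun h => hx (h ▸ hP.hi_mem x)

theorem lo_eq {p x : ℝ} (hp : p ∈ P) (hpx : p ≤ x) (h : ∀ p' ∈ P, p' ≤ x → p' ≤ p) :
    lo P x = p :=
  le_antisymm (h _ (hP.lo_mem x) (hP.lo_le x)) (le_lo hp hpx)

theorem hi_eq {p x : ℝ} (hp : p ∈ P) (hpx : x ≤ p) (h : ∀ p' ∈ P, x ≤ p' → p ≤ p') :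
    hi P x = p :=
  le_antisymm (hi_le hp hpx) (h _ (hP.hi_mem x) (hP.le_hi x))

theorem lo_of_mem {x : ℝ} (hx : x ∈ P) : lo P x = x := hP.lo_eq hx le_rfl fun _ _ h => h

theorem lo_mono : Monotone (lo P) := fun x _ h => le_lo (hP.lo_mem x) ((hP.lo_le x).trans h)

theorem self_mem_gap {x : ℝ} (hx : x ∉ P) : x ∈ Ioo (lo P x) (hi P x) := ⟨hP.lo_lt hx, hP.lt_hi hx⟩

omit hP in
theorem not_mem_of_gap {x y : ℝ} (hy : y ∈ Ioo (lo P x) (hi P x)) : y ∉ P := fun h => by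
  rcases le_total y x with h' | h'
  · exact absurd (le_lo h h') (not_le.mpr hy.1)
  · exact absurd (hi_le h h') (not_le.mpr hy.2)

theorem lo_eq_of_gap {x y : ℝ} (hy : y ∈ Ioo (lo P x) (hi P x)) : lo P y = lo P x := by
  refine hP.lo_eq (hP.lo_mem x) hy.1.le fun p hp h => ?_
  rcases le_total p x with h' | h'
  · exact le_lo hp h'
  · exact absurd ((hi_le hp h').trans h) (not_le.mpr hy.2)

theorem hi_eq_of_gap {x y : ℝ} (hy : y ∈ Ioo (lo P x) (hi P x)) : hi P y = hi P x := by
  refine hP.hi_eq (hP.hi_mem x) hy.2.le fun p hp h => ?_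
  rcases le_total p x with h' | h'
  · exact absurd (h.trans (le_lo hp h')) (not_le.mpr hy.1)
  · exact hi_le hp h'

theorem lo_map {G : Lft} (hG : ∀ x, G x ∈ P ↔ x ∈ P) (x : ℝ) : lo P (G x) = G (lo P x) := by
  refine hP.lo_eq ((hG _).mpr (hP.lo_mem x)) ((G.le_iff).mpr (hP.lo_le x)) fun p hp h => ?_
  obtain ⟨p, rfl⟩ := G.surjective p
  exact G.le_iff.mpr (le_lo ((hG p).mp hp) (G.le_iff.mp h))

theorem hi_map {G : Lft} (hG : ∀ x, G x ∈ P ↔ x ∈ P) (x : ℝ) : hi P (G x) = G (hi P x) := by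
  refine hP.hi_eq ((hG _).mpr (hP.hi_mem x)) ((G.le_iff).mpr (hP.le_hi x)) fun p hp h => ?_
  obtain ⟨p, rfl⟩ := G.surjective p
  exact G.le_iff.mpr (hi_le ((hG p).mp hp) (G.le_iff.mp h))

theorem lo_add_int (x : ℝ) (n : ℤ) : lo P (x + n) = lo P x + n :=
  hP.lo_map (G := tr n) (fun x => hP.add_int x n) x

theorem hi_add_int (x : ℝ) (n : ℤ) : hi P (x + n) = hi P x + n :=
  hP.hi_map (G := tr n) (fun x => hP.add_int x n) x

/-- Points of different gaps are separated by the end points. -/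
theorem hi_le_lo {x y : ℝ} (hxy : x ≤ y) (h : lo P x ≠ lo P y) : hi P x ≤ lo P y := by
  have h1 : lo P x < lo P y := (hP.lo_mono hxy).lt_of_ne h
  have h2 : x ≤ lo P y := by
    by_contra hcon
    exact absurd (le_lo (hP.lo_mem y) (not_le.mp hcon).le) (not_le.mpr h1)
  exact hi_le (hP.lo_mem y) h2

theorem mem_gap_of_lo_eq {x y : ℝ} (hx : x ∉ P) (hy : y ∉ P) (h : lo P x = lo P y) :
    y ∈ Ioo (lo P x) (hi P x) := by
  refine ⟨h ▸ hP.lo_lt hy, ?_⟩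
  by_contra hcon
  have := le_lo (hP.hi_mem x) (not_lt.mp hcon)
  rw [← h] at this
  linarith [hP.lo_lt hx, hP.lt_hi hx]

end PerSet

/-! ## Translation coordinates on an interval without fixed points -/

/-- A parametrization of the orbit space of `S` through `c`, conjugating the unit translation
to `S`. -/
def theta (S : Lft) (c t : ℝ) : ℝ := (S ^ ⌊t⌋) (c + Int.fract t * (S c - c))

section Theta

variable {S : Lft} {c : ℝ}

theorem theta_add_one (t : ℝ) : theta S c (t + 1) = S (theta S c t) := by
  simp only [theta, Int.floor_add_one, Int.fract_add_one]
  rw [add_comm, zpow_one_add, mul_apply]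

theorem theta_shift (n : ℤ) (t : ℝ) : theta S (c + n) t = theta S c t + n := by
  simp only [theta]
  rw [← map_add_int, map_add_int S]
  congr 1
  ring

theorem theta_bounds (hc : c < S c) (t : ℝ) :
    (S ^ ⌊t⌋) c ≤ theta S c t ∧ theta S c t < (S ^ (⌊t⌋ + 1)) c := by
  have h0 := Int.fract_nonneg t
  have h1 := Int.fract_lt_one t
  rw [zpow_add_one, mul_apply, theta, le_iff, lt_iff]
  constructor <;> nlinarith

theorem zpow_apply_strictMono (hc : c < S c) : StrictMono fun n : ℤ => (S ^ n) c := by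
  refine strictMono_int_of_lt_succ fun n => ?_
  rw [zpow_add_one, mul_apply, lt_iff]
  exact hc

theorem theta_strictMono (hc : c < S c) : StrictMono (theta S c) := by
  intro s t hst
  rcases (Int.floor_mono hst.le).lt_or_eq with h | h
  · exact ((theta_bounds hc s).2.trans_le ((zpow_apply_strictMono hc).monotone h)).trans_le
      (theta_bounds hc t).1
  · simp only [theta, h]
    rw [lt_iff]
    have : Int.fract s < Int.fract t := by
      simp only [Int.fract, h]; linarith
    nlinarith

/-- A bounded forward orbit would converge to a fixed point inside the interval. -/
theorem exists_pow_gt {l r x : ℝ} (hc : c ∈ Ioo l r) (hx : x < r) (hS : ∀ y ∈ Ioo l r, y < S y) :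
    ∃ n : ℕ, x < (S ^ n) c := by
  by_contra! hcon
  have hm : Monotone fun n : ℕ => (S ^ n) c := monotone_nat_of_le_succ fun n => by
    rw [pow_succ, mul_apply, le_iff]; exact (hS c hc).le
  have hb : BddAbove (range fun n : ℕ => (S ^ n) c) := ⟨x, by rintro _ ⟨n, rfl⟩; exact hcon n⟩
  have ht := tendsto_atTop_ciSup hm hb
  set L := ⨆ n : ℕ, (S ^ n) c
  have h1 : S L = L := by
    have h2 := (S.continuous.tendsto L).comp ht
    have h3 := ht.comp (tendsto_add_atTop_nat 1)
    refine tendsto_nhds_unique (h2.congr fun n => ?_) h3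
    simp only [Function.comp_apply, pow_succ', mul_apply]
  have h2 : c ≤ L := le_ciSup hb 0
  have h3 : L ≤ x := ciSup_le hcon
  exact absurd h1 (hS L ⟨hc.1.trans_le h2, h3.trans_lt hx⟩).ne'

theorem exists_pow_inv_lt {l r x : ℝ} (hc : c ∈ Ioo l r) (hx : l < x)
    (hS : ∀ y ∈ Ioo l r, S⁻¹ y < y) : ∃ n : ℕ, (S⁻¹ ^ n) c < x := by
  by_contra! hcon
  have hm : Antitone fun n : ℕ => (S⁻¹ ^ n) c := antitone_nat_of_succ_le fun n => by
    rw [pow_succ, mul_apply, le_iff]; exact (hS c hc).le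
  have hb : BddBelow (range fun n : ℕ => (S⁻¹ ^ n) c) := ⟨x, by rintro _ ⟨n, rfl⟩; exact hcon n⟩
  have ht := tendsto_atTop_ciInf hm hb
  set L := ⨅ n : ℕ, (S⁻¹ ^ n) c
  have h1 : S⁻¹ L = L := by
    have h2 := ((S⁻¹).continuous.tendsto L).comp ht
    have h3 := ht.comp (tendsto_add_atTop_nat 1)
    refine tendsto_nhds_unique (h2.congr fun n => ?_) h3
    simp only [Function.comp_apply, pow_succ', mul_apply]
  have h2 : L ≤ c := ciInf_le hb 0
  have h3 : x ≤ L := le_ciInf hcon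
  exact absurd h1 (hS L ⟨hx.trans_le h3, h2.trans_lt hc.2⟩).ne

/-- The images of `[c, S c)` under powers of `S` cover the interval; the greatest `k` with `(S ^ k)
c ≤ x` picks the one containing `x`. -/
theorem exists_theta_eq {l r x : ℝ} (hS : ∀ y ∈ Ioo l r, y < S y)
    (hc : c ∈ Ioo l r) (hx : x ∈ Ioo l r) : ∃ t, theta S c t = x := by
  have hcS := hS c hc
  have hS' : ∀ y ∈ Ioo l r, S⁻¹ y < y := fun y hy => by
    rw [← S.lt_iff, apply_inv_self]; exact hS y hy
  obtain ⟨n, hn⟩ := exists_pow_gt hc hx.2 hS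
  obtain ⟨m, hm⟩ := exists_pow_inv_lt hc hx.1 hS'
  obtain ⟨k, hk, hk'⟩ := Int.exists_greatest_of_bdd (P := fun k : ℤ => (S ^ k) c ≤ x)
    ⟨n, fun z hz => by
      by_contra hcon
      have := (zpow_apply_strictMono hcS).monotone (not_le.mp hcon).le
      simp only [zpow_natCast] at this
      linarith⟩ ⟨-m, by rw [zpow_neg, zpow_natCast, ← inv_pow]; exact hm.le⟩
  have hk2 : x < (S ^ (k + 1)) c := by
    by_contra hcon
    have := hk' (k + 1) (not_lt.mp hcon)
    omega
  set w := (S ^ k)⁻¹ x with hw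
  have hxw : x = (S ^ k) w := by rw [hw, apply_inv_self]
  rw [hxw, zpow_add_one, mul_apply, lt_iff] at hk2
  rw [hxw, le_iff] at hk
  refine ⟨k + (w - c) / (S c - c), ?_⟩
  have hd : 0 < S c - c := sub_pos.mpr hcS
  have h1 : 0 ≤ (w - c) / (S c - c) := div_nonneg (sub_nonneg.mpr hk) hd.le
  have h2 : (w - c) / (S c - c) < 1 := by rw [div_lt_one hd]; linarith
  have h3 : ⌊(w - c) / (S c - c)⌋ = 0 := Int.floor_eq_zero_iff.mpr ⟨h1, h2⟩
  rw [theta, Int.floor_intCast_add, h3, Int.fract_intCast_add, Int.fract, h3, hxw]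
  simp only [add_zero, Int.cast_zero, sub_zero]
  rw [div_mul_cancel₀ _ hd.ne']
  congr 1
  ring

theorem zpow_fixed {l : ℝ} (hl : S l = l) (n : ℤ) : (S ^ n) l = l := by
  induction n with
  | zero => simp
  | succ n ih => rw [zpow_add_one, mul_apply, hl, ih]
  | pred n ih =>
    rw [zpow_sub_one, mul_apply]
    have : S⁻¹ l = l := by apply S.injective; rw [apply_inv_self, hl]
    rw [this, ih]

theorem theta_mem {l r : ℝ} (hl : S l = l) (hr : S r = r) (hc : c ∈ Ioo l r) (hcS : c < S c)
    (t : ℝ) : theta S c t ∈ Ioo l r := by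
  have h := theta_bounds hcS t
  constructor
  · refine lt_of_lt_of_le ?_ h.1
    conv_lhs => rw [← zpow_fixed hl ⌊t⌋]
    exact (lt_iff _).mpr hc.1
  · refine h.2.trans ?_
    conv_rhs => rw [← zpow_fixed hr (⌊t⌋ + 1)]
    exact (lt_iff _).mpr hc.2

end Theta

theorem continuousOn_of_strictMonoOn_surjOn {f : ℝ → ℝ} {l r : ℝ} (hm : StrictMonoOn f (Ioo l r))
    (hs : ∀ t, ∃ y ∈ Ioo l r, f y = t) : ContinuousOn f (Ioo l r) := by
  rw [continuousOn_iff_continuous_domRestrict]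
  have hm' : StrictMono ((Ioo l r).domRestrict f) := fun x y h => hm x.2 y.2 h
  exact (hm'.orderIsoOfSurjective _ fun t => by
    obtain ⟨y, hy, h⟩ := hs t; exact ⟨⟨y, hy⟩, h⟩).continuous

end CircleAction
end

open scoped unitInterval
noncomputable section
namespace CircleAction
open Filter Topology Set Lft

/-! ## Lifts with rational translation number -/

/-- The lift `A` has a periodic orbit of period `q` modulo the translation by `s`. -/
structure RatLift (A : Lft) (q : ℕ) (s : ℤ) : Prop where
  pos : 0 < q
  exists_fix : ∃ x, (A ^ q) x = x + s

/-- The return map `A ^ q - s`. -/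
def ret (A : Lft) (q : ℕ) (s : ℤ) : Lft := tr (-s) * A ^ q

/-- The fixed points of the return map, that is, the periodic points. -/
def perSet (A : Lft) (q : ℕ) (s : ℤ) : Set ℝ := {x | ret A q s x = x}

theorem commute_ret (A : Lft) (q : ℕ) (s : ℤ) : Commute A (ret A q s) :=
  (A.commute_tr _).mul_right (Commute.self_pow A q)

theorem ret_apply (A : Lft) (q : ℕ) (s : ℤ) (x : ℝ) : ret A q s x = (A ^ q) x - s := by
  simp [ret, sub_eq_add_neg]

theorem mem_perSet {A : Lft} {q : ℕ} {s : ℤ} {x : ℝ} : x ∈ perSet A q s ↔ ret A q s x = x := Iff.rfl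

/-- The sign of the displacement of `S` at `x`. -/
def sg (S : Lft) (x : ℝ) : ℤ := SignType.sign (S x - x)

theorem sg_of_lt {S : Lft} {x : ℝ} (h : x < S x) : sg S x = 1 := by
  rw [sg, sign_pos (sub_pos.mpr h)]; rfl

theorem sg_of_gt {S : Lft} {x : ℝ} (h : S x < x) : sg S x = -1 := by
  rw [sg, sign_neg (sub_neg.mpr h)]; rfl

section RatLift

variable {A : Lft} {q : ℕ} {s : ℤ}

theorem map_mem_perSet_iff {G : Lft} (hG : Commute G A) (x : ℝ) :
    G x ∈ perSet A q s ↔ x ∈ perSet A q s := by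
  have h : Commute G (ret A q s) := (G.commute_tr _).mul_right (hG.pow_right q)
  rw [mem_perSet, mem_perSet, ← comm_apply h, eq_iff]

theorem self_mem_perSet_iff (x : ℝ) : A x ∈ perSet A q s ↔ x ∈ perSet A q s :=
  map_mem_perSet_iff (Commute.refl A) x

theorem ret_fix {x : ℝ} (hx : x ∈ perSet A q s) : ret A q s x = x := hx

theorem RatLift.perSet (hA : RatLift A q s) : PerSet (perSet A q s) where
  closed := isClosed_eq (ret A q s).continuous continuous_id
  nonempty := by
    obtain ⟨x, hx⟩ := hA.exists_fix
    exact ⟨x, by rw [mem_perSet, ret_apply, hx]; ring⟩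
  add_one x := by simpa using! map_mem_perSet_iff (A.commute_tr' 1) x

/-- The gap of `x` is displaced by the return map in the same direction as `x`. -/
theorem ret_gt_of_gap {x : ℝ} (hA : RatLift A q s) (hx : x < ret A q s x) {y : ℝ}
    (hy : y ∈ Ioo (lo (CircleAction.perSet A q s) x) (hi (CircleAction.perSet A q s) x)) :
    y < ret A q s y := by
  have hxP : x ∉ CircleAction.perSet A q s := fun h => hx.ne' h
  have hxg := hA.perSet.self_mem_gap hxP
  by_contra hcon
  have hc : ContinuousOn (fun y => ret A q s y - y)
      (Ioo (lo (CircleAction.perSet A q s) x) (hi (CircleAction.perSet A q s) x)) :=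
    ((ret A q s).continuous.sub continuous_id).continuousOn
  obtain ⟨z, hz, hz0⟩ := isPreconnected_Ioo.intermediate_value hy hxg hc
    (show (0 : ℝ) ∈ Icc _ _ from ⟨by linarith, by linarith⟩)
  exact PerSet.not_mem_of_gap hz (sub_eq_zero.mp hz0)

theorem ret_lt_of_gap {x : ℝ} (hA : RatLift A q s) (hx : ret A q s x < x) {y : ℝ}
    (hy : y ∈ Ioo (lo (CircleAction.perSet A q s) x) (hi (CircleAction.perSet A q s) x)) :
    ret A q s y < y := by
  have hxP : x ∉ CircleAction.perSet A q s := fun h => hx.ne h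
  have hxg := hA.perSet.self_mem_gap hxP
  rcases lt_trichotomy y (ret A q s y) with h | h | h
  · have := ret_gt_of_gap hA h (y := x) (by
      rw [hA.perSet.lo_eq_of_gap hy, hA.perSet.hi_eq_of_gap hy]; exact hxg)
    linarith
  · exact absurd (show y ∈ CircleAction.perSet A q s from h.symm) (PerSet.not_mem_of_gap hy)
  · exact h

theorem ret_gt_or_lt {x : ℝ} (hx : x ∉ perSet A q s) : x < ret A q s x ∨ ret A q s x < x :=
  (lt_or_gt_of_ne hx).symm

theorem sg_eq_of_gap (hA : RatLift A q s) {x y : ℝ} (hx : x ∉ CircleAction.perSet A q s)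
    (hy : y ∈ Ioo (lo (CircleAction.perSet A q s) x) (hi (CircleAction.perSet A q s) x)) :
    sg (ret A q s) y = sg (ret A q s) x := by
  rcases ret_gt_or_lt hx with h | h
  · rw [sg_of_lt h, sg_of_lt (ret_gt_of_gap hA h hy)]
  · rw [sg_of_gt h, sg_of_gt (ret_lt_of_gap hA h hy)]

theorem sg_map {S G : Lft} (h : Commute G S) (x : ℝ) : sg S (G x) = sg S x := by
  rcases lt_trichotomy x (S x) with h1 | h1 | h1
  · rw [sg_of_lt h1, sg_of_lt]; rw [← comm_apply h, lt_iff]; exact h1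
  · rw [sg, sg, ← comm_apply h, ← h1]; simp
  · rw [sg_of_gt h1, sg_of_gt]; rw [← comm_apply h, lt_iff]; exact h1

variable (A q s) in
/-- The translation coordinate on the gaps of the periodic set for the return map. -/
def rawCoord (x : ℝ) : ℝ :=
  Function.invFun (theta ((ret A q s) ^ sg (ret A q s) x)
    ((lo (perSet A q s) x + hi (perSet A q s) x) / 2)) x

theorem gapData (hA : RatLift A q s) {x : ℝ} (hx : x ∉ CircleAction.perSet A q s) :
    (lo (CircleAction.perSet A q s) x + hi (CircleAction.perSet A q s) x) / 2 ∈
        Ioo (lo (CircleAction.perSet A q s) x) (hi (CircleAction.perSet A q s) x) ∧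
      ∀ y ∈ Ioo (lo (CircleAction.perSet A q s) x) (hi (CircleAction.perSet A q s) x),
        y < ((ret A q s) ^ sg (ret A q s) x) y := by
  have hxg := hA.perSet.self_mem_gap hx
  refine ⟨?_, fun y hy => ?_⟩
  · have := hxg.1.trans hxg.2
    constructor <;> linarith
  · rcases ret_gt_or_lt hx with h | h
    · rw [sg_of_lt h, zpow_one]; exact ret_gt_of_gap hA h hy
    · rw [sg_of_gt h, zpow_neg_one, ← (ret A q s).lt_iff, apply_inv_self]
      exact ret_lt_of_gap hA h hy

/-- The exponent `sg` selects whichever of the return map and its inverse moves the gap of `x`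
forwards, so `θ` is increasing and turns the unit translation into that map. -/
theorem rawCoord_spec (hA : RatLift A q s) {x : ℝ} (hx : x ∉ CircleAction.perSet A q s) :
    ∃ θ : ℝ → ℝ, StrictMono θ ∧ (∀ t, θ t ∈ Ioo (lo (CircleAction.perSet A q s) x)
        (hi (CircleAction.perSet A q s) x)) ∧ (∀ t, rawCoord A q s (θ t) = t) ∧
      (∀ y ∈ Ioo (lo (CircleAction.perSet A q s) x) (hi (CircleAction.perSet A q s) x),
        θ (rawCoord A q s y) = y) ∧
      ∀ t, θ (t + 1) = ((ret A q s) ^ sg (ret A q s) x) (θ t) := by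
  set P := CircleAction.perSet A q s with hPdef
  have hP : PerSet P := hA.perSet
  set S := ret A q s
  set T := S ^ sg S x with hT
  set c := (lo P x + hi P x) / 2 with hc
  have hl : S (lo P x) = lo P x := hP.lo_mem x
  have hh : S (hi P x) = hi P x := hP.hi_mem x
  have hTl : T (lo P x) = lo P x := zpow_fixed hl _
  have hTh : T (hi P x) = hi P x := zpow_fixed hh _
  have hxg := hP.self_mem_gap hx
  obtain ⟨hcg, hTgt⟩ := gapData hA hx
  have hraw : ∀ y ∈ Ioo (lo P x) (hi P x), rawCoord A q s y = Function.invFun (theta T c) y := by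
    intro y hy
    rw [rawCoord, sg_eq_of_gap hA hx hy, ← hPdef, hP.lo_eq_of_gap hy, hP.hi_eq_of_gap hy]
  have hmono := theta_strictMono (hTgt c hcg)
  have hmem := theta_mem hTl hTh hcg (hTgt c hcg)
  refine ⟨theta T c, hmono, hmem, fun t => ?_, fun y hy => ?_, theta_add_one⟩
  · rw [hraw _ (hmem t)]; exact Function.leftInverse_invFun hmono.injective t
  · rw [hraw y hy]; exact Function.invFun_eq (exists_theta_eq hTgt hcg hy)

theorem rawCoord_add_int (hA : RatLift A q s) {x : ℝ} (hx : x ∉ CircleAction.perSet A q s) (n : ℤ) :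
    rawCoord A q s (x + n) = rawCoord A q s x := by
  have hP := hA.perSet
  set P := CircleAction.perSet A q s with hPdef
  set T := (ret A q s) ^ sg (ret A q s) x with hT
  set c := (lo P x + hi P x) / 2 with hc
  have hsg : sg (ret A q s) (x + n) = sg (ret A q s) x := by
    simpa using! sg_map ((ret A q s).commute_tr' n) x
  rw [rawCoord, rawCoord, hsg, ← hPdef, hP.lo_add_int, hP.hi_add_int,
    show (lo P x + n + (hi P x + n)) / 2 = c + n by rw [hc]; ring, ← hT, ← hc]
  have h5 : theta T (c + n) = fun t => theta T c t + n := funext fun t => theta_shift n t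
  obtain ⟨hcg, hTgt⟩ := gapData hA hx
  have hinj : Function.Injective (theta T c) := (theta_strictMono (hTgt c hcg)).injective
  obtain ⟨t, ht⟩ : ∃ t, theta T c t = x := exists_theta_eq hTgt hcg (hP.self_mem_gap hx)
  have e1 : Function.invFun (theta T c) x = t :=
    hinj (by rw [ht]; exact Function.invFun_eq ⟨t, ht⟩)
  have e2 : Function.invFun (theta T (c + n)) (x + n) = t := by
    refine hinj ?_
    have : theta T (c + n) (Function.invFun (theta T (c + n)) (x + n)) = x + n :=
      Function.invFun_eq ⟨t, by rw [h5, ← ht]⟩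
    rw [h5] at this
    simp only [add_left_inj] at this
    rw [← h5] at this
    rw [ht, this]
  rw [e1, e2]

theorem rawCoord_ret (hA : RatLift A q s) {x : ℝ} (hx : x ∉ CircleAction.perSet A q s) :
    rawCoord A q s (ret A q s x) = rawCoord A q s x + sg (ret A q s) x := by
  obtain ⟨θ, -, -, h3, h4, h5⟩ := rawCoord_spec hA hx
  have hxt := h4 x (hA.perSet.self_mem_gap hx)
  rcases ret_gt_or_lt hx with h | h
  · rw [sg_of_lt h, zpow_one] at h5
    rw [sg_of_lt h]
    conv_lhs => rw [← hxt, ← h5, h3]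
    simp
  · rw [sg_of_gt h, zpow_neg_one] at h5
    rw [sg_of_gt h]
    have h6 := h5 (rawCoord A q s x - 1)
    rw [sub_add_cancel, hxt] at h6
    have h7 : ret A q s x = θ (rawCoord A q s x - 1) := by
      conv_lhs => rw [h6]
      rw [apply_inv_self]
    rw [h7, h3]; push_cast; ring

theorem pow_apply_add (x : ℝ) : (A ^ q) x = ret A q s x + s := by
  rw [ret_apply]; ring

variable (A q s) in
/-- A coordinate on the complement of the periodic set in which `A` is a unit translation. -/
def coord (x : ℝ) : ℝ := ∑ j ∈ Finset.range q, rawCoord A q s ((A ^ j) x)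

theorem pow_mem_perSet_iff (j : ℕ) (x : ℝ) :
    (A ^ j) x ∈ CircleAction.perSet A q s ↔ x ∈ CircleAction.perSet A q s :=
  map_mem_perSet_iff ((Commute.refl A).pow_left j) x

theorem coord_add_int (hA : RatLift A q s) {x : ℝ} (hx : x ∉ CircleAction.perSet A q s) (n : ℤ) :
    coord A q s (x + n) = coord A q s x := by
  refine Finset.sum_congr rfl fun j _ => ?_
  rw [map_add_int, rawCoord_add_int hA (by rwa [pow_mem_perSet_iff])]

/-- Summing along `q` points of the orbit telescopes: applying `A` replaces the first term by the
one at the return, and these differ by the sign of the displacement. -/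
theorem coord_map (hA : RatLift A q s) {x : ℝ} (hx : x ∉ CircleAction.perSet A q s) :
    coord A q s (A x) = coord A q s x + sg (ret A q s) x := by
  have h1 : ∀ j, rawCoord A q s ((A ^ j) (A x)) = rawCoord A q s ((A ^ (j + 1)) x) := fun j => by
    rw [pow_succ, mul_apply]
  have h2 : rawCoord A q s ((A ^ q) x) = rawCoord A q s x + sg (ret A q s) x := by
    rw [pow_apply_add, rawCoord_add_int hA, rawCoord_ret hA hx]
    rwa [map_mem_perSet_iff (commute_ret A q s).symm]
  simp only [coord, h1]
  have h3 := Finset.sum_range_succ (fun j => rawCoord A q s ((A ^ j) x)) q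
  rw [Finset.sum_range_succ', h2] at h3
  simp only [pow_zero, one_apply] at h3
  linarith

theorem gap_map (hA : RatLift A q s) {G : Lft} (hG : Commute G A) {x y : ℝ}
    (hy : y ∈ Ioo (lo (CircleAction.perSet A q s) x) (hi (CircleAction.perSet A q s) x)) :
    G y ∈ Ioo (lo (CircleAction.perSet A q s) (G x)) (hi (CircleAction.perSet A q s) (G x)) := by
  rw [hA.perSet.lo_map (map_mem_perSet_iff hG), hA.perSet.hi_map (map_mem_perSet_iff hG)]
  exact ⟨G.lt_iff.mpr hy.1, G.lt_iff.mpr hy.2⟩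

theorem rawCoord_strictMonoOn (hA : RatLift A q s) {x : ℝ} (hx : x ∉ CircleAction.perSet A q s) :
    StrictMonoOn (rawCoord A q s)
      (Ioo (lo (CircleAction.perSet A q s) x) (hi (CircleAction.perSet A q s) x)) := by
  obtain ⟨θ, h1, -, -, h4, -⟩ := rawCoord_spec hA hx
  intro y hy z hz hyz
  rw [← h1.lt_iff_lt, h4 y hy, h4 z hz]
  exact hyz

theorem rawCoord_continuousOn (hA : RatLift A q s) {x : ℝ}
    (hx : x ∉ CircleAction.perSet A q s) : ContinuousOn (rawCoord A q s)
      (Ioo (lo (CircleAction.perSet A q s) x) (hi (CircleAction.perSet A q s) x)) := by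
  obtain ⟨θ, -, h2, h3, -, -⟩ := rawCoord_spec hA hx
  exact continuousOn_of_strictMonoOn_surjOn (rawCoord_strictMonoOn hA hx)
    fun t => ⟨θ t, h2 t, h3 t⟩

theorem coord_strictMonoOn (hA : RatLift A q s) {x : ℝ} (hx : x ∉ CircleAction.perSet A q s) :
    StrictMonoOn (coord A q s)
      (Ioo (lo (CircleAction.perSet A q s) x) (hi (CircleAction.perSet A q s) x)) := by
  intro y hy z hz hyz
  refine Finset.sum_lt_sum_of_nonempty (Finset.nonempty_range_iff.mpr hA.pos.ne') fun j _ => ?_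
  have hG : Commute (A ^ j) A := (Commute.refl A).pow_left j
  exact rawCoord_strictMonoOn hA (by rwa [pow_mem_perSet_iff]) (gap_map hA hG hy)
    (gap_map hA hG hz) ((lt_iff _).mpr hyz)

theorem coord_continuousOn (hA : RatLift A q s) {x : ℝ}
    (hx : x ∉ CircleAction.perSet A q s) : ContinuousOn (coord A q s)
      (Ioo (lo (CircleAction.perSet A q s) x) (hi (CircleAction.perSet A q s) x)) := by
  refine continuousOn_finsetSum _ fun j _ => ?_
  have hG : Commute (A ^ j) A := (Commute.refl A).pow_left j
  exact (rawCoord_continuousOn hA (by rwa [pow_mem_perSet_iff])).comp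
    (A ^ j).continuous.continuousOn fun y hy => gap_map hA hG hy

theorem ret_mem_gap (hA : RatLift A q s) {x y : ℝ}
    (hy : y ∈ Ioo (lo (CircleAction.perSet A q s) x) (hi (CircleAction.perSet A q s) x)) (n : ℤ) :
    ((ret A q s) ^ n) y ∈
      Ioo (lo (CircleAction.perSet A q s) x) (hi (CircleAction.perSet A q s) x) := by
  have h1 := zpow_fixed (S := ret A q s) (hA.perSet.lo_mem x) n
  have h2 := zpow_fixed (S := ret A q s) (hA.perSet.hi_mem x) n
  rw [← h1, ← h2]
  exact ⟨(lt_iff _).mpr hy.1, (lt_iff _).mpr hy.2⟩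

theorem coord_ret_zpow (hA : RatLift A q s) {x : ℝ} (hx : x ∉ CircleAction.perSet A q s) (n : ℤ) :
    coord A q s (((ret A q s) ^ n) x) = coord A q s x + n * (q * sg (ret A q s) x) := by
  have hpow : ∀ (j : ℕ) (x : ℝ), x ∉ CircleAction.perSet A q s →
      coord A q s ((A ^ j) x) = coord A q s x + j * sg (ret A q s) x := by
    intro j x hx
    induction j with
    | zero => simp
    | succ j ih =>
      rw [pow_succ', mul_apply, coord_map hA (by rwa [pow_mem_perSet_iff]), ih,
        sg_map ((commute_ret A q s).pow_left j)]
      push_cast; ring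
  have h1 : ∀ x, x ∉ CircleAction.perSet A q s →
      coord A q s (ret A q s x) = coord A q s x + q * sg (ret A q s) x := by
    intro x hx
    rw [← hpow q x hx, pow_apply_add, coord_add_int hA]
    rwa [map_mem_perSet_iff (commute_ret A q s).symm]
  have hm : ∀ n : ℤ, ((ret A q s) ^ n) x ∉ CircleAction.perSet A q s := fun n => by
    rwa [map_mem_perSet_iff ((commute_ret A q s).symm.zpow_left n)]
  have hs : ∀ n : ℤ, sg (ret A q s) (((ret A q s) ^ n) x) = sg (ret A q s) x := fun n =>
    sg_map ((Commute.refl _).zpow_left n) x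
  induction n with
  | zero => simp
  | succ n ih =>
    rw [add_comm, zpow_one_add, mul_apply, h1 _ (hm _), ih, hs]; push_cast; ring
  | pred n ih =>
    have h2 := h1 _ (hm (-n - 1))
    rw [← mul_apply, ← zpow_one_add, hs, show 1 + (-(n : ℤ) - 1) = -n by ring, ih] at h2
    push_cast at h2 ⊢; linarith

theorem sg_eq_one_or (x : ℝ) (hx : x ∉ CircleAction.perSet A q s) :
    sg (ret A q s) x = 1 ∨ sg (ret A q s) x = -1 :=
  (ret_gt_or_lt hx).imp sg_of_lt sg_of_gt

/-- Powers of the return map preserve the gap and shift the coordinate by multiples of `q`, so it is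
unbounded both ways on the gap. -/
theorem coord_surj (hA : RatLift A q s) {x : ℝ} (hx : x ∉ CircleAction.perSet A q s) (t : ℝ) :
    ∃ y ∈ Ioo (lo (CircleAction.perSet A q s) x) (hi (CircleAction.perSet A q s) x),
      coord A q s y = t := by
  have hxg := hA.perSet.self_mem_gap hx
  have hq : (1 : ℝ) ≤ q := by exact_mod_cast hA.pos
  have key : ∀ n : ℕ, ∃ y ∈ Ioo (lo (CircleAction.perSet A q s) x) (hi (CircleAction.perSet A q s) x),
      coord A q s x + n ≤ coord A q s y := by
    intro n
    refine ⟨_, ret_mem_gap hA hxg (n * sg (ret A q s) x), ?_⟩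
    rw [coord_ret_zpow hA hx]
    have : (0 : ℝ) ≤ n := n.cast_nonneg
    rcases sg_eq_one_or x hx with h | h <;> rw [h] <;> push_cast <;> nlinarith
  have key' : ∀ n : ℕ, ∃ y ∈ Ioo (lo (CircleAction.perSet A q s) x) (hi (CircleAction.perSet A q s) x),
      coord A q s y ≤ coord A q s x - n := by
    intro n
    refine ⟨_, ret_mem_gap hA hxg (-n * sg (ret A q s) x), ?_⟩
    rw [coord_ret_zpow hA hx]
    have : (0 : ℝ) ≤ n := n.cast_nonneg
    rcases sg_eq_one_or x hx with h | h <;> rw [h] <;> push_cast <;> nlinarith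
  obtain ⟨n, hn⟩ := exists_nat_ge (|t - coord A q s x|)
  obtain ⟨y, hy, h1⟩ := key n
  obtain ⟨z, hz, h2⟩ := key' n
  have h3 := abs_le.mp hn
  exact isPreconnected_Ioo.intermediate_value hz hy (coord_continuousOn hA hx)
    (show t ∈ Icc _ _ from ⟨by linarith, by linarith⟩)

end RatLift

end CircleAction
end

open scoped unitInterval
noncomputable section
namespace CircleAction
open Filter Topology Set Lft

/-! ## Bending along a lift with rational translation number -/

/-- The convex combinations of the identity and a lift. -/
def convexPath (κ : Lft) (t : I) : Lft := by
  refine ofSurj (fun x => (1 - t) * x + t * κ x) (fun x y h => ?_) (fun w => ?_) fun x => ?_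
  · have h1 := κ.lt_iff.mpr h
    have h2 := t.2.1
    have h3 := t.2.2
    rcases h2.eq_or_lt with h4 | h4
    · simp only [← h4]; linarith
    · change (1 - (t : ℝ)) * x + t * κ x < (1 - t) * y + t * κ y
      nlinarith
  · have hc : Continuous fun x => (1 - (t : ℝ)) * x + t * κ x :=
      (continuous_const.mul continuous_id).add (continuous_const.mul κ.continuous)
    have h2 := t.2.1
    have h3 := t.2.2
    refine mem_range_of_exists_le_of_exists_ge hc ⟨min w (κ⁻¹ w), ?_⟩ ⟨max w (κ⁻¹ w), ?_⟩
    · have h4 : κ (min w (κ⁻¹ w)) ≤ w := by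
        conv_rhs => rw [← κ.apply_inv_self w]
        exact κ.le_iff.mpr (min_le_right _ _)
      nlinarith [min_le_left w (κ⁻¹ w)]
    · have h4 : w ≤ κ (max w (κ⁻¹ w)) := by
        conv_lhs => rw [← κ.apply_inv_self w]
        exact κ.le_iff.mpr (le_max_right _ _)
      nlinarith [le_max_left w (κ⁻¹ w)]
  · simp only [map_add_one]; ring

theorem convexPath_apply (κ : Lft) (t : I) (x : ℝ) : convexPath κ t x = (1 - t) * x + t * κ x := rfl

theorem convexPath_zero (κ : Lft) : convexPath κ 0 = 1 := by ext x; simp [convexPath_apply]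
theorem convexPath_one (κ : Lft) : convexPath κ 1 = κ := by ext x; simp [convexPath_apply]

section

variable {A : Lft} {q : ℕ} {s : ℤ}

local notation "P" => perSet A q s

variable (A q s) in
/-- The point with coordinate `t` in the gap of `x`. -/
def coordInv (x t : ℝ) : ℝ :=
  Function.invFunOn (coord A q s) (Ioo (lo (perSet A q s) x) (hi (perSet A q s) x)) t

variable (hA : RatLift A q s)
include hA

theorem coordInv_mem {x : ℝ} (hx : x ∉ P) (t : ℝ) : coordInv A q s x t ∈ Ioo (lo P x) (hi P x) :=
  Function.invFunOn_mem (coord_surj hA hx t)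

theorem coord_coordInv {x : ℝ} (hx : x ∉ P) (t : ℝ) : coord A q s (coordInv A q s x t) = t :=
  Function.invFunOn_eq (coord_surj hA hx t)

theorem coordInv_coord {x y : ℝ} (hx : x ∉ P) (hy : y ∈ Ioo (lo P x) (hi P x)) :
    coordInv A q s x (coord A q s y) = y :=
  (coord_strictMonoOn hA hx).injOn.leftInvOn_invFunOn hy

theorem coordInv_strictMono {x : ℝ} (hx : x ∉ P) : StrictMono (coordInv A q s x) := by
  intro t t' h
  rw [← (coord_strictMonoOn hA hx).lt_iff_lt (coordInv_mem hA hx t) (coordInv_mem hA hx t'),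
    coord_coordInv hA hx, coord_coordInv hA hx]
  exact h

theorem coordInv_continuous {x : ℝ} (hx : x ∉ P) : Continuous (coordInv A q s x) := by
  let f : ℝ → Ioo (lo P x) (hi P x) := fun t => ⟨coordInv A q s x t, coordInv_mem hA hx t⟩
  have hf : StrictMono f := fun t t' h => coordInv_strictMono hA hx h
  have hs : Function.Surjective f := fun y =>
    ⟨coord A q s y, Subtype.ext (coordInv_coord hA hx y.2)⟩
  exact continuous_subtype_val.comp (hf.orderIsoOfSurjective f hs).continuous

theorem coordInv_congr {x y : ℝ} (hy : y ∈ Ioo (lo P x) (hi P x)) :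
    coordInv A q s y = coordInv A q s x := by
  funext t
  rw [coordInv, hA.perSet.lo_eq_of_gap hy, hA.perSet.hi_eq_of_gap hy, coordInv]

omit hA in
open Classical in
variable (A q s) in
/-- The map which fixes the periodic set and acts by `κ` in the coordinate of each gap. -/
def bendFun (κ : Lft) (x : ℝ) : ℝ :=
  if x ∈ perSet A q s then x else coordInv A q s x (κ (coord A q s x))

omit hA in
theorem bendFun_of_mem (κ : Lft) {x : ℝ} (hx : x ∈ P) : bendFun A q s κ x = x := if_pos hx

omit hA in
theorem bendFun_of_not_mem (κ : Lft) {x : ℝ} (hx : x ∉ P) :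
    bendFun A q s κ x = coordInv A q s x (κ (coord A q s x)) := if_neg hx

theorem bendFun_mem_gap (κ : Lft) {x : ℝ} (hx : x ∉ P) :
    bendFun A q s κ x ∈ Ioo (lo P x) (hi P x) := by
  rw [bendFun_of_not_mem κ hx]; exact coordInv_mem hA hx _

theorem coord_bendFun (κ : Lft) {x : ℝ} (hx : x ∉ P) :
    coord A q s (bendFun A q s κ x) = κ (coord A q s x) := by
  rw [bendFun_of_not_mem κ hx, coord_coordInv hA hx]

theorem eq_bendFun (κ : Lft) {x y : ℝ} (hx : x ∉ P) (hy : y ∈ Ioo (lo P x) (hi P x))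
    (h : coord A q s y = κ (coord A q s x)) : bendFun A q s κ x = y := by
  rw [bendFun_of_not_mem κ hx, ← h, coordInv_coord hA hx hy]

theorem bendFun_strictMono (κ : Lft) : StrictMono (bendFun A q s κ) := by
  have hP := hA.perSet
  have hlo : ∀ x, lo P x ≤ bendFun A q s κ x := fun x => by
    by_cases hx : x ∈ P
    · rw [bendFun_of_mem κ hx]; exact hP.lo_le x
    · exact (bendFun_mem_gap hA κ hx).1.le
  have hhi : ∀ x, bendFun A q s κ x ≤ hi P x := fun x => by
    by_cases hx : x ∈ P
    · rw [bendFun_of_mem κ hx]; exact hP.le_hi x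
    · exact (bendFun_mem_gap hA κ hx).2.le
  intro x y hxy
  by_cases hl : lo P x = lo P y
  · have hy : y ∉ P := fun hy => by
      rw [hP.lo_of_mem hy] at hl
      linarith [hP.lo_le x]
    by_cases hx : x ∈ P
    · rw [bendFun_of_mem κ hx]
      have := (bendFun_mem_gap hA κ hy).1
      rwa [← hl, hP.lo_of_mem hx] at this
    · have hyx := hP.mem_gap_of_lo_eq hx hy hl
      rw [bendFun_of_not_mem κ hx, bendFun_of_not_mem κ hy, coordInv_congr hA hyx]
      refine coordInv_strictMono hA hx ((lt_iff _).mpr ?_)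
      exact coord_strictMonoOn hA hx (hP.self_mem_gap hx) hyx hxy
  · have h1 := hP.hi_le_lo hxy.le hl
    by_cases hx : x ∈ P
    · by_cases hy : y ∈ P
      · rwa [bendFun_of_mem κ hx, bendFun_of_mem κ hy]
      · exact ((hhi x).trans h1).trans_lt (bendFun_mem_gap hA κ hy).1
    · exact ((bendFun_mem_gap hA κ hx).2.trans_le h1).trans_le (hlo y)

/-- In gap coordinates `G` is an integer translation, and `κ` commutes with those. -/
theorem bendFun_map (κ : Lft) {G : Lft} (hG : Commute G A)
    (hGc : ∀ x, x ∉ P → ∃ n : ℤ, ∀ y ∈ Ioo (lo P x) (hi P x),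
      coord A q s (G y) = coord A q s y + n) (x : ℝ) :
    bendFun A q s κ (G x) = G (bendFun A q s κ x) := by
  by_cases hx : x ∈ P
  · rw [bendFun_of_mem κ hx, bendFun_of_mem κ ((map_mem_perSet_iff hG x).mpr hx)]
  · obtain ⟨n, hn⟩ := hGc x hx
    refine eq_bendFun hA κ (by rwa [map_mem_perSet_iff hG]) (gap_map hA hG (bendFun_mem_gap hA κ hx)) ?_
    rw [hn _ (bendFun_mem_gap hA κ hx), hn _ (hA.perSet.self_mem_gap hx), map_add_int,
      coord_bendFun hA κ hx]

theorem bendFun_add_one (κ : Lft) (x : ℝ) : bendFun A q s κ (x + 1) = bendFun A q s κ x + 1 := by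
  have := bendFun_map hA κ (A.commute_tr' 1) (fun x hx => ⟨0, fun y hy => by
    rw [tr_apply, coord_add_int hA (PerSet.not_mem_of_gap hy)]; simp⟩) x
  simpa using this

/-- The lift which fixes the periodic set of `A` and acts by `κ` in the coordinate of each gap. -/
def bendLift (κ : Lft) : Lft :=
  ofSurj (bendFun A q s κ) (bendFun_strictMono hA κ) (fun y => by
    by_cases hy : y ∈ P
    · exact ⟨y, bendFun_of_mem κ hy⟩
    · have hm := coordInv_mem hA hy (κ⁻¹ (coord A q s y))
      refine ⟨_, eq_bendFun hA κ (PerSet.not_mem_of_gap hm) (x := coordInv A q s y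
        (κ⁻¹ (coord A q s y))) ?_ ?_⟩
      · rw [hA.perSet.lo_eq_of_gap hm, hA.perSet.hi_eq_of_gap hm]
        exact hA.perSet.self_mem_gap hy
      · rw [coord_coordInv hA hy, apply_inv_self]) (bendFun_add_one hA κ)

theorem bendLift_of_mem (κ : Lft) {x : ℝ} (hx : x ∈ P) : bendLift hA κ x = x := bendFun_of_mem κ hx

theorem bendLift_mem_gap (κ : Lft) {x : ℝ} (hx : x ∉ P) :
    bendLift hA κ x ∈ Ioo (lo P x) (hi P x) := bendFun_mem_gap hA κ hx

theorem coord_bendLift (κ : Lft) {x : ℝ} (hx : x ∉ P) :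
    coord A q s (bendLift hA κ x) = κ (coord A q s x) := coord_bendFun hA κ hx

theorem commute_bendLift (κ : Lft) : Commute (bendLift hA κ) A := by
  refine Lft.ext fun x => bendFun_map hA κ (Commute.refl A) (fun x hx => ?_) x
  refine ⟨sg (ret A q s) x, fun y hy => ?_⟩
  rw [coord_map hA (PerSet.not_mem_of_gap hy), sg_eq_of_gap hA hx hy]

/-- Convex combinations of `κ` with the identity are again lifts, so the path in the centralizer is
built in the coordinate and not on the line itself. -/
theorem bendPath_bendLift (κ : Lft) : BendPath A (bendLift hA κ) := by
  refine ⟨fun t => bendLift hA (convexPath κ t), fun x => ?_, ?_, ?_, fun t => commute_bendLift hA _⟩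
  · by_cases hx : x ∈ P
    · simp only [bendLift_of_mem hA _ hx]; exact continuous_const
    · have h1 : ∀ t : I, bendLift hA (convexPath κ t) x =
          coordInv A q s x ((1 - t) * coord A q s x + t * κ (coord A q s x)) := fun t => by
        rw [← convexPath_apply]; exact bendFun_of_not_mem _ hx
      simp only [h1]
      exact (coordInv_continuous hA hx).comp (by fun_prop)
  · ext x
    by_cases hx : x ∈ P
    · rw [bendLift_of_mem hA _ hx]; rfl
    · exact eq_bendFun hA _ hx (hA.perSet.self_mem_gap hx) (by rw [convexPath_zero]; rfl)
  · simp only [convexPath_one]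

/-- Points of a gap can be moved forwards arbitrarily within the gap. -/
theorem exists_bump_of_gap {x y : ℝ} (hx : x ∉ P) (hy : y ∈ Ioo (lo P x) (hi P x)) :
    ∃ H, BendPath A H ∧ (∀ z, z ≤ H z) ∧ y ≤ H x := by
  obtain ⟨n, hn⟩ := exists_nat_ge (coord A q s y - coord A q s x)
  have key : ∀ z, z ∉ P → ∀ w ∈ Ioo (lo P z) (hi P z), coord A q s w ≤ coord A q s z + n →
      w ≤ bendLift hA (tr n) z := by
    intro z hz w hw h
    rw [← (coord_strictMonoOn hA hz).le_iff_le hw (bendLift_mem_gap hA _ hz),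
      coord_bendLift hA _ hz]
    simpa using h
  refine ⟨bendLift hA (tr n), bendPath_bendLift hA _, fun z => ?_, key x hx y hy (by linarith)⟩
  by_cases hz : z ∈ P
  · rw [bendLift_of_mem hA _ hz]
  · exact key z hz z (hA.perSet.self_mem_gap hz) (by simp)

end

end CircleAction
end

open scoped unitInterval
noncomputable section
namespace CircleAction
open Filter Topology Set Lft

/-! ## Rationality of the members of a standard pair -/

/-- The lifts which preserve the partition into fibres of `F`. -/
def fibreStabilizer (F : CircleDeg1Lift) : Subgroup Lft where
  carrier := {C | ∀ x y, F (C x) = F (C y) ↔ F x = F y}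
  one_mem' := fun _ _ => Iff.rfl
  mul_mem' := fun {C D} hC hD x y => by rw [mul_apply, mul_apply, hC, hD]
  inv_mem' := fun {C} hC x y => by rw [← hC, apply_inv_self, apply_inv_self]

/-- Take a nondegenerate fibre interval with ends `u`, `v` and a point `x₀` such that points on its
two sides never share a fibre. By minimality some group element takes `x₀` into the image of `(u,
v)`; pulling the interval back gives two points of one fibre on different sides of `x₀`. -/
theorem fibreStabilizer_ne_top {Γ : Type*} [Group Γ] {ρ : Γ →* HomeoPlus} (hmin : IsMinimalRep ρ)
    {F : CircleDeg1Lift} (hF : ¬ Function.Injective F) :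
    ((fibreStabilizer F).map proj).comap ρ ≠ ⊤ := by
  intro htop
  obtain ⟨u, v, huv, hFuv⟩ : ∃ u v, u < v ∧ F u = F v := by
    simp only [Function.Injective, not_forall] at hF
    obtain ⟨u, v, h, hne⟩ := hF
    rcases lt_or_gt_of_ne hne with h' | h'
    exacts [⟨u, v, h', h⟩, ⟨v, u, h', h.symm⟩]
  set x₀ := sSup {x | F x ≤ 0} with hx₀
  have hbd : BddAbove {x | F x ≤ 0} := by
    obtain ⟨N, hN⟩ := exists_nat_gt (-F 0)
    refine ⟨N, fun x hx => ?_⟩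
    by_contra hcon
    have h1 := F.monotone (not_le.mp hcon).le
    have h2 := F.map_add_nat 0 N
    rw [zero_add] at h2
    have h3 : F x ≤ 0 := hx
    linarith
  have hsep : ∀ x y, x < x₀ → x₀ < y → F x ≠ F y := by
    intro x y hx hy h
    have hne : {x | F x ≤ 0}.Nonempty := by
      refine ⟨(-⌈F 0⌉ : ℤ), ?_⟩
      have h2 := F.map_add_int 0 (-⌈F 0⌉)
      rw [zero_add] at h2
      rw [mem_ofPred_eq, h2]
      push_cast
      linarith [Int.le_ceil (F 0)]
    obtain ⟨z, hz, hxz⟩ := exists_lt_of_lt_csSup hne hx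
    have h1 : F y ≤ 0 := h ▸ (F.monotone hxz.le).trans hz
    exact absurd (le_csSup hbd h1) (not_le.mpr hy)
  have hU : IsOpen ((fun x : ℝ => (x : S1)) '' Ioo u v) := QuotientAddGroup.isOpenMap_coe _ isOpen_Ioo
  obtain ⟨z, ⟨w, hw, rfl⟩, γ, hγ⟩ := (hmin (x₀ : S1)).inter_open_nonempty _ hU
    ((nonempty_Ioo.mpr huv).image _)
  have hmem : γ ∈ ((fibreStabilizer F).map proj).comap ρ := htop ▸ Subgroup.mem_top γ
  obtain ⟨C, hC, hCγ⟩ := hmem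
  simp only [← hCγ, proj_coe] at hγ
  obtain ⟨n, hn⟩ := coe_eq_coe_iff.mp hγ
  have hC' : ∀ x y, F (C⁻¹ x) = F (C⁻¹ y) ↔ F x = F y := inv_mem hC
  refine hsep (C⁻¹ (u - n)) (C⁻¹ (v - n)) ?_ ?_ ?_
  · rw [← C.lt_iff, apply_inv_self]; linarith [hw.1]
  · rw [← C.lt_iff, apply_inv_self]; linarith [hw.2]
  · rw [hC', F.map_sub_int, F.map_sub_int, hFuv]

namespace IrrSemiconj

variable {A : Lft} {α : ℝ} {F : CircleDeg1Lift}

/-- Points inside a fibre of `G` can be pushed past each other by the centralizer of `B`, and `F`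
does not notice such pushes by `comp_eq`. So `F` is constant on the interior of the fibre, and by
continuity on its closure. -/
theorem fibre_le (hF : IrrSemiconj A α F) {B : Lft} {β : ℝ} {G : CircleDeg1Lift}
    (hG : IrrSemiconj B β G) (hBA : Bend B A) {u v : ℝ} (h : G u = G v) : F u = F v := by
  wlog huv : u < v generalizing u v
  · rcases (not_lt.mp huv).eq_or_lt with h' | h'
    · rw [h']
    · exact (this h.symm h').symm
  have hconst : ∀ x ∈ Ioo u v, ∀ y ∈ Ioo u v, x < y → F x = F y := by
    intro x hx y hy hxy
    obtain ⟨H, hH, hge, hxH⟩ := hG.exists_bump h hx.1 hxy hy.2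
    have h1 := hF.comp_eq hBA hH hge x
    exact le_antisymm (F.monotone hxy.le) (h1 ▸ F.monotone hxH)
  obtain ⟨m, hm⟩ := nonempty_Ioo.mpr huv
  have heq : EqOn F (fun _ => F m) (Ioo u v) := fun x hx => by
    rcases lt_trichotomy x m with h' | h' | h'
    · exact hconst x hx m hm h'
    · rw [h']
    · exact (hconst m hm x hx h').symm
  have hcl := heq.closure hF.continuous continuous_const
  rw [closure_Ioo huv.ne] at hcl
  rw [hcl (left_mem_Icc.mpr huv.le), hcl (right_mem_Icc.mpr huv.le)]

theorem mem_fibreStabilizer_self (hF : IrrSemiconj A α F) : A ∈ fibreStabilizer F := fun x y => by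
  rw [hF.semiconj, hF.semiconj, add_left_inj]

theorem mem_fibreStabilizer_of_irrational (hF : IrrSemiconj A α F) {B : Lft} {β : ℝ}
    {G : CircleDeg1Lift} (hG : IrrSemiconj B β G) (hAB : Bend A B) (hBA : Bend B A) :
    B ∈ fibreStabilizer F := fun x y => by
  have h1 : ∀ x y, F x = F y ↔ G x = G y := fun x y =>
    ⟨fun h => hG.fibre_le hF hAB h, fun h => hF.fibre_le hG hBA h⟩
  rw [h1, h1, hG.mem_fibreStabilizer_self x y]

/-- Bending along `B` shows that `F` is constant on the gaps of its periodic set, so `B ^ p` adds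
`r` to `F`. If `B` merged two fibres of `F`, a bump `G` in the centralizer of `A` could be inserted
there so that `G * B` carries `y` past `B y'` with `F y < F y'`. But `F` composed with the
semi-conjugacy is `F` plus a constant, so `(G * B) ^ p` also adds exactly `r`, a contradiction.
Conversely `B` splits no fibre, since its `p`-th power does not. -/
theorem mem_fibreStabilizer_of_ratLift (hF : IrrSemiconj A α F) {B : Lft} {p : ℕ} {r : ℤ}
    (hB : RatLift B p r) (hAB : Bend A B) (hBA : Bend B A) : B ∈ fibreStabilizer F := by
  have hgap : ∀ x, x ∉ perSet B p r → ∀ y ∈ Ioo (lo (perSet B p r) x) (hi (perSet B p r) x),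
      x ≤ y → F x = F y := by
    intro x hx y hy hxy
    obtain ⟨H, hH, hge, hxH⟩ := exists_bump_of_gap hB hx hy
    have h1 := hF.comp_eq hBA hH hge x
    exact le_antisymm (F.monotone hxy) (h1 ▸ F.monotone hxH)
  have hpow : ∀ x, F ((B ^ p) x) = F x + r := by
    intro x
    rw [pow_apply_add (s := r), F.map_add_int, add_left_inj]
    by_cases hx : x ∈ perSet B p r
    · rw [ret_fix hx]
    · have h1 := ret_mem_gap hB (hB.perSet.self_mem_gap hx) 1
      rw [zpow_one] at h1
      rcases le_total x (ret B p r x) with h2 | h2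
      · exact (hgap x hx _ h1 h2).symm
      · refine hgap _ (PerSet.not_mem_of_gap h1) x ?_ h2
        rw [hB.perSet.lo_eq_of_gap h1, hB.perSet.hi_eq_of_gap h1]
        exact hB.perSet.self_mem_gap hx
  have hlt : ∀ x x', F x < F x' → F (B x) ≠ F (B x') := by
    intro x x' hlt heq
    obtain ⟨m, hm⟩ := exists_between hlt
    obtain ⟨m', hm'⟩ := exists_between hm.2
    have hsurj := F.continuous_iff_surjective.mp hF.continuous
    obtain ⟨y, rfl⟩ := hsurj m
    obtain ⟨y', rfl⟩ := hsurj m'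
    have h1 : x < y := F.monotone.reflect_lt hm.1
    have h2 : y < y' := F.monotone.reflect_lt hm'.1
    have h3 : y' < x' := F.monotone.reflect_lt hm'.2
    obtain ⟨G, hG, hge, hGy⟩ := hF.exists_bump heq (B.lt_iff.mpr h1) (B.lt_iff.mpr h2)
      (B.lt_iff.mpr h3)
    obtain ⟨h, hc, hhA, hhB⟩ := hAB G hG
    obtain ⟨c, hcst⟩ := hF.eq_add_const (φ := F * h) (hF.continuous.comp hc) fun x => by
      change F (h (A x)) ≤ F (h x) + α
      rw [hhA, hF.semiconj]
    have hit : ∀ (n : ℕ) z, h (((G * B) ^ n) z) = (B ^ n) (h z) := by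
      intro n
      induction n with
      | zero => intro z; rfl
      | succ n ih => intro z; rw [pow_succ', mul_apply, mul_apply, hhB, ih, pow_succ', mul_apply]
    have hp : ∀ z, F (((G * B) ^ p) z) = F z + r := fun z => by
      have h4 := hcst (((G * B) ^ p) z)
      have h5 := hcst z
      change F (h _) = _ at h4 h5
      rw [hit, hpow] at h4
      linarith
    have hmon : ∀ (n : ℕ) z, (B ^ n) z ≤ ((G * B) ^ n) z := by
      intro n z
      induction n with
      | zero => rfl
      | succ n ih =>
        rw [pow_succ', mul_apply, pow_succ', mul_apply, mul_apply]
        exact (B.le_iff.mpr ih).trans (hge _)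
    obtain ⟨k, rfl⟩ := Nat.exists_eq_succ_of_ne_zero hB.pos.ne'
    have h6 : (B ^ (k + 1)) y' ≤ ((G * B) ^ (k + 1)) y := by
      rw [pow_succ, mul_apply, pow_succ, mul_apply, mul_apply]
      exact ((B ^ k).le_iff.mpr hGy).trans (hmon k _)
    have h7 := F.monotone h6
    rw [hp, hpow] at h7
    linarith [hm'.1]
  have hback : ∀ x y, F (B x) = F (B y) → F x = F y := fun x y h => by
    rcases lt_trichotomy (F x) (F y) with h' | h' | h'
    · exact absurd h (hlt x y h')
    · exact h'
    · exact absurd h.symm (hlt y x h')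
  have hbackn : ∀ (n : ℕ) x y, F ((B ^ n) x) = F ((B ^ n) y) → F x = F y := by
    intro n
    induction n with
    | zero => intro x y h; exact h
    | succ n ih =>
      intro x y h
      rw [pow_succ, mul_apply, mul_apply] at h
      exact hback x y (ih _ _ h)
  refine fun x y => ⟨hback x y, fun h => ?_⟩
  obtain ⟨k, rfl⟩ := Nat.exists_eq_succ_of_ne_zero hB.pos.ne'
  refine hbackn k _ _ ?_
  rw [← mul_apply, ← mul_apply, ← pow_succ, hpow, hpow, h]

end IrrSemiconj

theorem irrational_or_ratLift (A : Lft) : Irrational (tau A) ∨ ∃ q s, RatLift A q s := by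
  by_cases h : ∃ q s, RatLift A q s
  · exact Or.inr h
  · refine Or.inl (irrational_tau_of_forall fun q s x hq hx => h ⟨q, s, hq, x, hx⟩)

theorem RatLift.inv {A : Lft} {q : ℕ} {s : ℤ} (h : RatLift A q s) : RatLift A⁻¹ q (-s) := by
  obtain ⟨x, hx⟩ := h.exists_fix
  refine ⟨h.pos, x, ?_⟩
  apply (A ^ q).injective
  rw [map_add_int, hx, ← mul_apply, inv_pow, mul_inv_cancel]
  simp

/-- In the irrational case `A` and the images of all partners of `a` preserve the fibres of the
semi-conjugacy, and together they generate the image of `ρ`. -/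
theorem exists_ratLift {g : ℕ} {ρ : SurfaceGroup g →* HomeoPlus} (hrigid : PathRigid ρ) (hmin : IsMinimalRep ρ) {a b : SurfaceGroup g} (hab : IsStandardPair a b)
    {A : Lft} (hA : proj A = ρ a) : ∃ q s, RatLift A q s := by
  refine (irrational_or_ratLift A).resolve_left fun hirr => ?_
  obtain ⟨F, hF⟩ := exists_irrSemiconj hirr
  obtain ⟨B₀, hB₀⟩ := proj_surjective (ρ b)
  refine fibreStabilizer_ne_top hmin
    (hF.not_injective (bend_of_isStandardPair hrigid hmin hab hA hB₀).1)
    (hab.eq_top ⟨A, hF.mem_fibreStabilizer_self, hA⟩ fun b' hb' => ?_)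
  obtain ⟨B, hB⟩ := proj_surjective (ρ b')
  obtain ⟨h1, h2⟩ := bend_of_isStandardPair hrigid hmin hb' hA hB
  refine ⟨B, ?_, hB⟩
  rcases irrational_or_ratLift B with hi | ⟨p, r, hr⟩
  · obtain ⟨G, hG⟩ := exists_irrSemiconj hi
    exact hF.mem_fibreStabilizer_of_irrational hG h1 h2
  · exact hF.mem_fibreStabilizer_of_ratLift hr h1 h2

theorem exists_ratLift_right {g : ℕ} {ρ : SurfaceGroup g →* HomeoPlus} (hrigid : PathRigid ρ) (hmin : IsMinimalRep ρ) {a b : SurfaceGroup g} (hab : IsStandardPair a b)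
    {B : Lft} (hB : proj B = ρ b) : ∃ q s, RatLift B q s := by
  obtain ⟨q, s, h⟩ := exists_ratLift hrigid hmin hab.swap (A := B⁻¹) (by
    rw [map_inv, map_inv, hB])
  have := h.inv
  rw [inv_inv] at this
  exact ⟨q, -s, this⟩

end CircleAction
end

open scoped unitInterval
noncomputable section
namespace CircleAction
open Filter Topology Set Lft

/-! ## Collapsing periodic orbits by composition with a periodic map -/

/-- A property that holds once and propagates forwards reaches every index, because going forwards
along a cycle also reaches the earlier indices. -/
theorem forall_of_periodic {p : ℕ} {Pr : ℕ → Prop} (hp : 0 < p) (h0 : ∃ m, Pr m)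
    (hs : ∀ m, Pr m → Pr (m + 1)) (hper : ∀ m, Pr (m + p) → Pr m) (m : ℕ) : Pr m := by
  obtain ⟨m₀, h0⟩ := h0
  have h1 : ∀ k, Pr (m₀ + k) := fun k => by
    induction k with
    | zero => exact h0
    | succ k ih => exact hs _ ih
  have h2 : ∀ k, Pr (m + k * p) → Pr m := fun k => by
    induction k with
    | zero => simp
    | succ k ih => intro h; exact ih (hper _ (by convert h using 1; ring))
  refine h2 m₀ ?_
  have h3 : m₀ ≤ m + m₀ * p := by nlinarith
  obtain ⟨k, hk⟩ := Nat.exists_eq_add_of_le h3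
  rw [hk]; exact h1 k

/-- A lift which fixes the integers, extending a homeomorphism of `[-1, 0]`. -/
theorem exists_lft_extending {L : ℝ → ℝ} (hm : StrictMono L) (hc : Continuous L) (h0 : L 0 = 0)
    (h1 : L (-1) = -1) : ∃ G : Lft, ∀ (k : ℤ), ∀ t ∈ Icc (-1 : ℝ) 0, G (k + t) = k + L t := by
  let f : ℝ → ℝ := fun x => L (x - ⌈x⌉) + ⌈x⌉
  have hr : ∀ x : ℝ, -1 < x - ⌈x⌉ ∧ x - ⌈x⌉ ≤ 0 := fun x =>
    ⟨by linarith [Int.ceil_lt_add_one x], by linarith [Int.le_ceil x]⟩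
  have hb : ∀ x, ⌈x⌉ - 1 < f x ∧ f x ≤ ⌈x⌉ := fun x => by
    have e1 := hm (hr x).1
    have e2 := hm.monotone (hr x).2
    rw [h1] at e1
    rw [h0] at e2
    constructor <;> simp only [f] <;> linarith
  have hfm : StrictMono f := by
    intro x y hxy
    rcases (Int.ceil_mono hxy.le).lt_or_eq with h | h
    · have h2 : (⌈x⌉ : ℝ) ≤ ⌈y⌉ - 1 := by
        have : ⌈x⌉ ≤ ⌈y⌉ - 1 := by omega
        exact_mod_cast this
      linarith [(hb x).2, (hb y).1]
    · simp only [f, h]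
      have := hm (show x - ⌈y⌉ < y - ⌈y⌉ by linarith)
      linarith
  have hceil : ∀ (k : ℤ) (t : ℝ), -1 < t → t ≤ 0 → ⌈k + t⌉ = k := fun k t ht ht' => by
    rw [Int.ceil_eq_iff]; constructor <;> linarith
  have hspec : ∀ (k : ℤ) (t : ℝ), -1 < t → t ≤ 0 → f (k + t) = k + L t := fun k t ht ht' => by
    simp only [f, hceil k t ht ht']
    rw [add_sub_cancel_left, add_comm]
  refine ⟨ofSurj f hfm (fun w => ?_) (fun x => ?_), fun k t ht => ?_⟩
  · obtain ⟨e1, e2⟩ := hr w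
    obtain ⟨t, ht, htw⟩ := intermediate_value_Icc (show (-1 : ℝ) ≤ 0 by norm_num)
      hc.continuousOn (show w - ⌈w⌉ ∈ Icc (L (-1)) (L 0) by rw [h0, h1]; exact ⟨e1.le, e2⟩)
    have ht' : -1 < t := by
      rw [← hm.lt_iff_lt, h1, htw]; exact e1
    exact ⟨⌈w⌉ + t, by rw [hspec _ _ ht' ht.2, htw]; ring⟩
  · simp only [f, Int.ceil_add_one]; push_cast; ring_nf
  · change f (k + t) = k + L t
    rcases ht.1.eq_or_lt with h | h
    · have := hspec (k - 1) 0 (by norm_num) le_rfl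
      rw [← h, h1]
      rw [h0, add_zero] at this
      push_cast at this
      rw [← sub_eq_add_neg, this]
    · exact hspec k t h ht.2

/-- Given a strictly increasing `N` there is a lift that fixes the integers and maps all but the
first `ε` of each unit interval into the last `δ`, linearly and contracting in the coordinate
`N`. -/
theorem exists_collapsing_lift {N : ℝ → ℝ} (hN : StrictMono N) (hNc : Continuous N) {δ ε : ℝ}
    (hδ : 0 < δ) (hδ1 : δ < 1) (hε : 0 < ε) (hε1 : ε < 1) :
    ∃ (K : Lft) (c : ℝ), 0 < c ∧ c < 1 ∧ (∀ z, K z ≤ ⌈z⌉) ∧ (∀ z, z - 1 ≤ K z) ∧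
      (∀ (k : ℤ) (z : ℝ), k - 1 + ε < z → k - δ ≤ K z) ∧
      ∀ (k : ℤ) (z : ℝ), k - 1 + ε < z → z ≤ k → N (K z - k) = N 0 + c * (z - k) := by
  have hd : 0 < N 0 - N (-δ) := sub_pos.mpr (hN (by linarith))
  -- This bound gives `a (-δ) ≤ -1`, so that in `max a b` the branch `a` matters only on `(-δ, 0]`.
  set c := min (1 / 2) (N 0 - N (-δ)) with hcdef
  have hc0 : 0 < c := lt_min (by norm_num) hd
  have hc1 : c ≤ 1 / 2 := min_le_left _ _
  let a : ℝ → ℝ := fun t => (N t - N 0) / c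
  let b : ℝ → ℝ := fun t => -1 + ε * (t + 1)
  have ha : StrictMono a := fun x y h => div_lt_div_of_pos_right (by linarith [hN h]) hc0
  have hb : StrictMono b := fun x y h => by
    have := mul_lt_mul_of_pos_left (show x + 1 < y + 1 by linarith) hε
    simp only [b]; linarith
  have haδ : a (-δ) ≤ -1 := by
    simp only [a]
    rw [div_le_iff₀ hc0]
    have : c ≤ N 0 - N (-δ) := min_le_right _ _
    linarith
  have ha0 : a 0 = 0 := by simp [a]
  have hb0 : b 0 = -1 + ε := by simp [b]
  have hb1 : b (-1) = -1 := by simp [b]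
  -- The collapsing lift is `G⁻¹`. The branch `b` stretches nothing beyond `-1 + ε`, so above that
  -- height `G` follows `a`, whose inverse contracts by `c` in the coordinate `N`.
  obtain ⟨G, hG⟩ := exists_lft_extending (L := fun t => max (a t) (b t))
    (fun x y h => max_lt_max (ha h) (hb h))
    (by simp only [a, b]; fun_prop) (by rw [ha0, hb0]; exact max_eq_left (by linarith))
    (by rw [hb1]; exact max_eq_right ((ha (show (-1 : ℝ) < -δ by linarith)).le.trans haδ))
  have hGint : ∀ k : ℤ, G k = k := fun k => by
    have := hG k 0 (by norm_num)
    rw [add_zero, ha0, hb0, max_eq_left (by linarith)] at this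
    simpa using this
  have hGinv : ∀ k : ℤ, G⁻¹ k = k := fun k => by rw [← G.eq_iff, apply_inv_self, hGint]
  have hlow : ∀ (k : ℤ) (z : ℝ), k - 1 + ε < z → k - δ ≤ G⁻¹ z := fun k z hz => by
    rw [← G.le_iff, apply_inv_self, sub_eq_add_neg, hG k _ ⟨by linarith, by linarith⟩]
    have h2 : b (-δ) ≤ -1 + ε := hb0 ▸ (hb.monotone (by linarith))
    have : max (a (-δ)) (b (-δ)) ≤ -1 + ε := max_le (by linarith) h2
    linarith
  have hup : ∀ z, G⁻¹ z ≤ ⌈z⌉ := fun z => by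
    rw [← hGinv ⌈z⌉]; exact (le_iff _).mpr (Int.le_ceil z)
  refine ⟨G⁻¹, c, hc0, by linarith, hup, fun z => ?_, hlow, fun k z hz hzk => ?_⟩
  · have h1 : ((⌊z⌋ : ℤ) : ℝ) ≤ G⁻¹ z := by
      conv_lhs => rw [← hGinv ⌊z⌋]
      exact (le_iff _).mpr (Int.floor_le z)
    linarith [Int.lt_floor_add_one z]
  · set t := G⁻¹ z - k with ht
    have h1 := hlow k z hz
    have h2 : G⁻¹ z ≤ k := by
      rw [← hGinv k]; exact (le_iff _).mpr hzk
    have h3 := hG k t ⟨by linarith, by linarith⟩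
    rw [ht, add_sub_cancel, apply_inv_self, ← ht] at h3
    have h4 : b t ≤ -1 + ε := hb0 ▸ (hb.monotone (by linarith))
    have h5 : max (a t) (b t) = a t := by
      rcases max_choice (a t) (b t) with h | h
      · exact h
      · rw [h] at h3; linarith
    rw [h5] at h3
    have h6 : z - k = (N t - N 0) / c := by
      change z = k + (N t - N 0) / c at h3; linarith
    rw [h6, mul_div_cancel₀ _ hc0.ne']; ring

section

variable {ι : Type*} {τ : ι → ι} {p : ℕ} {f : ι → ℝ → ℝ}

/-- One step of the integer upper bound for the dynamics. -/
def ceilStep (τ : ι → ι) (p : ℕ) (f : ι → ℝ → ℝ) (n : ℤ) (o : ι → ℤ) (i : ι) : ℤ :=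
  ⌈f (τ^[p - 1] i) (o (τ^[p - 1] i))⌉ + n

theorem ceilStep_apply (hp : 0 < p) (hτ : ∀ i, τ^[p] i = i) (n : ℤ) (o : ι → ℤ) (i : ι) :
    ceilStep τ p f n o (τ i) = ⌈f i (o i)⌉ + n := by
  have h : τ^[p - 1] (τ i) = i := by
    rw [← Function.iterate_succ_apply, Nat.succ_eq_add_one, Nat.sub_add_cancel hp, hτ]
  rw [ceilStep, h]

/-- The ceilings of a bounded function are integers bounded above, hence attain a maximum; past some
`X` they stay at it. -/
theorem exists_max_ceil [Finite ι] (hf : ∀ i, StrictMono (f i)) :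
    ∃ X : ℕ, ∀ i, BddAbove (range (f i)) → ∀ x, ⌈f i x⌉ ≤ ⌈f i X⌉ := by
  have h : ∀ i, ∃ X : ℕ, BddAbove (range (f i)) → ∀ x, ⌈f i x⌉ ≤ ⌈f i X⌉ := by
    intro i
    by_cases hb : BddAbove (range (f i))
    · obtain ⟨M, hM⟩ := hb
      obtain ⟨k, ⟨x, hx⟩, hk⟩ := Int.exists_greatest_of_bdd (P := fun k => ∃ x, ⌈f i x⌉ = k)
        ⟨⌈M⌉, by rintro z ⟨x, rfl⟩; exact Int.ceil_mono (hM ⟨x, rfl⟩)⟩ ⟨_, 0, rfl⟩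
      obtain ⟨X, hX⟩ := exists_nat_ge x
      exact ⟨X, fun _ w => (hk _ ⟨w, rfl⟩).trans (hx ▸ Int.ceil_mono ((hf i).monotone hX))⟩
    · exact ⟨0, fun h => absurd h hb⟩
  choose X hX using h
  obtain ⟨Y, hY⟩ := (Set.finite_range X).bddAbove
  exact ⟨Y, fun i hb x => (hX i hb x).trans
    (Int.ceil_mono ((hf i).monotone (by exact_mod_cast hY ⟨i, rfl⟩)))⟩

/-- Provides a translation large enough to keep all orbits that start above `X` above `X`, and to
lift any value of a map bounded below to that level, with a loss of `1` for the collapsing lift. -/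
theorem exists_shift [Finite ι] (X : ℕ) :
    ∃ n : ℤ, (∀ i, (X : ℝ) ≤ f i X - 1 + n) ∧
      ∀ i, BddBelow (range (f i)) → ∀ x, (X : ℝ) ≤ f i x - 1 + n := by
  have h : ∀ i, ∃ n : ℕ, (X : ℝ) ≤ f i X - 1 + n ∧
      (BddBelow (range (f i)) → ∀ x, (X : ℝ) ≤ f i x - 1 + n) := by
    intro i
    by_cases hb : BddBelow (range (f i))
    · obtain ⟨M, hM⟩ := hb
      obtain ⟨n, hn⟩ := exists_nat_ge (X + 1 - M)
      have : ∀ x, (X : ℝ) ≤ f i x - 1 + n := fun x => by linarith [hM ⟨x, rfl⟩]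
      exact ⟨n, this X, fun _ => this⟩
    · obtain ⟨n, hn⟩ := exists_nat_ge (X + 1 - f i X)
      exact ⟨n, by linarith, fun h => absurd h hb⟩
  choose n hn using h
  obtain ⟨Y, hY⟩ := (Set.finite_range n).bddAbove
  have hY' : ∀ i, (n i : ℝ) ≤ Y := fun i => by exact_mod_cast hY ⟨i, rfl⟩
  refine ⟨Y, fun i => ?_, fun i hb x => ?_⟩
  · have := (hn i).1; push_cast; linarith [hY' i]
  · have := (hn i).2 hb x; push_cast; linarith [hY' i]

/-- The map `κ` is a large translation after a lift collapsing most of each unit interval towards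
its right end. Integer upper bounds for the orbits evolve by `ceilStep`; a map bounded above on each
cycle makes them stabilize after one period. A map bounded below pushes every periodic orbit up to
within `δ` of these bounds. In that zone the dynamics contracts the coordinate `N`, so two periodic
orbits over the same cycle coincide. -/
theorem exists_collapse [Finite ι] (hp : 0 < p) (hτ : ∀ i, τ^[p] i = i)
    (hf : ∀ i, StrictMono (f i)) (hfc : ∀ i, Continuous (f i))
    (hab : ∀ i, ∃ m, BddAbove (range (f (τ^[m] i))))
    (hbb : ∀ i, ∃ m, BddBelow (range (f (τ^[m] i)))) :
    ∃ κ : Lft, ∀ (i : ι) (y y' : ℕ → ℝ),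
      (∀ m, y (m + 1) = κ (f (τ^[m] i) (y m))) → (∀ m, y (m + p) = y m) →
      (∀ m, y' (m + 1) = κ (f (τ^[m] i) (y' m))) → (∀ m, y' (m + p) = y' m) → y 0 = y' 0 := by
  classical
  have := Fintype.ofFinite ι
  obtain ⟨X, hX⟩ := exists_max_ceil hf
  obtain ⟨n, hn1, hn2⟩ := exists_shift (f := f) X
  set T := ceilStep τ p f n with hT
  have hTap : ∀ o i, T o (τ i) = ⌈f i (o i)⌉ + n := ceilStep_apply hp hτ n
  have hsurj : ∀ i, ∃ j, τ j = i := fun i => ⟨τ^[p - 1] i, by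
    rw [← Function.iterate_succ_apply' τ, Nat.succ_eq_add_one, Nat.sub_add_cancel hp, hτ]⟩
  have hTge : ∀ o : ι → ℤ, (∀ i, (X : ℤ) ≤ o i) → ∀ i, (X : ℤ) ≤ T o i := by
    intro o ho i
    obtain ⟨j, rfl⟩ := hsurj i
    rw [hTap]
    have h1 := (hf j).monotone (show (X : ℝ) ≤ o j by exact_mod_cast ho j)
    have h2 := Int.le_ceil (f j (o j))
    have h3 := hn1 j
    have : (X : ℝ) ≤ ((⌈f j (o j)⌉ + n : ℤ) : ℝ) := by push_cast; linarith
    exact_mod_cast this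
  have hTge' : ∀ (k : ℕ) (o : ι → ℤ), (∀ i, (X : ℤ) ≤ o i) → ∀ i, (X : ℤ) ≤ T^[k] o i := by
    intro k
    induction k with
    | zero => intro o ho; exact ho
    | succ k ih => intro o ho; rw [Function.iterate_succ_apply']; exact hTge _ (ih o ho)
  have hmax : ∀ j, BddAbove (range (f j)) → ∀ o : ι → ℤ, (∀ i, (X : ℤ) ≤ o i) →
      T o (τ j) = ⌈f j X⌉ + n := by
    intro j hj o ho
    rw [hTap, le_antisymm (hX j hj (o j)) (Int.ceil_mono ((hf j).monotone (by exact_mod_cast ho j)))]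
  -- Once the iteration passes an index with bounded map, its value there is the maximal ceiling,
  -- whatever the start above `X`.
  have hstable : ∀ o o' : ι → ℤ, (∀ i, (X : ℤ) ≤ o i) → (∀ i, (X : ℤ) ≤ o' i) →
      T^[p] o = T^[p] o' := by
    intro o o' ho ho'
    funext i
    obtain ⟨m, hm⟩ := hab i
    have hmod : ∀ k, τ^[k] i = τ^[k % p] i := fun k => by
      conv_lhs => rw [← Nat.mod_add_div k p]
      rw [Function.iterate_add_apply, Function.iterate_mul,
        Function.iterate_fixed (hτ i)]
    rw [hmod] at hm
    have hlt := Nat.mod_lt m hp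
    set m' := m % p
    have key : ∀ l k, T^[l + 1 + k] o (τ^[l + 1] (τ^[m'] i)) =
        T^[l + 1 + k] o' (τ^[l + 1] (τ^[m'] i)) := by
      intro l k
      induction l with
      | zero =>
        rw [zero_add, add_comm, Function.iterate_succ_apply' T, Function.iterate_succ_apply' T,
          Function.iterate_one τ, hmax _ hm _ (hTge' k o ho), hmax _ hm _ (hTge' k o' ho')]
      | succ l ih =>
        rw [show l + 1 + 1 + k = (l + 1 + k) + 1 by ring, Function.iterate_succ_apply' T,
          Function.iterate_succ_apply' T, Function.iterate_succ_apply' τ (l + 1), hTap, hTap, ih]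
    have h1 := key (p - m' - 1) m'
    rw [show p - m' - 1 + 1 + m' = p by omega, ← Function.iterate_add_apply,
      show p - m' - 1 + 1 + m' = p by omega, hτ] at h1
    exact h1
  set O : ℕ → ι → ℤ := fun k => T^[k] fun _ => (X : ℤ) with hO
  have hOge : ∀ k i, (X : ℤ) ≤ O k i := fun k => hTge' k _ fun _ => le_rfl
  have hOsucc : ∀ k i, O (k + 1) (τ i) = ⌈f i (O k i)⌉ + n := fun k i => by
    simp only [hO]
    rw [Function.iterate_succ_apply', hTap]
  have hofix : ∀ i, O p (τ i) = ⌈f i (O p i)⌉ + n := fun i => by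
    rw [← hOsucc]
    have : O (p + 1) = O p := by
      simp only [hO]
      rw [Function.iterate_succ_apply]
      exact hstable _ _ (hTge _ fun _ => le_rfl) fun _ => le_rfl
    rw [this]
  -- Room exists because a number exceeds its ceiling minus one strictly; finitely many indices and
  -- steps are involved. The same reason gives `ε` below.
  obtain ⟨δ, hδ, hδ1, hδf⟩ : ∃ δ : ℝ, 0 < δ ∧ δ < 1 ∧ ∀ k ∈ Finset.range (p + 1), ∀ i,
      (⌈f i (O k i)⌉ : ℝ) - 1 < f i (O k i - δ) := by
    have h1 : ∀ k ∈ Finset.range (p + 1), ∀ i, ∀ᶠ δ in 𝓝[>] (0 : ℝ),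
        (⌈f i (O k i)⌉ : ℝ) - 1 < f i (O k i - δ) := by
      intro k _ i
      refine nhdsWithin_le_nhds ?_
      have hc : Continuous fun δ : ℝ => f i (O k i - δ) :=
        (hfc i).comp (continuous_const.sub continuous_id)
      refine hc.continuousAt.eventually (lt_mem_nhds ?_)
      simp only [sub_zero]
      linarith [Int.ceil_lt_add_one (f i (O k i))]
    have h2 : ∀ᶠ δ in 𝓝[>] (0 : ℝ), ∀ k ∈ Finset.range (p + 1), ∀ i,
        (⌈f i (O k i)⌉ : ℝ) - 1 < f i (O k i - δ) :=
      (Finset.eventually_all _).mpr fun k hk => eventually_all.mpr (h1 k hk)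
    have h3 : ∀ᶠ δ in 𝓝[>] (0 : ℝ), δ ∈ Ioo (0 : ℝ) 1 := Ioo_mem_nhdsGT one_pos
    obtain ⟨δ, hd1, hd2⟩ := (h2.and h3).exists
    exact ⟨δ, hd2.1, hd2.2, hd1⟩
  obtain ⟨ε, hε, hε1, hεf⟩ : ∃ ε : ℝ, 0 < ε ∧ ε < 1 ∧ ∀ k ∈ Finset.range (p + 1), ∀ i,
      (⌈f i (O k i)⌉ : ℝ) - 1 + ε < f i (O k i - δ) := by
    have h1 : ∀ k ∈ Finset.range (p + 1), ∀ i, ∀ᶠ ε in 𝓝[>] (0 : ℝ),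
        (⌈f i (O k i)⌉ : ℝ) - 1 + ε < f i (O k i - δ) := by
      intro k hk i
      refine nhdsWithin_le_nhds ?_
      have hc : Continuous fun ε : ℝ => (⌈f i (O k i)⌉ : ℝ) - 1 + ε := by fun_prop
      refine hc.continuousAt.eventually (gt_mem_nhds ?_)
      simpa using hδf k hk i
    have h2 : ∀ᶠ ε in 𝓝[>] (0 : ℝ), ∀ k ∈ Finset.range (p + 1), ∀ i,
        (⌈f i (O k i)⌉ : ℝ) - 1 + ε < f i (O k i - δ) :=
      (Finset.eventually_all _).mpr fun k hk => eventually_all.mpr (h1 k hk)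
    have h3 : ∀ᶠ δ in 𝓝[>] (0 : ℝ), δ ∈ Ioo (0 : ℝ) 1 := Ioo_mem_nhdsGT one_pos
    obtain ⟨δ, hd1, hd2⟩ := (h2.and h3).exists
    exact ⟨δ, hd2.1, hd2.2, hd1⟩
  rcases isEmpty_or_nonempty ι with hι | hι
  · exact ⟨1, fun i => isEmptyElim i⟩
  -- The sum makes increments of `N` dominate those of each single `f i` near its bound, so one
  -- contraction in `N` serves for all indices.
  let N : ℝ → ℝ := fun t => ∑ i, f i (O p i + t)
  have hterm : ∀ i, StrictMono fun t => f i (O p i + t) := fun i x y h =>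
    hf i (show (O p i : ℝ) + x < O p i + y by linarith)
  have hN : StrictMono N := fun x y h =>
    Finset.sum_lt_sum_of_nonempty Finset.univ_nonempty fun i _ => hterm i h
  have hNc : Continuous N :=
    continuous_finsetSum _ fun i _ => (hfc i).comp (continuous_const.add continuous_id)
  have hNle : ∀ i x y, x ≤ y → f i (O p i + y) - f i (O p i + x) ≤ N y - N x := by
    intro i x y hxy
    have h1 := Finset.single_le_sum (f := fun j => f j (O p j + y) - f j (O p j + x))
      (fun j _ => sub_nonneg.mpr ((hterm j).monotone hxy)) (Finset.mem_univ i)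
    rw [Finset.sum_sub_distrib] at h1
    exact h1
  have hNabs : ∀ i x y, |f i (O p i + x) - f i (O p i + y)| ≤ |N x - N y| := by
    intro i x y
    rcases le_total x y with h | h
    · rw [abs_sub_comm, abs_sub_comm (N x), abs_of_nonneg (sub_nonneg.mpr ((hterm i).monotone h)),
        abs_of_nonneg (sub_nonneg.mpr (hN.monotone h))]
      exact hNle i x y h
    · rw [abs_of_nonneg (sub_nonneg.mpr ((hterm i).monotone h)),
        abs_of_nonneg (sub_nonneg.mpr (hN.monotone h))]
      exact hNle i y x h
  obtain ⟨K, c, hc0, hc1, hKup, hKlow, hKδ, hKN⟩ :=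
    exists_collapsing_lift hN hNc hδ hδ1 hε hε1
  have horbit : ∀ (i : ι) (y : ℕ → ℝ), (∀ m, y (m + 1) = (tr n * K) (f (τ^[m] i) (y m))) →
      (∀ m, y (m + p) = y m) → ∀ m, O p (τ^[m] i) - δ ≤ y m ∧ y m ≤ O p (τ^[m] i) := by
    intro i y hy hper
    have hτm : ∀ m, τ^[m + p] i = τ^[m] i := fun m => by rw [Function.iterate_add_apply, hτ]
    have hyK : ∀ m, y (m + 1) = K (f (τ^[m] i) (y m)) + n := hy
    have hyX : ∀ m, (X : ℝ) ≤ y m := by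
      refine forall_of_periodic hp ?_ (fun m h => ?_) fun m h => hper m ▸ h
      · obtain ⟨m, hm⟩ := hbb i
        refine ⟨m + 1, ?_⟩
        rw [hyK]
        linarith [hn2 _ hm (y m), hKlow (f (τ^[m] i) (y m))]
      · rw [hyK]
        have h1 := (hf (τ^[m] i)).monotone h
        linarith [hn1 (τ^[m] i), hKlow (f (τ^[m] i) (y m))]
    have hlow : ∀ k ≤ p, ∀ m, (O k (τ^[m] i) : ℝ) - δ ≤ y m := by
      intro k
      induction k with
      | zero =>
        intro _ m
        have : (O 0 (τ^[m] i) : ℝ) = X := by simp [hO]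
        rw [this]; linarith [hyX m]
      | succ k ih =>
        intro hk
        have hstep : ∀ m, (O (k + 1) (τ^[m + 1] i) : ℝ) - δ ≤ y (m + 1) := by
          intro m
          rw [hyK, Function.iterate_succ_apply', hOsucc]
          have h1 := hεf k (Finset.mem_range.mpr (by omega)) (τ^[m] i)
          have h2 := (hf (τ^[m] i)).monotone (ih (by omega) m)
          have h3 := hKδ _ _ (h1.trans_le h2)
          push_cast; linarith
        intro m
        have h1 := hstep (m + (p - 1))
        rw [show m + (p - 1) + 1 = m + p by omega, hτm, hper] at h1
        exact h1
    have hup : ∀ m, y m ≤ O p (τ^[m] i) := by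
      refine forall_of_periodic hp ?_ (fun m h => ?_) fun m h => by rwa [hper, hτm] at h
      · obtain ⟨m, hm⟩ := hab i
        refine ⟨m + 1, ?_⟩
        rw [hyK, Function.iterate_succ_apply', hofix,
          le_antisymm (hX _ hm (O p (τ^[m] i)))
            (Int.ceil_mono ((hf _).monotone (by exact_mod_cast hOge p _)))]
        have h1 := hKup (f (τ^[m] i) (y m))
        have h2 : (⌈f (τ^[m] i) (y m)⌉ : ℝ) ≤ ⌈f (τ^[m] i) X⌉ := by exact_mod_cast hX _ hm (y m)
        push_cast; linarith
      · rw [hyK, Function.iterate_succ_apply', hofix]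
        have h1 := hKup (f (τ^[m] i) (y m))
        have h2 : (⌈f (τ^[m] i) (y m)⌉ : ℝ) ≤ ⌈f (τ^[m] i) (O p (τ^[m] i))⌉ := by
          exact_mod_cast Int.ceil_mono ((hf _).monotone h)
        push_cast; linarith
    exact fun m => ⟨hlow p le_rfl m, hup m⟩
  have hstepN : ∀ (i : ι) (y : ℕ → ℝ), (∀ m, y (m + 1) = (tr n * K) (f (τ^[m] i) (y m))) →
      (∀ m, y (m + p) = y m) → ∀ m, N (y (m + 1) - O p (τ^[m + 1] i)) =
        N 0 + c * (f (τ^[m] i) (y m) - ⌈f (τ^[m] i) (O p (τ^[m] i))⌉) := by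
    intro i y hy hper m
    obtain ⟨h1, h2⟩ := horbit i y hy hper m
    have h3 := (hf (τ^[m] i)).monotone h1
    have h4 := (hf (τ^[m] i)).monotone h2
    have h5 := hεf p (Finset.mem_range.mpr (by omega)) (τ^[m] i)
    rw [← hKN _ _ (h5.trans_le h3) (h4.trans (Int.le_ceil _)), hy, Function.iterate_succ_apply',
      hofix]
    simp only [mul_apply, tr_apply]
    push_cast
    ring_nf
  refine ⟨tr n * K, fun i y y' hy hper hy' hper' => ?_⟩
  set d : ℕ → ℝ := fun m => |N (y m - O p (τ^[m] i)) - N (y' m - O p (τ^[m] i))| with hd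
  have hdstep : ∀ m, d (m + 1) ≤ c * d m := by
    intro m
    simp only [hd]
    rw [hstepN i y hy hper, hstepN i y' hy' hper',
      show ∀ a b e g : ℝ, a + c * (b - e) - (a + c * (g - e)) = c * (b - g) from
        fun a b e g => by ring, abs_mul, abs_of_pos hc0]
    refine mul_le_mul_of_nonneg_left ?_ hc0.le
    have := hNabs (τ^[m] i) (y m - O p (τ^[m] i)) (y' m - O p (τ^[m] i))
    rwa [add_sub_cancel, add_sub_cancel] at this
  have hdpow : ∀ m, d m ≤ c ^ m * d 0 := by
    intro m
    induction m with
    | zero => simp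
    | succ m ih =>
      refine (hdstep m).trans ?_
      rw [pow_succ', mul_assoc]
      exact mul_le_mul_of_nonneg_left ih hc0.le
  have hdp : d p = d 0 := by
    have h1 := hper 0
    have h2 := hper' 0
    rw [zero_add] at h1 h2
    simp only [hd, h1, h2, hτ, Function.iterate_zero, id]
  have hcp : c ^ p < 1 := pow_lt_one₀ hc0.le hc1 hp.ne'
  have hd0 : d 0 = 0 := by
    have h1 := hdpow p
    rw [hdp] at h1
    have h2 : 0 ≤ d 0 := abs_nonneg _
    nlinarith
  simp only [hd, abs_eq_zero, sub_eq_zero] at hd0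
  have := hN.injective hd0
  linarith

end

end CircleAction
end

open scoped unitInterval
noncomputable section
namespace CircleAction
open Filter Topology Set Lft

/-! ## Semi-conjugacies between bent pairs -/

theorem semiconj_pow {h : CircleDeg1Lift} {C D : Lft} (hCD : ∀ x, h (C x) = D (h x)) (n : ℕ) (x : ℝ) :
    h ((C ^ n) x) = (D ^ n) (h x) := by
  induction n with
  | zero => rfl
  | succ n ih => rw [pow_succ', mul_apply, hCD, ih, pow_succ', mul_apply]

theorem semiconj_ret {h : CircleDeg1Lift} {C D : Lft} (hCD : ∀ x, h (C x) = D (h x)) (p : ℕ) (r : ℤ)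
    (x : ℝ) : h (ret C p r x) = ret D p r (h x) := by
  rw [ret_apply, ret_apply, h.map_sub_int, semiconj_pow hCD]

theorem semiconj_mem_perSet {h : CircleDeg1Lift} {C D : Lft} (hCD : ∀ x, h (C x) = D (h x)) {p : ℕ}
    {r : ℤ} {x : ℝ} (hx : x ∈ perSet C p r) : h x ∈ perSet D p r := by
  rw [mem_perSet, ← semiconj_ret hCD, ret_fix hx]

/-- A fixed point lifts to a fixed point, the last one of its fibre. -/
theorem exists_fix_over {h : CircleDeg1Lift} (hc : Continuous h) {C D : Lft}
    (hCD : ∀ x, h (C x) = D (h x)) {y : ℝ} (hy : D y = y) :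
    ∃ v, h v = y ∧ C v = v ∧ ∀ x, h x = y → x ≤ v := by
  have hne : (h ⁻¹' {y}).Nonempty := by
    obtain ⟨x, hx⟩ := h.continuous_iff_surjective.mp hc y
    exact ⟨x, hx⟩
  have hbd : BddAbove (h ⁻¹' {y}) := by
    obtain ⟨x, hx⟩ := hne
    refine ⟨x + 1, fun z hz => ?_⟩
    by_contra hcon
    have h1 := h.monotone (not_le.mp hcon).le
    rw [h.map_add_one] at h1
    rw [mem_preimage, mem_singleton_iff] at hx hz
    linarith
  have hmem : sSup (h ⁻¹' {y}) ∈ h ⁻¹' {y} := (isClosed_singleton.preimage hc).csSup_mem hne hbd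
  set v := sSup (h ⁻¹' {y})
  have hv : h v = y := hmem
  have hle : ∀ x, h x = y → x ≤ v := fun x hx => le_csSup hbd hx
  refine ⟨v, hv, le_antisymm (hle _ (by rw [hCD, hv, hy])) ?_, hle⟩
  have h1 : h (C⁻¹ v) = y := by
    apply D.injective
    rw [← hCD, apply_inv_self, hv, hy]
  have := (C.le_iff).mpr (hle _ h1)
  rwa [apply_inv_self] at this

theorem exists_mem_perSet_over {h : CircleDeg1Lift} (hc : Continuous h) {C D : Lft}
    (hCD : ∀ x, h (C x) = D (h x)) {p : ℕ} {r : ℤ} {y : ℝ} (hy : y ∈ perSet D p r) :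
    ∃ v, h v = y ∧ v ∈ perSet C p r ∧ ∀ x, h x = y → x ≤ v :=
  exists_fix_over hc (semiconj_ret hCD p r) hy

section

variable {A : Lft} {q : ℕ} {s : ℤ} {h : CircleDeg1Lift}

/-- `h` maps the periodic set into itself, and every periodic point has a periodic preimage; hence
ends of gaps go to ends of gaps. -/
theorem semiconj_lo (hA : RatLift A q s) (hc : Continuous h) (hh : ∀ x, h (A x) = A (h x)) {x : ℝ}
    (hx : h x ∉ perSet A q s) : h (lo (perSet A q s) x) = lo (perSet A q s) (h x) := by
  have hP := hA.perSet
  refine le_antisymm (PerSet.le_lo (semiconj_mem_perSet hh (hP.lo_mem x)) (h.monotone (hP.lo_le x))) ?_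
  obtain ⟨v, hv, hvP, -⟩ := exists_mem_perSet_over hc hh (hP.lo_mem (h x))
  rw [← hv]
  refine h.monotone (PerSet.le_lo hvP (h.monotone.reflect_lt ?_).le)
  rw [hv]; exact hP.lo_lt hx

theorem semiconj_hi (hA : RatLift A q s) (hc : Continuous h) (hh : ∀ x, h (A x) = A (h x)) {x : ℝ}
    (hx : h x ∉ perSet A q s) : h (hi (perSet A q s) x) = hi (perSet A q s) (h x) := by
  have hP := hA.perSet
  refine le_antisymm ?_ (PerSet.hi_le (semiconj_mem_perSet hh (hP.hi_mem x)) (h.monotone (hP.le_hi x)))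
  obtain ⟨v, hv, hvP, -⟩ := exists_mem_perSet_over hc hh (hP.hi_mem (h x))
  rw [← hv]
  refine h.monotone (PerSet.hi_le hvP (h.monotone.reflect_lt ?_).le)
  rw [hv]; exact hP.lt_hi hx

end

/-- Rescaling the parameter makes every intermediate lift the end of a bending path. -/
theorem BendPath.truncate {A F : Lft} (h : BendPath A F) : ∃ c ∈ LftFamily I, c 0 = 1 ∧ c 1 = F ∧
    ∀ t, BendPath A (c t) := by
  obtain ⟨c, hc, h0, h1, hA⟩ := h
  refine ⟨c, hc, h0, h1, fun t => ⟨fun u => c (u * t), fun x => ?_, ?_, ?_, fun u => hA _⟩⟩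
  · exact (hc x).comp (continuous_id.mul continuous_const)
  · simp [h0]
  · simp

/-- A pair of lifts with rational translation numbers, without common periodic points, which
stays semi-conjugate to itself under bending of the second along the first. -/
structure BendPair (A B : Lft) (q : ℕ) (s : ℤ) (p : ℕ) (r : ℤ) : Prop where
  left : RatLift A q s
  right : RatLift B p r
  disj : ∀ x, x ∈ perSet A q s → x ∉ perSet B p r
  bend : Bend A B

/-- The semi-conjugacy which exists for a bent pair. -/
structure BendSemi (A B F : Lft) (h : CircleDeg1Lift) : Prop where
  continuous : Continuous h
  left : ∀ x, h (A x) = A (h x)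
  right : ∀ x, h ((F * B) x) = B (h x)

namespace BendPair

variable {A B : Lft} {q : ℕ} {s : ℤ} {p : ℕ} {r : ℤ} (H : BendPair A B q s p r)
include H

local notation "P" => perSet A q s
local notation "Q" => perSet B p r
local notation "R" => ret B p r

theorem exists_semi {F : Lft} (hF : BendPath A F) : ∃ h, BendSemi A B F h := by
  obtain ⟨h, h1, h2, h3⟩ := H.bend F hF
  exact ⟨h, h1, h2, h3⟩

/-- A common periodic point of `A` and `F * B` would be sent by the semi-conjugacy to a common
periodic point of `A` and `B`. -/
theorem ret_bend_ne {F : Lft} (hF : BendPath A F) {x : ℝ} (hx : x ∈ P) : ret (F * B) p r x ≠ x := by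
  obtain ⟨h, hh⟩ := H.exists_semi hF
  intro hfix
  exact H.disj (h x) (semiconj_mem_perSet hh.left hx) (semiconj_mem_perSet hh.right hfix)

theorem ret_ne {x : ℝ} (hx : x ∈ P) : R x ≠ x := H.disj x hx

/-- Bending does not change the direction in which the return map moves a periodic point. -/
theorem lt_ret_bend_iff {F : Lft} (hF : BendPath A F) {x : ℝ} (hx : x ∈ P) :
    x < ret (F * B) p r x ↔ x < R x := by
  obtain ⟨c, hc, h0, h1, hA⟩ := hF.truncate
  have hcont : Continuous fun t => ret (c t * B) p r x - x := by
    have hmem : (fun _ => tr (-r)) * (c * fun _ => B) ^ p ∈ LftFamily I :=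
      mul_mem (const_mem_LftFamily _) (pow_mem (mul_mem hc (const_mem_LftFamily _)) _)
    exact (hmem x).sub continuous_const
  -- The displacement at a point of `P` never vanishes along the path, so it keeps its sign.
  have hne : ∀ t, ret (c t * B) p r x - x ≠ 0 := fun t =>
    sub_ne_zero.mpr (H.ret_bend_ne (hA t) hx)
  have key : ∀ t t', 0 < ret (c t * B) p r x - x → 0 < ret (c t' * B) p r x - x := by
    intro t t' ht
    by_contra hcon
    obtain ⟨u, hu⟩ := mem_range_of_exists_le_of_exists_ge hcont ⟨t', not_lt.mp hcon⟩ ⟨t, ht.le⟩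
    exact hne u hu
  have e0 : ret (c 0 * B) p r x = R x := by rw [h0, one_mul]
  have e1 : ret (c 1 * B) p r x = ret (F * B) p r x := by rw [h1]
  rw [← sub_pos, ← sub_pos (b := x), ← e0, ← e1]
  exact ⟨key 1 0, key 0 1⟩

theorem ret_bend_lt_iff {F : Lft} (hF : BendPath A F) {x : ℝ} (hx : x ∈ P) :
    ret (F * B) p r x < x ↔ R x < x := by
  have h1 := H.lt_ret_bend_iff hF hx
  have h2 := H.ret_bend_ne hF hx
  have h3 := H.ret_ne hx
  rw [← not_iff_not, not_lt, not_lt, le_iff_lt_or_eq, le_iff_lt_or_eq, h1]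
  simp [h2.symm, h3.symm]

/-- `h` may send `x` to another point of `P`. The displacement of the bent return map at `x` has the
same sign as that of `R` at `x`, because bending preserves it, and as that of `R` at `h x`, because
`h` is monotone. -/
theorem ret_semi_lt_iff {F : Lft} (hF : BendPath A F) {h : CircleDeg1Lift} (hh : BendSemi A B F h)
    {x : ℝ} (hx : x ∈ P) : R (h x) < h x ↔ R x < x := by
  have hx' : h x ∈ P := semiconj_mem_perSet hh.left hx
  have e := semiconj_ret hh.right p r x
  constructor
  · intro h1
    rw [← H.ret_bend_lt_iff hF hx]
    rw [← e] at h1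
    exact h.monotone.reflect_lt h1
  · intro h1
    rw [← H.ret_bend_lt_iff hF hx] at h1
    have := h.monotone h1.le
    rw [e] at this
    exact this.lt_of_ne (H.ret_ne hx')

theorem lt_ret_semi_iff {F : Lft} (hF : BendPath A F) {h : CircleDeg1Lift} (hh : BendSemi A B F h)
    {x : ℝ} (hx : x ∈ P) : h x < R (h x) ↔ x < R x := by
  have h1 := H.ret_semi_lt_iff hF hh hx
  have h2 := H.ret_ne hx
  have h3 := H.ret_ne (semiconj_mem_perSet hh.left hx)
  rw [← not_iff_not, not_lt, not_lt, le_iff_lt_or_eq, le_iff_lt_or_eq, h1]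
  simp [h2, h3]

theorem not_mem_left {y : ℝ} (hy : y ∈ Q) : y ∉ P := fun h => H.disj y h hy

theorem not_mem_bend {F : Lft} {h : CircleDeg1Lift} (hh : BendSemi A B F h)
    {x : ℝ} (hx : x ∈ perSet (F * B) p r) : x ∉ P := fun hxP =>
  H.disj (h x) (semiconj_mem_perSet hh.left hxP) (semiconj_mem_perSet hh.right hx)

/-- Time reversal: every statement about points moved backwards yields one about points moved
forwards. -/
theorem inv_right : BendPair A B⁻¹ q s p (-r) where
  left := H.left
  right := H.right.inv
  disj x hx hx' := by
    refine H.disj x hx ?_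
    rw [mem_perSet, ret_apply, inv_pow] at hx'
    push_cast at hx'
    have h1 : (B ^ p)⁻¹ x = x - r := by linarith
    rw [mem_perSet, ret_apply]
    have h2 : (B ^ p) (x - r) = x := by rw [← h1, apply_inv_self]
    rw [map_sub_int] at h2
    linarith
  bend := H.bend.inv_right

end BendPair

theorem ret_inv (B : Lft) (p : ℕ) (r : ℤ) : ret B⁻¹ p (-r) = (ret B p r)⁻¹ := by
  rw [ret, ret, mul_inv_rev, tr_inv, inv_pow]
  exact (Lft.commute_tr' _ _).eq

theorem perSet_inv (B : Lft) (p : ℕ) (r : ℤ) : perSet B⁻¹ p (-r) = perSet B p r := by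
  ext x
  rw [mem_perSet, mem_perSet, ret_inv, ← (ret B p r).eq_iff, apply_inv_self, eq_comm]

theorem inv_lt_self_iff {S : Lft} {x : ℝ} : S⁻¹ x < x ↔ x < S x := by
  rw [← S.lt_iff, apply_inv_self]

theorem self_lt_inv_iff {S : Lft} {x : ℝ} : x < S⁻¹ x ↔ S x < x := by
  rw [← S.lt_iff, apply_inv_self]

end CircleAction
end

open scoped unitInterval
noncomputable section
namespace CircleAction
open Filter Topology Set Lft

/-! ## Strong bending and the gaps which contain periodic points -/

theorem PerSet.lt_lo_add_one {P : Set ℝ} (hP : PerSet P) (x : ℝ) : x < lo P x + 1 := by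
  by_contra hcon
  have := PerSet.le_lo ((hP.add_one _).mpr (hP.lo_mem x)) (not_lt.mp hcon)
  linarith

theorem PerSet.hi_lt_add_one {P : Set ℝ} (hP : PerSet P) (x : ℝ) : hi P x < x + 1 := by
  by_contra hcon
  have h1 : hi P x - 1 ∈ P := by
    rw [← hP.add_one, sub_add_cancel]; exact hP.hi_mem x
  have := PerSet.hi_le (x := x) h1 (by linarith)
  linarith

/-- If the gaps of a sequence of points converge to a nondegenerate interval, then they are
eventually equal to it. -/
theorem PerSet.eventually_gap_eq {P : Set ℝ} (hP : PerSet P) {l : Filter ℕ} [l.NeBot] {x : ℕ → ℝ}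
    {u v : ℝ} (hu : Tendsto (fun n => lo P (x n)) l (𝓝 u))
    (hv : Tendsto (fun n => hi P (x n)) l (𝓝 v)) (huv : u < v) :
    ∀ᶠ n in l, lo P (x n) = u ∧ hi P (x n) = v := by
  obtain ⟨c, hc⟩ := exists_between huv
  have h1 : ∀ᶠ n in l, lo P c = lo P (x n) ∧ hi P c = hi P (x n) := by
    filter_upwards [hu.eventually (gt_mem_nhds hc.1), hv.eventually (lt_mem_nhds hc.2)] with n h h'
    exact ⟨hP.lo_eq_of_gap ⟨h, h'⟩, hP.hi_eq_of_gap ⟨h, h'⟩⟩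
  have hu' : u = lo P c := tendsto_nhds_unique hu
    (tendsto_const_nhds.congr' (h1.mono fun n h => h.1))
  have hv' : v = hi P c := tendsto_nhds_unique hv
    (tendsto_const_nhds.congr' (h1.mono fun n h => h.2))
  rw [hu', hv']
  exact h1.mono fun n h => ⟨h.1.symm, h.2.symm⟩

theorem exists_tendsto_hyperfilter {u : ℕ → ℝ} {a b : ℝ} (h : ∀ n, u n ∈ Icc a b) :
    ∃ c, Tendsto u (hyperfilter ℕ : Filter ℕ) (𝓝 c) := by
  obtain ⟨c, -, hc⟩ := isCompact_Icc.ultrafilter_le_nhds ((hyperfilter ℕ).map u)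
    (tendsto_principal.mpr (Eventually.of_forall h))
  exact ⟨c, hc⟩

namespace BendPair

variable {A B : Lft} {q : ℕ} {s : ℤ} {p : ℕ} {r : ℤ} (H : BendPair A B q s p r)
include H

local notation "P" => perSet A q s
local notation "Q" => perSet B p r
local notation "R" => ret B p r

/-- An integer translation normalizes the periodic point over `y` to lie in `[y, y + 1)`, which
keeps the points obtained from varying bends in a compact set. -/
theorem exists_semi_over {F : Lft} (hF : BendPath A F) {y : ℝ} (hy : y ∈ Q) :
    ∃ h, BendSemi A B F h ∧ ∃ x ∈ perSet (F * B) p r, h x = y ∧ y ≤ x ∧ x < y + 1 := by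
  obtain ⟨h, hh⟩ := H.exists_semi hF
  obtain ⟨v, hv, hvQ, -⟩ := exists_mem_perSet_over hh.continuous hh.right hy
  set k := ⌊v - y⌋ with hk
  refine ⟨h * toDeg1 (tr k), ⟨hh.continuous.comp (continuous_toDeg1 _), fun x => ?_, fun x => ?_⟩,
    v - k, ?_, ?_, ?_, ?_⟩
  · change h (A x + k) = A (h (x + k))
    rw [← hh.left, map_add_int]
  · change h ((F * B) x + k) = B (h (x + k))
    rw [← hh.right, map_add_int]
  · have := map_mem_perSet_iff (A := F * B) (q := p) (s := r) (commute_tr' (F * B) (-k)) v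
    rw [tr_apply] at this
    push_cast at this
    rw [sub_eq_add_neg, this]; exact hvQ
  · change h (v - k + k) = y
    rw [sub_add_cancel, hv]
  · have := Int.floor_le (v - y); linarith
  · have := Int.lt_floor_add_one (v - y); linarith

/-- Bend by `n` units in the gap coordinate, follow the bent periodic orbit over `y`, and let `n`
tend to infinity along an ultrafilter. The limit orbit `w` and the limit gap ends `u ≤ w ≤ v` exist
by compactness. Where the orbit is not pushed to the right end of its gap, it must have entered at
the left end, so selecting ends `z` suitably gives `B (z m) ≤ z (m + 1)`. After a full period this
says that `R` does not move `z m` forwards, and it fixes no point of `P`. -/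
theorem exists_chain {y : ℝ} (hy : y ∈ Q) :
    ∃ (F : ℕ → Lft) (h : ℕ → CircleDeg1Lift) (x : ℕ → ℕ → ℝ) (z u v : ℕ → ℝ),
      (∀ n, BendPath A (F n)) ∧ (∀ n, BendSemi A B (F n) (h n)) ∧
      (∀ n w, w ∈ P → F n w = w) ∧
      (∀ n m, h n (x n m) = (B ^ m) y) ∧
      (∀ m, Tendsto (fun n => lo P (x n m)) (hyperfilter ℕ : Filter ℕ) (𝓝 (u m))) ∧
      (∀ m, Tendsto (fun n => hi P (x n m)) (hyperfilter ℕ : Filter ℕ) (𝓝 (v m))) ∧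
      (∀ m, z m = u m ∨ z m = v m) ∧ (∀ m, B (z m) ≤ z (m + 1)) ∧
      ∀ m, z m ∈ P ∧ R (z m) < z m := by
  classical
  have hP := H.left.perSet
  let F : ℕ → Lft := fun n => bendLift H.left (tr n)
  have hF : ∀ n, BendPath A (F n) := fun n => bendPath_bendLift H.left _
  choose h hh x₀ hx₀ hhx hx1 hx2 using fun n => H.exists_semi_over (hF n) hy
  let x : ℕ → ℕ → ℝ := fun n m => ((F n * B) ^ m) (x₀ n)
  have hxQ : ∀ n m, x n m ∈ perSet (F n * B) p r := fun n m => (pow_mem_perSet_iff m _).mpr (hx₀ n)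
  have hhxm : ∀ n m, h n (x n m) = (B ^ m) y := fun n m => by
    rw [semiconj_pow (hh n).right, hhx]
  have hxP : ∀ n m, x n m ∉ P := fun n m => H.not_mem_bend (hh n) (hxQ n m)
  have hbd : ∀ n w, h n w ≤ w + 1 ∧ w - 2 ≤ h n w := by
    intro n w
    set k := ⌊w - x₀ n⌋ with hk
    have h1 := Int.floor_le (w - x₀ n)
    have h2 := Int.lt_floor_add_one (w - x₀ n)
    have h3 : h n (x₀ n + k) ≤ h n w := (h n).monotone (by linarith)
    have h4 : h n w ≤ h n (x₀ n + (k + 1 : ℤ)) := (h n).monotone (by push_cast; linarith)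
    rw [(h n).map_add_int, hhx] at h3 h4
    push_cast at h4
    constructor <;> linarith [hx1 n, hx2 n]
  have hxbd : ∀ m n, x n m ∈ Icc ((B ^ m) y - 1) ((B ^ m) y + 2) := fun m n => by
    have := hbd n (x n m)
    rw [hhxm] at this
    exact ⟨by linarith, by linarith⟩
  choose w hw using fun m => exists_tendsto_hyperfilter (hxbd m)
  choose u hu using fun m => exists_tendsto_hyperfilter (u := fun n => lo P (x n m))
    (a := (B ^ m) y - 2) (b := (B ^ m) y + 2) fun n =>
      ⟨by linarith [(hxbd m n).1, hP.lt_lo_add_one (x n m)],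
        by linarith [(hxbd m n).2, hP.lo_le (x n m)]⟩
  choose v hv using fun m => exists_tendsto_hyperfilter (u := fun n => hi P (x n m))
    (a := (B ^ m) y - 1) (b := (B ^ m) y + 3) fun n =>
      ⟨by linarith [(hxbd m n).1, hP.le_hi (x n m)],
        by linarith [(hxbd m n).2, hP.hi_lt_add_one (x n m)]⟩
  have huw : ∀ m, u m ≤ w m := fun m =>
    le_of_tendsto_of_tendsto' (hu m) (hw m) fun n => hP.lo_le _
  have hwv : ∀ m, w m ≤ v m := fun m =>
    le_of_tendsto_of_tendsto' (hw m) (hv m) fun n => hP.le_hi _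
  have huP : ∀ m, u m ∈ P := fun m =>
    hP.closed.mem_of_tendsto (hu m) (Eventually.of_forall fun n => hP.lo_mem _)
  have hvP : ∀ m, v m ∈ P := fun m =>
    hP.closed.mem_of_tendsto (hv m) (Eventually.of_forall fun n => hP.hi_mem _)
  have hxper : ∀ n m, x n (m + p) = x n m + r := fun n m => by
    have h1 : x n (m + p) = ((F n * B) ^ p) (x n m) := by
      simp only [x]; rw [← mul_apply, ← pow_add, add_comm]
    rw [h1, pow_apply_add (s := r), ret_fix (hxQ n m)]
  have hwper : ∀ m, w (m + p) = w m + r := fun m => tendsto_nhds_unique (hw (m + p)) (by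
    simp only [hxper]; exact (hw m).add_const _)
  have huper : ∀ m, u (m + p) = u m + r := fun m => tendsto_nhds_unique (hu (m + p)) (by
    simp only [hxper, hP.lo_add_int]; exact (hu m).add_const _)
  have hvper : ∀ m, v (m + p) = v m + r := fun m => tendsto_nhds_unique (hv (m + p)) (by
    simp only [hxper, hP.hi_add_int]; exact (hv m).add_const _)
  -- The choice ensures `z m ≤ w m` while taking the right end whenever the limit orbit reaches it.
  let z : ℕ → ℝ := fun m => if w m = v m then v m else u m
  have hz : ∀ m, z m = u m ∨ z m = v m := fun m => by
    simp only [z]; split_ifs <;> simp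
  have hzw : ∀ m, z m ≤ w m := fun m => by
    simp only [z]; split_ifs with hc
    · exact hc.ge
    · exact huw m
  have huz : ∀ m, u m ≤ z m := fun m => by
    simp only [z]; split_ifs with hc
    · exact (huw m).trans (hwv m)
    · exact le_rfl
  have hzper : ∀ m, z (m + p) = z m + r := fun m => by
    simp only [z, hwper, huper, hvper, add_left_inj]; split_ifs <;> rfl
  have hzP : ∀ m, z m ∈ P := fun m => by
    rcases hz m with e | e <;> rw [e]
    exacts [huP m, hvP m]
  have hxs : ∀ n m, x n (m + 1) = F n (B (x n m)) := fun n m => by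
    simp only [x]; rw [pow_succ', mul_apply, mul_apply]
  have hBP : ∀ n m, B (x n m) ∉ P := fun n m h1 => by
    refine hxP n (m + 1) ?_
    rw [hxs, map_mem_perSet_iff (hF n).commute]; exact h1
  have hgap : ∀ n m, x n (m + 1) ∈ Ioo (lo P (B (x n m))) (hi P (B (x n m))) := fun n m => by
    rw [hxs]; exact bendLift_mem_gap H.left _ (hBP n m)
  have hBgap : ∀ n m, B (x n m) ∈ Ioo (lo P (x n (m + 1))) (hi P (x n (m + 1))) := fun n m => by
    rw [hP.lo_eq_of_gap (hgap n m), hP.hi_eq_of_gap (hgap n m)]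
    exact hP.self_mem_gap (hBP n m)
  have hstep : ∀ m, B (w m) ≤ z (m + 1) := by
    intro m
    have hBw : Tendsto (fun n => B (x n m)) (hyperfilter ℕ : Filter ℕ) (𝓝 (B (w m))) :=
      (B.continuous.tendsto _).comp (hw m)
    by_contra! hcon
    have hlt : u (m + 1) < B (w m) := (huz _).trans_lt hcon
    have hle : B (w m) ≤ v (m + 1) :=
      le_of_tendsto_of_tendsto' hBw (hv (m + 1)) fun n => (hBgap n m).2.le
    have hev := hP.eventually_gap_eq (hu (m + 1)) (hv (m + 1)) (hlt.trans_le hle)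
    obtain ⟨c, hc1, hc2⟩ := exists_between hlt
    -- The image `B (w m)` is strictly to the right of `u (m + 1)`, so the gaps are eventually one
    -- fixed gap. In it `x n (m + 1)` is `n` coordinate units beyond a point with coordinate bounded
    -- below, hence eventually passes every `d < v (m + 1)`.
    have hge : v (m + 1) ≤ w (m + 1) := by
      refine le_of_forall_lt fun d' hd' => ?_
      obtain ⟨d, hd1, hd2⟩ := exists_between (max_lt hd' (hlt.trans_le hle))
      refine (le_max_left _ _).trans_lt (hd1.trans_le (ge_of_tendsto (hw (m + 1)) ?_))
      obtain ⟨N, hN⟩ := exists_nat_ge (coord A q s d - coord A q s c)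
      have hlarge : ∀ᶠ n in (hyperfilter ℕ : Filter ℕ), N ≤ n :=
        Nat.hyperfilter_le_atTop (eventually_ge_atTop N)
      filter_upwards [hev, hBw.eventually (lt_mem_nhds hc2), hlarge] with n hn hn2 hn3
      have hd : d ∈ Ioo (lo P (x n (m + 1))) (hi P (x n (m + 1))) := by
        rw [hn.1, hn.2]; exact ⟨(le_max_right _ _).trans_lt hd1, hd2⟩
      have hc : c ∈ Ioo (lo P (x n (m + 1))) (hi P (x n (m + 1))) := by
        rw [hn.1, hn.2]; exact ⟨hc1, hc2.trans_le hle⟩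
      have hmono := coord_strictMonoOn H.left (hxP n (m + 1))
      rw [← hmono.le_iff_le hd (hP.self_mem_gap (hxP n (m + 1)))]
      have e1 : coord A q s (x n (m + 1)) = coord A q s (B (x n m)) + n := by
        rw [hxs]
        have := coord_bendLift H.left (tr n) (hBP n m)
        simpa using this
      have e2 := hmono hc (hBgap n m) hn2
      have e3 : (N : ℝ) ≤ n := by exact_mod_cast hn3
      linarith
    have : z (m + 1) = v (m + 1) := if_pos (le_antisymm (hwv _) hge)
    rw [this] at hcon
    exact absurd hle (not_le.mpr hcon)
  have hzstep : ∀ m, B (z m) ≤ z (m + 1) := fun m => (B.le_iff.mpr (hzw m)).trans (hstep m)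
  have hzpow : ∀ k m, (B ^ k) (z m) ≤ z (m + k) := by
    intro k m
    induction k with
    | zero => rfl
    | succ k ih =>
      rw [pow_succ', mul_apply]; exact (B.le_iff.mpr ih).trans (hzstep _)
  refine ⟨F, h, x, z, u, v, hF, hh, fun n w hw => bendLift_of_mem H.left _ hw, hhxm, hu, hv, hz,
    hzstep, fun m => ⟨hzP m, ?_⟩⟩
  have h1 := hzpow p m
  rw [hzper, pow_apply_add (s := r)] at h1
  exact lt_of_le_of_ne (by linarith) (H.ret_ne (hzP m))

/-- A gap of `P` containing a point of `Q` has an end point that is moved backwards. -/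
theorem exists_end_lt {y : ℝ} (hy : y ∈ Q) :
    R (lo P y) < lo P y ∨ R (hi P y) < hi P y := by
  have hyP := H.not_mem_left hy
  obtain ⟨F, h, x, z, u, v, hF, hh, -, hhx, hu, hv, hz, -, hzR⟩ := H.exists_chain hy
  -- Being moved backwards is an open condition, so it passes from the limit end to an end of an
  -- actual gap, and then through `h n` to the gap of `y`.
  have hopen : ∀ a, R a < a → ∀ᶠ b in 𝓝 a, R b < b := fun a ha =>
    (R).continuous.continuousAt.eventually_lt continuousAt_id ha
  have hhx0 : ∀ n, h n (x n 0) = y := fun n => by rw [hhx]; rfl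
  rcases hz 0 with e | e
  · left
    obtain ⟨n, hn⟩ := ((hu 0).eventually (hopen _ (e ▸ (hzR 0).2))).exists
    rw [← hhx0 n, ← semiconj_lo H.left (hh n).continuous (hh n).left (by rwa [hhx0 n])]
    exact (H.ret_semi_lt_iff (hF n) (hh n) (H.left.perSet.lo_mem _)).mpr hn
  · right
    obtain ⟨n, hn⟩ := ((hv 0).eventually (hopen _ (e ▸ (hzR 0).2))).exists
    rw [← hhx0 n, ← semiconj_hi H.left (hh n).continuous (hh n).left (by rwa [hhx0 n])]
    exact (H.ret_semi_lt_iff (hF n) (hh n) (H.left.perSet.hi_mem _)).mpr hn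

theorem exists_end_gt {y : ℝ} (hy : y ∈ Q) :
    lo P y < R (lo P y) ∨ hi P y < R (hi P y) := by
  have := H.inv_right.exists_end_lt (y := y) (by rwa [perSet_inv])
  rwa [ret_inv, inv_lt_self_iff, inv_lt_self_iff] at this

/-- The return map moves the end points of a gap that contains a point of `Q` in opposite
directions: both inwards or both outwards. -/
theorem ends {y : ℝ} (hy : y ∈ Q) :
    (lo P y < R (lo P y) ∧ R (hi P y) < hi P y) ∨ (R (lo P y) < lo P y ∧ hi P y < R (hi P y)) := by
  rcases H.exists_end_lt hy with h1 | h1 <;> rcases H.exists_end_gt hy with h2 | h2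
  · linarith
  · exact Or.inr ⟨h1, h2⟩
  · exact Or.inl ⟨h2, h1⟩
  · linarith

/-- Refines the chain to two consecutive gaps at once: for a suitable `n` both gaps equal their
limits, so `h n` sends `z 0` and `z 1` to ends of the gaps of `y` and `B y`, and preserves their
inequality. -/
theorem exists_step_lt {y : ℝ} (hy : y ∈ Q) :
    ∃ Z Z', (Z = lo P y ∨ Z = hi P y) ∧ (Z' = lo P (B y) ∨ Z' = hi P (B y)) ∧ B Z ≤ Z' ∧
      R Z < Z ∧ R Z' < Z' := by
  have hP := H.left.perSet
  have hyP := H.not_mem_left hy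
  obtain ⟨F, h, x, z, u, v, hF, hh, hFP, hhx, hu, hv, hz, hzs, hzR⟩ := H.exists_chain hy
  have hBm : ∀ m, (B ^ m) y ∈ Q := fun m => (pow_mem_perSet_iff m y).mpr hy
  have hBmP : ∀ m, (B ^ m) y ∉ P := fun m => H.not_mem_left (hBm m)
  have hlo : ∀ n m, h n (lo P (x n m)) = lo P ((B ^ m) y) := fun n m => by
    rw [← hhx n m, semiconj_lo H.left (hh n).continuous (hh n).left (by rw [hhx n m]; exact hBmP m)]
  have hhi : ∀ n m, h n (hi P (x n m)) = hi P ((B ^ m) y) := fun n m => by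
    rw [← hhx n m, semiconj_hi H.left (hh n).continuous (hh n).left (by rw [hhx n m]; exact hBmP m)]
  have hsign : ∀ n m, (R (lo P (x n m)) - lo P (x n m)) * (R (hi P (x n m)) - hi P (x n m)) ≤ 0 := by
    intro n m
    have e1 := H.ret_semi_lt_iff (hF n) (hh n) (hP.lo_mem (x n m))
    have e2 := H.ret_semi_lt_iff (hF n) (hh n) (hP.hi_mem (x n m))
    have e3 := H.lt_ret_semi_iff (hF n) (hh n) (hP.lo_mem (x n m))
    have e4 := H.lt_ret_semi_iff (hF n) (hh n) (hP.hi_mem (x n m))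
    rw [hlo] at e1 e3
    rw [hhi] at e2 e4
    rcases H.ends (hBm m) with h1 | h1
    · exact mul_nonpos_of_nonneg_of_nonpos (by linarith [e3.mp h1.1]) (by linarith [e2.mp h1.2])
    · exact mul_nonpos_of_nonpos_of_nonneg (by linarith [e1.mp h1.1]) (by linarith [e4.mp h1.2])
  -- The ends of each gap are moved in opposite directions; if the gaps shrank to a point, `R` would
  -- fix that point of `P`.
  have huv : ∀ m, u m < v m := by
    intro m
    have hle : u m ≤ v m :=
      le_of_tendsto_of_tendsto' (hu m) (hv m) fun n => (hP.lo_le _).trans (hP.le_hi _)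
    refine hle.lt_of_ne fun heq => ?_
    have hc : Continuous fun a => R a - a := (R).continuous.sub continuous_id
    have ht := ((hc.tendsto _).comp (hu m)).mul ((hc.tendsto _).comp (hv m))
    have h1 := le_of_tendsto' ht (hsign · m)
    rw [← heq] at h1
    have h2 : R (u m) - u m = 0 := by nlinarith [mul_self_nonneg (R (u m) - u m)]
    refine H.ret_ne (x := u m) ?_ (by linarith)
    exact hP.closed.mem_of_tendsto (hu m) (Eventually.of_forall fun n => hP.lo_mem _)
  obtain ⟨n, h0, h1⟩ := ((hP.eventually_gap_eq (hu 0) (hv 0) (huv 0)).and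
    (hP.eventually_gap_eq (hu 1) (hv 1) (huv 1))).exists
  have hend : ∀ m, lo P (x n m) = u m ∧ hi P (x n m) = v m →
      h n (z m) = lo P ((B ^ m) y) ∨ h n (z m) = hi P ((B ^ m) y) := by
    intro m hm
    rcases hz m with e | e
    · left; rw [e, ← hm.1, hlo]
    · right; rw [e, ← hm.2, hhi]
  refine ⟨h n (z 0), h n (z 1), hend 0 h0, by simpa using hend 1 h1, ?_, ?_, ?_⟩
  · rw [← (hh n).right]
    refine (h n).monotone ?_
    rw [← hFP n _ (hzR 1).1]
    exact (F n).le_iff.mpr (hzs 0)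
  · exact (H.ret_semi_lt_iff (hF n) (hh n) (hzR 0).1).mpr (hzR 0).2
  · exact (H.ret_semi_lt_iff (hF n) (hh n) (hzR 1).1).mpr (hzR 1).2

theorem exists_step_gt {y : ℝ} (hy : y ∈ Q) :
    ∃ Z Z', (Z = lo P y ∨ Z = hi P y) ∧ (Z' = lo P (B y) ∨ Z' = hi P (B y)) ∧ Z' ≤ B Z ∧
      Z < R Z ∧ Z' < R Z' := by
  obtain ⟨Z', Z, h1, h2, h3, h4, h5⟩ := H.inv_right.exists_step_lt (y := B y) (by
    rwa [perSet_inv, self_mem_perSet_iff])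
  rw [ret_inv, inv_lt_self_iff] at h4 h5
  rw [inv_apply_self] at h2
  refine ⟨Z, Z', h2, h1, ?_, h5, h4⟩
  have := B.le_iff.mpr h3
  rwa [apply_inv_self] at this

/-- The gap of `y ∈ Q` is of contracting type. -/
def Contr (_ : BendPair A B q s p r) (y : ℝ) : Prop := lo P y < R (lo P y) ∧ R (hi P y) < hi P y

/-- In a contracting gap the end moved backwards is the right one and the end moved forwards the
left one, which identifies the ends in `exists_step_lt` and `exists_step_gt`. If the gap of `B y`
were expanding, its left end would lie beyond `B (hi P y)`, hence beyond `B y`. -/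
theorem contr_step {y : ℝ} (hy : y ∈ Q) (hc : H.Contr y) :
    H.Contr (B y) ∧ lo P (B y) ≤ B (lo P y) ∧ B (hi P y) ≤ hi P (B y) := by
  have hP := H.left.perSet
  have hyP := H.not_mem_left hy
  have hBy : B y ∈ Q := (self_mem_perSet_iff y).mpr hy
  have hByP := H.not_mem_left hBy
  obtain ⟨Z, Z', h1, h2, h3, h4, h5⟩ := H.exists_step_lt hy
  obtain ⟨W, W', g1, g2, g3, g4, g5⟩ := H.exists_step_gt hy
  have hZ : Z = hi P y := h1.resolve_left fun e => by rw [e] at h4; linarith [hc.1]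
  have hW : W = lo P y := g1.resolve_right fun e => by rw [e] at g4; linarith [hc.2]
  have hcB : H.Contr (B y) := by
    refine (H.ends hBy).resolve_right fun he => ?_
    have hZ' : Z' = lo P (B y) := h2.resolve_right fun e => by rw [e] at h5; linarith [he.2]
    rw [hZ, hZ'] at h3
    have e1 := B.lt_iff.mpr (hP.lt_hi hyP)
    linarith [hP.lo_lt hByP]
  refine ⟨hcB, ?_, ?_⟩
  · have hW' : W' = lo P (B y) := g2.resolve_right fun e => by rw [e] at g5; linarith [hcB.2]
    rwa [hW, hW'] at g3
  · have hZ' : Z' = hi P (B y) := h2.resolve_left fun e => by rw [e] at h5; linarith [hcB.1]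
    rwa [hZ, hZ'] at h3

end BendPair

end CircleAction
end

open scoped unitInterval
noncomputable section
namespace CircleAction
open Filter Topology Set Lft

/-! ## Uniqueness of the periodic point in a gap -/

namespace BendPair

variable {A B : Lft} {q : ℕ} {s : ℤ} {p : ℕ} {r : ℤ} (H : BendPair A B q s p r)
include H

local notation "P" => perSet A q s
local notation "Q" => perSet B p r
local notation "R" => ret B p r

theorem contr_of_lo_eq {y y' : ℝ} (hy : y ∈ Q) (hy' : y' ∈ Q) (hc : H.Contr y) (k : ℤ)
    (h : lo P y' = lo P y + k) : H.Contr y' ∧ y' - k ∈ Ioo (lo P y) (hi P y) := by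
  have hP := H.left.perSet
  have h1 : y' - k ∈ Ioo (lo P y) (hi P y) := by
    refine hP.mem_gap_of_lo_eq (H.not_mem_left hy) ?_ ?_
    · have := hP.add_int (y' - k) k
      rw [sub_add_cancel] at this
      rw [← this]; exact H.not_mem_left hy'
    · have := hP.lo_add_int (y' - k) k
      rw [sub_add_cancel, h] at this
      linarith
  have h2 : hi P y' = hi P y + k := by
    have := hP.hi_add_int (y' - k) k
    rwa [sub_add_cancel, hP.hi_eq_of_gap h1] at this
  refine ⟨?_, h1⟩
  rw [Contr, h, h2, map_add_int, map_add_int]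
  exact ⟨by linarith [hc.1], by linarith [hc.2]⟩

theorem contr_pow {y : ℝ} (hy : y ∈ Q) (hc : H.Contr y) (m : ℕ) : H.Contr ((B ^ m) y) := by
  induction m with
  | zero => exact hc
  | succ m ih =>
    rw [pow_succ', mul_apply]
    exact (H.contr_step ((pow_mem_perSet_iff m y).mpr hy) ih).1

theorem map_gap {y : ℝ} (hy : y ∈ Q) (hc : H.Contr y) {x : ℝ} (hx : x ∈ Ioo (lo P y) (hi P y)) :
    B x ∈ Ioo (lo P (B y)) (hi P (B y)) := by
  obtain ⟨-, h1, h2⟩ := H.contr_step hy hc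
  exact ⟨h1.trans_lt (B.lt_iff.mpr hx.1), (B.lt_iff.mpr hx.2).trans_le h2⟩

omit H in
theorem pow_period {y : ℝ} (hy : y ∈ Q) : (B ^ p) y = y + r := by
  rw [pow_apply_add (s := r), ret_fix hy]

/-- If `B` matched right ends all around the cycle, the right end would be a fixed point of `R` in
`P`. -/
theorem exists_lt_hi {y : ℝ} (hy : y ∈ Q) (hc : H.Contr y) :
    ∃ m, B (hi P ((B ^ m) y)) < hi P (B ((B ^ m) y)) := by
  by_contra! hcon
  have h1 : ∀ m, (B ^ m) (hi P y) = hi P ((B ^ m) y) := by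
    intro m
    induction m with
    | zero => rfl
    | succ m ih =>
      rw [pow_succ', mul_apply, mul_apply, ih]
      exact le_antisymm (H.contr_step ((pow_mem_perSet_iff m y).mpr hy) (H.contr_pow hy hc m)).2.2
        (hcon m)
  have h2 := h1 p
  rw [pow_period hy, H.left.perSet.hi_add_int, pow_apply_add (s := r)] at h2
  exact H.ret_ne (H.left.perSet.hi_mem y) (by linarith)

theorem exists_lo_lt {y : ℝ} (hy : y ∈ Q) (hc : H.Contr y) :
    ∃ m, lo P (B ((B ^ m) y)) < B (lo P ((B ^ m) y)) := by
  by_contra! hcon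
  have h1 : ∀ m, (B ^ m) (lo P y) = lo P ((B ^ m) y) := by
    intro m
    induction m with
    | zero => rfl
    | succ m ih =>
      rw [pow_succ', mul_apply, mul_apply, ih]
      exact le_antisymm (hcon m)
        (H.contr_step ((pow_mem_perSet_iff m y).mpr hy) (H.contr_pow hy hc m)).2.1
  have h2 := h1 p
  rw [pow_period hy, H.left.perSet.lo_add_int, pow_apply_add (s := r)] at h2
  exact H.ret_ne (H.left.perSet.lo_mem y) (by linarith)

/-- The left end points of the gaps that contain a point of `Q` in the unit interval. -/
theorem finite_lo : (lo P '' (Q ∩ Icc 0 1)).Finite := by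
  have hK : IsCompact (Q ∩ Icc (0 : ℝ) 1) := isCompact_Icc.inter_left H.right.perSet.closed
  obtain ⟨t, -, ht⟩ := hK.elim_nhds_subcover (fun y => Ioo (lo P y) (hi P y)) fun y hy =>
    isOpen_Ioo.mem_nhds (H.left.perSet.self_mem_gap (H.not_mem_left hy.1))
  refine (t.finite_toSet.image (lo P)).subset ?_
  rintro _ ⟨y, hy, rfl⟩
  obtain ⟨w, hw, hyw⟩ := mem_iUnion₂.mp (ht hy)
  exact ⟨w, hw, (H.left.perSet.lo_eq_of_gap hyw).symm⟩

/-- The points of `Q` in gaps of contracting type, two of them being identified if their gaps are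
translates of each other. -/
def gapSetoid : Setoid {y : ℝ // y ∈ perSet B p r ∧ H.Contr y} where
  r y y' := ∃ k : ℤ, lo (perSet A q s) y' = lo (perSet A q s) y + k
  iseqv :=
    { refl := fun y => ⟨0, by simp⟩
      symm := by
        rintro y y' ⟨k, h⟩
        exact ⟨-k, by rw [h]; push_cast; ring⟩
      trans := by
        rintro y y' y'' ⟨k, h⟩ ⟨k', h'⟩
        exact ⟨k + k', by rw [h', h]; push_cast; ring⟩ }

theorem finite_gaps : Finite (Quotient H.gapSetoid) := by
  have hfin := H.finite_lo
  have : Finite (lo P '' (Q ∩ Icc 0 1)) := hfin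
  let f : Quotient H.gapSetoid → lo P '' (Q ∩ Icc 0 1) := fun c =>
    ⟨lo P ((c.out : ℝ) + (-⌊(c.out : ℝ)⌋ : ℤ)), _, ⟨(H.right.perSet.add_int _ _).mpr c.out.2.1, by
      push_cast
      constructor
      · linarith [Int.floor_le (c.out : ℝ)]
      · linarith [Int.lt_floor_add_one (c.out : ℝ)]⟩, rfl⟩
  refine Finite.of_injective f fun c c' h => ?_
  have h1 := congrArg Subtype.val h
  simp only [f, H.left.perSet.lo_add_int] at h1
  rw [← Quotient.out_equiv_out]
  refine ⟨⌊(c'.out : ℝ)⌋ - ⌊(c.out : ℝ)⌋, ?_⟩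
  push_cast at h1 ⊢
  linarith

/-- The action of `B` on the gaps of contracting type. -/
def gapMap : Quotient H.gapSetoid → Quotient H.gapSetoid :=
  Quotient.map (fun y => ⟨B y, (self_mem_perSet_iff _).mpr y.2.1, (H.contr_step y.2.1 y.2.2).1⟩) (by
    rintro ⟨y, hy, hc⟩ ⟨y', hy', hc'⟩ ⟨k, h⟩
    refine ⟨k, ?_⟩
    have h1 := (H.contr_of_lo_eq hy hy' hc k h).2
    have h2 := H.left.perSet.lo_eq_of_gap (H.map_gap hy hc h1)
    rw [map_sub_int] at h2
    have h3 := H.left.perSet.lo_add_int (B y' - k) k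
    rw [sub_add_cancel] at h3
    change lo P (B y') = lo P (B y) + k
    rw [h3, h2])

omit H in
theorem coordInv_add_int (hA : RatLift A q s) {x : ℝ} (hx : x ∉ P) (k : ℤ) (t : ℝ) :
    coordInv A q s (x + k) t = coordInv A q s x t + k := by
  have hm := coordInv_mem hA hx t
  have h1 : coordInv A q s x t + k ∈ Ioo (lo P (x + k)) (hi P (x + k)) := by
    rw [hA.perSet.lo_add_int, hA.perSet.hi_add_int]
    exact ⟨by linarith [hm.1], by linarith [hm.2]⟩
  have h2 := coordInv_coord hA (by rwa [hA.perSet.add_int]) h1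
  rwa [coord_add_int hA (PerSet.not_mem_of_gap hm), coord_coordInv hA hx] at h2

/-- The map `B` in the coordinates of a gap of contracting type and of the next gap. -/
def gapFun : Quotient H.gapSetoid → ℝ → ℝ :=
  Quotient.lift (fun y t => coord A q s (B (coordInv A q s y t))) (by
    rintro ⟨y, hy, hc⟩ ⟨y', hy', hc'⟩ ⟨k, h⟩
    funext t
    have h1 := (H.contr_of_lo_eq hy hy' hc k h).2
    have hyP := H.not_mem_left hy
    have h2 := coordInv_add_int H.left (PerSet.not_mem_of_gap h1) k t
    rw [sub_add_cancel, coordInv_congr H.left h1] at h2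
    change coord A q s (B (coordInv A q s y t)) = coord A q s (B (coordInv A q s y' t))
    rw [h2, map_add_int, coord_add_int H.left]
    exact PerSet.not_mem_of_gap (H.map_gap hy hc (coordInv_mem H.left hyP t)))

theorem gapMap_iterate {y : ℝ} (hy : y ∈ Q) (hc : H.Contr y) (m : ℕ) :
    H.gapMap^[m] (Quotient.mk _ ⟨y, hy, hc⟩) =
      Quotient.mk _ ⟨(B ^ m) y, (pow_mem_perSet_iff m y).mpr hy, H.contr_pow hy hc m⟩ := by
  induction m with
  | zero => rfl
  | succ m ih =>
    rw [Function.iterate_succ_apply', ih]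
    refine congrArg (Quotient.mk _) (Subtype.ext ?_)
    change B ((B ^ m) y) = (B ^ (m + 1)) y
    rw [pow_succ', mul_apply]

theorem gapFun_strictMono (c : Quotient H.gapSetoid) : StrictMono (H.gapFun c) := by
  induction c using Quotient.inductionOn with
  | h y =>
    obtain ⟨y, hy, hc⟩ := y
    have hyP := H.not_mem_left hy
    have hBP := H.not_mem_left ((self_mem_perSet_iff y).mpr hy)
    intro t t' h
    exact coord_strictMonoOn H.left hBP (H.map_gap hy hc (coordInv_mem H.left hyP t))
      (H.map_gap hy hc (coordInv_mem H.left hyP t')) (B.lt_iff.mpr (coordInv_strictMono H.left hyP h))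

theorem gapFun_continuous (c : Quotient H.gapSetoid) : Continuous (H.gapFun c) := by
  induction c using Quotient.inductionOn with
  | h y =>
    obtain ⟨y, hy, hc⟩ := y
    have hyP := H.not_mem_left hy
    have hBP := H.not_mem_left ((self_mem_perSet_iff y).mpr hy)
    exact (coord_continuousOn H.left hBP).comp_continuous
      (B.continuous.comp (coordInv_continuous H.left hyP))
      fun t => H.map_gap hy hc (coordInv_mem H.left hyP t)

/-- Somewhere on the cycle `B` sends the right end strictly inside the next gap; its coordinate
there is an upper bound. -/
theorem gapFun_bddAbove (c : Quotient H.gapSetoid) :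
    ∃ m, BddAbove (range (H.gapFun (H.gapMap^[m] c))) := by
  induction c using Quotient.inductionOn with
  | h y =>
    obtain ⟨y, hy, hc⟩ := y
    obtain ⟨m, hm⟩ := H.exists_lt_hi hy hc
    refine ⟨m, coord A q s (B (hi P ((B ^ m) y))), ?_⟩
    rw [H.gapMap_iterate hy hc]
    rintro _ ⟨t, rfl⟩
    have hmQ : (B ^ m) y ∈ Q := (pow_mem_perSet_iff m y).mpr hy
    have hmc := H.contr_pow hy hc m
    have hyP := H.not_mem_left hmQ
    have hBP := H.not_mem_left ((self_mem_perSet_iff _).mpr hmQ)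
    have hcm := coordInv_mem H.left hyP t
    refine (coord_strictMonoOn H.left hBP (H.map_gap hmQ hmc hcm) ⟨?_, hm⟩ (B.lt_iff.mpr hcm.2)).le
    exact (H.map_gap hmQ hmc hcm).1.trans (B.lt_iff.mpr hcm.2)

theorem gapFun_bddBelow (c : Quotient H.gapSetoid) :
    ∃ m, BddBelow (range (H.gapFun (H.gapMap^[m] c))) := by
  induction c using Quotient.inductionOn with
  | h y =>
    obtain ⟨y, hy, hc⟩ := y
    obtain ⟨m, hm⟩ := H.exists_lo_lt hy hc
    refine ⟨m, coord A q s (B (lo P ((B ^ m) y))), ?_⟩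
    rw [H.gapMap_iterate hy hc]
    rintro _ ⟨t, rfl⟩
    have hmQ : (B ^ m) y ∈ Q := (pow_mem_perSet_iff m y).mpr hy
    have hmc := H.contr_pow hy hc m
    have hyP := H.not_mem_left hmQ
    have hBP := H.not_mem_left ((self_mem_perSet_iff _).mpr hmQ)
    have hcm := coordInv_mem H.left hyP t
    refine (coord_strictMonoOn H.left hBP ⟨hm, ?_⟩ (H.map_gap hmQ hmc hcm) (B.lt_iff.mpr hcm.1)).le
    exact (B.lt_iff.mpr hcm.1).trans (H.map_gap hmQ hmc hcm).2

theorem gapMap_period (c : Quotient H.gapSetoid) : H.gapMap^[p] c = c := by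
  induction c using Quotient.inductionOn with
  | h y =>
    obtain ⟨y, hy, hc⟩ := y
    rw [H.gapMap_iterate hy hc]
    refine Quotient.sound ⟨-r, ?_⟩
    change lo P y = lo P ((B ^ p) y) + ((-r : ℤ) : ℝ)
    rw [pow_period hy, H.left.perSet.lo_add_int]; push_cast; ring

/-- Bend by the collapsing `κ`, for which the cycle of contracting gaps admits only one periodic
orbit. Two points of `Q` in one gap would lift through the semi-conjugacy to two periodic points of
`F * B` in one contracting gap. -/
theorem eq_of_contr {y y' : ℝ} (hy : y ∈ Q) (hc : H.Contr y) (hy' : y' ∈ Q)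
    (hg : y' ∈ Ioo (lo P y) (hi P y)) : y = y' := by
  wlog hlt : y < y' generalizing y y'
  · rcases (not_lt.mp hlt).eq_or_lt with h | h
    · exact h.symm
    · have hlo := H.left.perSet.lo_eq_of_gap hg
      refine (this hy' (H.contr_of_lo_eq hy hy' hc 0 (by simpa using hlo)).1 hy ?_ h).symm
      rw [hlo, H.left.perSet.hi_eq_of_gap hg]
      exact H.left.perSet.self_mem_gap (H.not_mem_left hy)
  exfalso
  have hP := H.left.perSet
  have := H.finite_gaps
  obtain ⟨κ, hκ⟩ := exists_collapse H.right.pos H.gapMap_period H.gapFun_strictMono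
    H.gapFun_continuous H.gapFun_bddAbove H.gapFun_bddBelow
  have hF := bendPath_bendLift H.left κ
  set F := bendLift H.left κ with hFdef
  obtain ⟨h, hh⟩ := H.exists_semi hF
  obtain ⟨x, hx, hxQ, -⟩ := exists_mem_perSet_over hh.continuous hh.right hy
  obtain ⟨x', hx', hxQ', -⟩ := exists_mem_perSet_over hh.continuous hh.right hy'
  have hxP := H.not_mem_bend hh hxQ
  have hxP' := H.not_mem_bend hh hxQ'
  have hyP := H.not_mem_left hy
  have hyP' := H.not_mem_left hy'
  have hlox := semiconj_lo H.left hh.continuous hh.left (x := x) (by rwa [hx])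
  have hhix := semiconj_hi H.left hh.continuous hh.left (x := x) (by rwa [hx])
  have hlox' := semiconj_lo H.left hh.continuous hh.left (x := x') (by rwa [hx'])
  rw [hx] at hlox hhix
  rw [hx'] at hlox'
  have hxx' : x < x' := h.monotone.reflect_lt (by rwa [hx, hx'])
  -- In different gaps, the ends between `x` and `x'` would be sent to the right end and the left
  -- end of the gap of `y` in the wrong order.
  have hsame : lo P x = lo P x' := by
    by_contra hne
    have h1 := h.monotone (hP.hi_le_lo hxx'.le hne)
    rw [hhix, hlox', hP.lo_eq_of_gap hg] at h1
    linarith [hP.lo_lt hyP, hP.lt_hi hyP]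
  have hx'g := hP.mem_gap_of_lo_eq hxP hxP' hsame
  have hxg := hP.self_mem_gap hxP
  have hc1 : lo P x < R (lo P x) := by
    rw [← H.lt_ret_semi_iff hF hh (hP.lo_mem x), hlox]; exact hc.1
  have hc2 : R (hi P x) < hi P x := by
    rw [← H.ret_semi_lt_iff hF hh (hP.hi_mem x), hhix]; exact hc.2
  -- The gap of `x` may differ from that of `y`. Its ends still move inwards, so it contains a point
  -- of `Q` and takes part in the dynamics that `κ` collapses.
  obtain ⟨w, hw, hwQ⟩ : ∃ w ∈ Ioo (lo P x) (hi P x), w ∈ Q := by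
    have hcont : Continuous fun a => R a - a := (R).continuous.sub continuous_id
    obtain ⟨w, hw, hw0⟩ := intermediate_value_Icc' (hxg.1.trans hxg.2).le hcont.continuousOn
      (show (0 : ℝ) ∈ Icc _ _ from ⟨by linarith, by linarith⟩)
    have hwQ : w ∈ Q := sub_eq_zero.mp hw0
    have hwP := H.not_mem_left hwQ
    exact ⟨w, ⟨hw.1.lt_of_ne fun e => hwP (e ▸ hP.lo_mem x),
      hw.2.lt_of_ne fun e => hwP (e ▸ hP.hi_mem x)⟩, hwQ⟩
  have hwc : H.Contr w := by
    rw [Contr, hP.lo_eq_of_gap hw, hP.hi_eq_of_gap hw]; exact ⟨hc1, hc2⟩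
  have hmQ : ∀ m, (B ^ m) w ∈ Q := fun m => (pow_mem_perSet_iff m w).mpr hwQ
  have orbit : ∀ v, v ∈ perSet (F * B) p r → v ∈ Ioo (lo P w) (hi P w) →
      (∀ m, coord A q s (((F * B) ^ (m + 1)) v) =
        κ (H.gapFun (H.gapMap^[m] (Quotient.mk _ ⟨w, hwQ, hwc⟩)) (coord A q s (((F * B) ^ m) v)))) ∧
      ∀ m, coord A q s (((F * B) ^ (m + p)) v) = coord A q s (((F * B) ^ m) v) := by
    intro v hvQ hvg
    have hstep : ∀ m, ((F * B) ^ m) v ∈ Ioo (lo P ((B ^ m) w)) (hi P ((B ^ m) w)) := by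
      intro m
      induction m with
      | zero => exact hvg
      | succ m ih =>
        rw [pow_succ' (F * B), mul_apply, mul_apply, pow_succ' B, mul_apply]
        have h1 := H.map_gap (hmQ m) (H.contr_pow hwQ hwc m) ih
        have h2 := bendLift_mem_gap H.left κ (PerSet.not_mem_of_gap h1)
        rwa [hP.lo_eq_of_gap h1, hP.hi_eq_of_gap h1] at h2
    refine ⟨fun m => ?_, fun m => ?_⟩
    · rw [H.gapMap_iterate hwQ hwc, pow_succ', mul_apply, mul_apply]
      have h1 := H.map_gap (hmQ m) (H.contr_pow hwQ hwc m) (hstep m)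
      rw [hFdef, coord_bendLift H.left κ (PerSet.not_mem_of_gap h1)]
      congr 1
      change _ = coord A q s (B (coordInv A q s ((B ^ m) w) _))
      rw [← hFdef, coordInv_coord H.left (H.not_mem_left (hmQ m)) (hstep m)]
    · rw [add_comm, pow_add, mul_apply]
      have h1 : ((F * B) ^ m) v ∈ perSet (F * B) p r := (pow_mem_perSet_iff m v).mpr hvQ
      rw [pow_apply_add (s := r), ret_fix h1,
        coord_add_int H.left (PerSet.not_mem_of_gap (hstep m))]
  have hgw : Ioo (lo P w) (hi P w) = Ioo (lo P x) (hi P x) := by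
    rw [hP.lo_eq_of_gap hw, hP.hi_eq_of_gap hw]
  obtain ⟨o1, o2⟩ := orbit x hxQ (hgw ▸ hxg)
  obtain ⟨o1', o2'⟩ := orbit x' hxQ' (hgw ▸ hx'g)
  have := hκ _ (fun m => coord A q s (((F * B) ^ m) x)) (fun m => coord A q s (((F * B) ^ m) x'))
    o1 o2 o1' o2'
  simp only [pow_zero, one_apply] at this
  exact hxx'.ne ((coord_strictMonoOn H.left hxP).injOn hxg hx'g this)

/-- A gap of `P` contains at most one point of `Q`. -/
theorem eq_of_gap {y y' : ℝ} (hy : y ∈ Q) (hy' : y' ∈ Q) (hg : y' ∈ Ioo (lo P y) (hi P y)) :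
    y = y' := by
  rcases H.ends hy with hc | he
  · exact H.eq_of_contr hy hc hy' hg
  -- An expanding gap is contracting for the inverse of `B`.
  · refine H.inv_right.eq_of_contr (y := y) (by rwa [perSet_inv]) ?_ (by rwa [perSet_inv]) hg
    rw [Contr, ret_inv, inv_lt_self_iff, self_lt_inv_iff]
    exact he

end BendPair

end CircleAction
end

open scoped unitInterval
noncomputable section
namespace CircleAction
open Filter Topology Set Lft

/-! ## Interlaced periodic sets -/

/-- An increasing enumeration of a periodic set, with `N` points in each period. -/
structure Enumerates (e : ℤ → ℝ) (P : Set ℝ) (N : ℤ) : Prop where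
  strictMono : StrictMono e
  range_eq : range e = P
  add_period : ∀ i, e (i + N) = e i + 1
  pos : 0 < N

theorem eq_add_of_strictMono_int {φ : ℤ → ℤ} (hm : StrictMono φ) (hs : Function.Surjective φ) (i : ℤ) :
    φ i = φ 0 + i := by
  have h1 : ∀ i, φ (i + 1) = φ i + 1 := fun i => by
    obtain ⟨j, hj⟩ := hs (φ i + 1)
    have h2 : i < j := hm.lt_iff_lt.mp (by omega)
    have h3 : φ (i + 1) ≤ φ j := hm.monotone (by omega)
    have h4 := hm (show i < i + 1 by omega)
    omega
  induction i with
  | zero => simp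
  | succ i ih => rw [h1, ih]; ring
  | pred i ih =>
    have := h1 (-i - 1)
    rw [sub_add_cancel, ih] at this
    omega

/-- A lift preserving an enumerated set shifts the enumeration. -/
theorem exists_shift_of_preserves {e : ℤ → ℝ} {P : Set ℝ} (hm : StrictMono e) (hr : range e = P)
    {G : Lft} (hG : ∀ x, G x ∈ P ↔ x ∈ P) : ∃ c, ∀ i, G (e i) = e (i + c) := by
  have h1 : ∀ i, ∃ j, e j = G (e i) := fun i => by
    have : G (e i) ∈ range e := by rw [hr, hG, ← hr]; exact ⟨i, rfl⟩
    exact this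
  choose φ hφ using h1
  have hφm : StrictMono φ := fun i j h => by
    rw [← hm.lt_iff_lt, hφ, hφ, lt_iff]; exact hm h
  have hφs : Function.Surjective φ := fun j => by
    have h2 : G⁻¹ (e j) ∈ range e := by
      rw [hr, ← hG, apply_inv_self, ← hr]; exact ⟨j, rfl⟩
    obtain ⟨i, hi⟩ := h2
    refine ⟨i, hm.injective ?_⟩
    rw [hφ, hi, apply_inv_self]
  refine ⟨φ 0, fun i => ?_⟩
  rw [← hφ, eq_add_of_strictMono_int hφm hφs, add_comm]

/-- A locally finite set unbounded on both sides is order isomorphic to `ℤ`, and the unit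
translation becomes a shift. -/
theorem PerSet.exists_enumerates {P : Set ℝ} (hP : PerSet P)
    (hfin : ∀ a b, (P ∩ Icc a b).Finite) : ∃ e N, Enumerates e P N := by
  have : ∀ a b : P, (Icc a b).Finite := fun a b => by
    refine Set.Finite.of_finite_image ((hfin a b).subset ?_) Subtype.val_injective.injOn
    rintro _ ⟨x, hx, rfl⟩
    exact ⟨x.2, hx⟩
  let _ := LocallyFiniteOrder.ofFiniteIcc this
  let _ := LinearLocallyFiniteOrder.succOrder P
  let _ := LinearLocallyFiniteOrder.predOrder P
  have : Nonempty P := hP.nonempty.to_subtype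
  have : NoMaxOrder P := ⟨fun x => ⟨⟨x + 1, (hP.add_one _).mpr x.2⟩, by
    rw [← Subtype.coe_lt_coe]; simp⟩⟩
  have : NoMinOrder P := ⟨fun x => ⟨⟨x - 1, by rw [← hP.add_one, sub_add_cancel]; exact x.2⟩, by
    rw [← Subtype.coe_lt_coe]; simp⟩⟩
  let E : P ≃o ℤ := orderIsoIntOfLinearSuccPredArch
  have hm : StrictMono fun i => (E.symm i : ℝ) := fun i j h => E.symm.strictMono h
  have hr : range (fun i => (E.symm i : ℝ)) = P := by
    ext x
    constructor
    · rintro ⟨i, rfl⟩; exact (E.symm i).2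
    · intro hx; exact ⟨E ⟨x, hx⟩, by simp⟩
  obtain ⟨N, hN⟩ := exists_shift_of_preserves hm hr (G := tr 1) fun x => by simpa using hP.add_one x
  have hN' : ∀ i, (E.symm (i + N) : ℝ) = E.symm i + 1 := fun i => by
    rw [← hN]; simp
  refine ⟨fun i => E.symm i, N, hm, hr, hN', ?_⟩
  have := hm.lt_iff_lt (a := 0) (b := 0 + N)
  simp only [hN'] at this
  simpa using this.mp (by linarith)

namespace Enumerates

variable {e : ℤ → ℝ} {P : Set ℝ} {N : ℤ} (he : Enumerates e P N)
include he

theorem mem (i : ℤ) : e i ∈ P := he.range_eq ▸ mem_range_self i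

theorem lo_eq (hP : PerSet P) {i : ℤ} {x : ℝ} (h1 : e i ≤ x) (h2 : x < e (i + 1)) : lo P x = e i := by
  refine hP.lo_eq (he.mem i) h1 fun y hy hyx => ?_
  rw [← he.range_eq] at hy
  obtain ⟨j, rfl⟩ := hy
  have : j < i + 1 := he.strictMono.lt_iff_lt.mp (hyx.trans_lt h2)
  exact he.strictMono.monotone (by omega)

theorem hi_eq (hP : PerSet P) {i : ℤ} {x : ℝ} (h1 : e i < x) (h2 : x ≤ e (i + 1)) :
    hi P x = e (i + 1) := by
  refine hP.hi_eq (he.mem _) h2 fun y hy hyx => ?_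
  rw [← he.range_eq] at hy
  obtain ⟨j, rfl⟩ := hy
  have : i < j := he.strictMono.lt_iff_lt.mp (h1.trans_le hyx)
  exact he.strictMono.monotone (by omega)

theorem exists_index (hP : PerSet P) (x : ℝ) : ∃ i, e i = lo P x ∧ e i ≤ x ∧ x < e (i + 1) := by
  obtain ⟨i, hi⟩ : lo P x ∈ range e := by rw [he.range_eq]; exact hP.lo_mem x
  refine ⟨i, hi, hi ▸ hP.lo_le x, ?_⟩
  by_contra hcon
  have := PerSet.le_lo (he.mem (i + 1)) (not_lt.mp hcon)
  rw [← hi] at this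
  have h2 := he.strictMono (show i < i + 1 by omega)
  linarith

theorem shift : Enumerates (fun i => e (i + 1)) P N where
  strictMono := fun i j h => he.strictMono (by omega)
  range_eq := by
    rw [← he.range_eq]
    exact (Equiv.addRight (1 : ℤ)).surjective.range_comp e
  add_period i := by rw [show i + N + 1 = i + 1 + N by ring, he.add_period]
  pos := he.pos

theorem not_mem {i : ℤ} {x : ℝ} (h1 : e i < x) (h2 : x < e (i + 1)) : x ∉ P := by
  rw [← he.range_eq]
  rintro ⟨j, rfl⟩
  have := he.strictMono.lt_iff_lt.mp h1
  have := he.strictMono.lt_iff_lt.mp h2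
  omega

end Enumerates

/-- If each gap of `P` contains at most one point of `Q` and conversely, then between two points
of `P` there is a point of `Q`. -/
theorem exists_between_of_gap {P Q : Set ℝ} (hQ : PerSet Q) (hd : ∀ x ∈ P, x ∉ Q)
    (hg : ∀ x ∈ P, ∀ y ∈ P, y ∈ Ioo (lo Q x) (hi Q x) → x = y) {x y : ℝ} (hx : x ∈ P)
    (hy : y ∈ P) (hxy : x < y) : ∃ z ∈ Q, x < z ∧ z < y := by
  refine ⟨hi Q x, hQ.hi_mem x, hQ.lt_hi (hd x hx), ?_⟩
  by_contra hcon
  rcases (not_lt.mp hcon).lt_or_eq with h | h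
  · exact hxy.ne (hg x hx y hy ⟨(hQ.lo_le x).trans_lt hxy, h⟩)
  · exact hd y hy (h ▸ hQ.hi_mem x)

/-- The gaps of `Q` form an open cover of the compact piece of `P`, with at most one point of `P` in
each. -/
theorem finite_of_gap {P Q : Set ℝ} (hP : PerSet P) (hQ : PerSet Q) (hd : ∀ x ∈ P, x ∉ Q)
    (hg : ∀ x ∈ P, ∀ y ∈ P, y ∈ Ioo (lo Q x) (hi Q x) → x = y) (a b : ℝ) :
    (P ∩ Icc a b).Finite := by
  have hK : IsCompact (P ∩ Icc a b) := isCompact_Icc.inter_left hP.closed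
  obtain ⟨t, htP, ht⟩ := hK.elim_nhds_subcover (fun y => Ioo (lo Q y) (hi Q y)) fun y hy =>
    isOpen_Ioo.mem_nhds (hQ.self_mem_gap (hd y hy.1))
  refine t.finite_toSet.subset fun y hy => ?_
  obtain ⟨w, hw, hyw⟩ := mem_iUnion₂.mp (ht hy)
  rw [← hg w (htP w hw).1 y hy.1 hyw]
  exact hw

/-- The enumeration of the interlaced set. -/
theorem Enumerates.interlace {P Q : Set ℝ} {e : ℤ → ℝ} {N : ℤ} (he : Enumerates e P N)
    (hP : PerSet P) (hQ : PerSet Q) (hd : ∀ x ∈ P, x ∉ Q)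
    (hgP : ∀ x ∈ P, ∀ y ∈ P, y ∈ Ioo (lo Q x) (hi Q x) → x = y)
    (hgQ : ∀ x ∈ Q, ∀ y ∈ Q, y ∈ Ioo (lo P x) (hi P x) → x = y) :
    ∃ e', Enumerates e' Q N ∧ ∀ i, e i < e' i ∧ e' i < e (i + 1) := by
  choose e' he'Q h1 h2 using fun i => exists_between_of_gap hQ hd hgP (he.mem i) (he.mem (i + 1))
    (he.strictMono (show i < i + 1 by omega))
  have huniq : ∀ i, ∀ y ∈ Q, e i < y → y < e (i + 1) → y = e' i := fun i y hy hy1 hy2 => by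
    refine hgQ y hy (e' i) (he'Q i) ?_
    rw [he.lo_eq hP hy1.le hy2, he.hi_eq hP hy1 hy2.le]
    exact ⟨h1 i, h2 i⟩
  refine ⟨e', ⟨?_, ?_, fun i => ?_, he.pos⟩, fun i => ⟨h1 i, h2 i⟩⟩
  · exact strictMono_int_of_lt_succ fun i => (h2 i).trans (h1 (i + 1))
  · ext y
    constructor
    · rintro ⟨i, rfl⟩; exact he'Q i
    · intro hy
      obtain ⟨i, -, hi1, hi2⟩ := he.exists_index hP y
      refine ⟨i, (huniq i y hy (hi1.lt_of_ne fun e1 => hd _ (he.mem i) (e1 ▸ hy)) hi2).symm⟩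
  · refine (huniq (i + N) _ ((hQ.add_one _).mpr (he'Q i)) ?_ ?_).symm
    · rw [he.add_period]; linarith [h1 i]
    · rw [show i + N + 1 = i + 1 + N by ring, he.add_period]; linarith [h2 i]

/-! ### Periodic points and cyclic order on the circle -/

theorem sbtw_coe {x y z : ℝ} (hxz : x < z) (hzy : z < y) (hyx : y < x + 1) :
    sbtw (x : S1) (z : S1) (y : S1) := by
  rw [sbtw_iff_not_btw, QuotientAddGroup.btw_coe_iff]
  have h1 : toIcoMod (one_pos : (0 : ℝ) < 1) y z = z + 1 := by
    rw [toIcoMod_eq_iff]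
    exact ⟨⟨by linarith, by linarith⟩, -1, by simp⟩
  have h2 : toIocMod (one_pos : (0 : ℝ) < 1) y x = x + 1 := by
    rw [toIocMod_eq_iff]
    exact ⟨⟨by linarith, by linarith⟩, -1, by simp⟩
  rw [h1, h2]
  linarith

theorem mem_Per_iff {F : Lft} {x : ℝ} :
    (x : S1) ∈ Per (proj F) ↔ ∃ n, 0 < n ∧ ∃ k : ℤ, (F ^ n) x = x + k := by
  have hit : ∀ n : ℕ, ((proj F : S1 ≃ₜ S1) : S1 → S1)^[n] (x : S1) = (((F ^ n) x : ℝ) : S1) := by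
    intro n
    induction n with
    | zero => rfl
    | succ n ih => rw [Function.iterate_succ_apply', ih, proj_coe, pow_succ', mul_apply]
  constructor
  · rintro ⟨n, hn, h⟩
    refine ⟨n, hn, coe_eq_coe_iff.mp ?_⟩
    rw [← hit]; exact h.symm
  · rintro ⟨n, hn, k, h⟩
    refine ⟨n, hn, ?_⟩
    change _ = _
    rw [hit, h]
    exact (coe_eq_coe_iff.mpr ⟨k, rfl⟩).symm

/-- All periodic points give the same translation number, so a power of the return map fixes each of
them. Off the periodic set this is impossible, as the return map shifts the gap coordinate by a
nonzero amount of constant sign. -/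
theorem mem_Per_iff_mem_perSet {F : Lft} {q : ℕ} {s : ℤ} (hF : RatLift F q s) {x : ℝ} :
    (x : S1) ∈ Per (proj F) ↔ x ∈ perSet F q s := by
  rw [mem_Per_iff]
  constructor
  · rintro ⟨n, hn, k, h⟩
    obtain ⟨y, hy⟩ := hF.exists_fix
    have hq0 : (0 : ℝ) < q := by exact_mod_cast hF.pos
    have hn0 : (0 : ℝ) < n := by exact_mod_cast hn
    have t1 : tau F = k / n :=
      ((toDeg1 F).translationNumber_eq_rat_iff F.continuous_toDeg1 hn).mpr
        ⟨x, by rw [toDeg1_pow_apply, h]⟩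
    have t2 : tau F = s / q :=
      ((toDeg1 F).translationNumber_eq_rat_iff F.continuous_toDeg1 hF.pos).mpr
        ⟨y, by rw [toDeg1_pow_apply, hy]⟩
    have hkq : (k : ℝ) * q = s * n := by
      rw [t1, div_eq_div_iff hn0.ne' hq0.ne'] at t2; exact t2
    have hkq' : k * q = s * n := by exact_mod_cast hkq
    by_contra hx
    have h3 : ((ret F q s) ^ n) x = x := by
      have e1 : (ret F q s) ^ n = tr (-(s * n)) * F ^ (q * n) := by
        have e2 : ∀ m : ℕ, (tr (-s)) ^ m = tr (-(s * m)) := fun m => by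
          induction m with
          | zero => ext; simp
          | succ m ih =>
            rw [pow_succ, ih]; ext; simp; ring
        rw [ret, (commute_tr' (F ^ q) (-s)).mul_pow, e2, ← pow_mul]
      have e3 : ∀ m : ℕ, (F ^ (n * m)) x = x + (k * m : ℤ) := fun m => by
        induction m with
        | zero => simp
        | succ m ih =>
          rw [Nat.mul_succ, add_comm, pow_add, mul_apply, ih, map_add_int, h]; push_cast; ring
      rw [e1, mul_apply, tr_apply, mul_comm q n, e3, hkq']
      push_cast; ring
    have h4 := coord_ret_zpow hF hx n
    rw [zpow_natCast, h3] at h4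
    have h5 : ((n : ℤ) : ℝ) * (q * sg (ret F q s) x) = 0 := by linarith
    rcases sg_eq_one_or x hx with h6 | h6 <;> rw [h6] at h5 <;> push_cast at h5 <;> nlinarith
  · intro hx
    exact ⟨q, hF.pos, s, by rw [pow_apply_add (s := s), ret_fix hx]⟩

theorem separatedBy_of_between {F G : Lft} {q p : ℕ} {s r : ℤ} (hF : RatLift F q s)
    (hG : RatLift G p r)
    (h : ∀ x ∈ perSet F q s, ∀ y ∈ perSet F q s, x < y → ∃ z ∈ perSet G p r, x < z ∧ z < y) :
    SeparatedBy (Per (proj F)) (Per (proj G)) := by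
  intro x hx y hy hxy
  induction x using QuotientAddGroup.induction_on with
  | H x =>
  induction y using QuotientAddGroup.induction_on with
  | H y =>
  have hx' := (mem_Per_iff_mem_perSet hF).mp hx
  have hy' := (mem_Per_iff_mem_perSet hF).mp hy
  have h0 := Int.floor_le (y - x)
  have h1 := Int.lt_floor_add_one (y - x)
  -- The representative of `y` in `[x, x + 1)`, as needed for the cyclic order.
  set w := y + (-⌊y - x⌋ : ℤ) with hw
  have hwy : (w : S1) = (y : S1) := (coe_eq_coe_iff.mpr ⟨_, hw⟩).symm
  have hw1 : x ≤ w := by rw [hw]; push_cast; linarith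
  have hw2 : w < x + 1 := by rw [hw]; push_cast; linarith
  have hw3 : x < w := hw1.lt_of_ne fun e => hxy (by
    change (x : S1) = (y : S1); rw [← hwy, e])
  obtain ⟨z, hz, hz1, hz2⟩ := h x hx' w ((hF.perSet.add_int _ _).mpr hy') hw3
  refine ⟨(z : S1), (mem_Per_iff_mem_perSet hG).mpr hz, ?_⟩
  change sbtw (x : S1) (z : S1) (y : S1)
  rw [← hwy]
  exact sbtw_coe hz1 hz2 hw2

end CircleAction
end

open scoped unitInterval
noncomputable section
namespace CircleAction
open Filter Topology Set Lft

/-! ## Conjugation to a hyperbolic element -/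

/-- The hyperbolic matrix with eigenvalues `exp (-1/2)` and `exp (1/2)`. -/
def hypMatrix : SL(2, ℝ) :=
  ⟨!![Real.exp (-1 / 2), 0; 0, Real.exp (1 / 2)], by
    rw [Matrix.det_fin_two_of, mul_zero, sub_zero, ← Real.exp_add]; norm_num⟩

theorem hypMatrix_isHyperbolic : (hypMatrix : Matrix (Fin 2) (Fin 2) ℝ).IsHyperbolic := by
  rw [Matrix.IsHyperbolic, Matrix.discr_fin_two]
  simp only [hypMatrix, Matrix.trace_fin_two_of, Matrix.det_fin_two_of]
  have h1 : Real.exp (-1 / 2) * Real.exp (1 / 2) = 1 := by rw [← Real.exp_add]; norm_num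
  have h2 : Real.exp (-1 / 2) < Real.exp (1 / 2) := Real.exp_lt_exp.mpr (by norm_num)
  nlinarith [mul_pos (sub_pos.mpr h2) (sub_pos.mpr h2)]

/-- The matrix multiplies slopes by `Real.exp 1`; the hypothesis is this relation between the slopes
with denominators cleared, so it also covers vertical lines. The factor `c` is the inner product of
the image with the target direction. -/
theorem hypMatrix_mulVec_lineDir {t t' : ℝ}
    (h : Real.cos (Real.pi * t) * Real.sin (Real.pi * t') =
      Real.exp 1 * (Real.sin (Real.pi * t) * Real.cos (Real.pi * t'))) :
    ∃ c : ℝ, (hypMatrix : Matrix (Fin 2) (Fin 2) ℝ) *ᵥ lineDir t = c • lineDir t' := by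
  set C := Real.cos (Real.pi * t)
  set S := Real.sin (Real.pi * t)
  set C' := Real.cos (Real.pi * t')
  set S' := Real.sin (Real.pi * t')
  have h1 : S' ^ 2 + C' ^ 2 = 1 := Real.sin_sq_add_cos_sq _
  set a := Real.exp (-1 / 2) with ha
  set b := Real.exp (1 / 2) with hb
  have hab : a * Real.exp 1 = b := by rw [ha, hb, ← Real.exp_add]; norm_num
  have h2 : a * (C * S') = b * (S * C') := by rw [h, ← mul_assoc, hab]
  refine ⟨a * C * C' + b * S * S', ?_⟩
  ext i
  fin_cases i
  · simp only [hypMatrix, lineDir, Matrix.mulVec, Matrix.of_apply, dotProduct, Fin.sum_univ_two,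
      Matrix.cons_val_zero, Matrix.cons_val_one, Matrix.cons_val_fin_one, Fin.zero_eta,
      Pi.smul_apply, smul_eq_mul, zero_mul, add_zero]
    change a * C = (a * C * C' + b * S * S') * C'
    linear_combination (-(a * C)) * h1 + S' * h2
  · simp only [hypMatrix, lineDir, Matrix.mulVec, Matrix.of_apply, dotProduct, Fin.sum_univ_two,
      Matrix.cons_val_zero, Matrix.cons_val_one, Matrix.cons_val_fin_one, Fin.mk_one,
      Pi.smul_apply, smul_eq_mul, zero_mul, zero_add]
    change b * S = (a * C * C' + b * S * S') * S'
    linear_combination (-(b * S)) * h1 - C' * h2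

/-- The angle in `(0, π / 2)` with tangent `exp u`, in units of `π / 2`. -/
def quarter (u : ℝ) : ℝ := 2 / Real.pi * Real.arctan (Real.exp u)

theorem quarter_strictMono : StrictMono quarter := fun u v h =>
  mul_lt_mul_of_pos_left (Real.arctan_strictMono (Real.exp_lt_exp.mpr h)) (by positivity)

theorem pi_mul_half_quarter (u : ℝ) : Real.pi * (quarter u / 2) = Real.arctan (Real.exp u) := by
  have := Real.pi_pos.ne'
  rw [quarter]; field_simp

theorem quarter_pos (u : ℝ) : 0 < quarter u :=
  mul_pos (by positivity) (Real.arctan_pos.mpr (Real.exp_pos u))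

theorem quarter_lt_one (u : ℝ) : quarter u < 1 := by
  have h1 := Real.arctan_lt_pi_div_two (Real.exp u)
  rw [← pi_mul_half_quarter] at h1
  have := Real.pi_pos
  nlinarith

theorem exists_quarter_eq {w : ℝ} (h0 : 0 < w) (h1 : w < 1) : ∃ u, quarter u = w := by
  have hpi := Real.pi_pos
  have hx0 : 0 < Real.pi * (w / 2) := by positivity
  have hx1 : Real.pi * (w / 2) < Real.pi / 2 := by nlinarith
  refine ⟨Real.log (Real.tan (Real.pi * (w / 2))), ?_⟩
  rw [quarter, Real.exp_log (Real.tan_pos_of_pos_of_lt_pi_div_two hx0 hx1),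
    Real.arctan_tan (by linarith) hx1]
  field_simp

theorem sin_quarter (u : ℝ) : Real.sin (Real.pi * (quarter u / 2)) =
    Real.exp u * Real.cos (Real.pi * (quarter u / 2)) := by
  rw [pi_mul_half_quarter, ← Real.tan_mul_cos (Real.cos_arctan_pos _).ne', Real.tan_arctan]

/-- The position of a point in a quarter turn, in terms of the coordinate. -/
inductive QuarterStep : ℝ → ℝ → ℤ → Prop
  | fix (ε : ℤ) : QuarterStep 0 0 ε
  | move (u : ℝ) (ε : ℤ) : QuarterStep (quarter u) (quarter (u + ε)) ε

/-- On an even quarter turn the tangent is `exp u`, and the step `u ↦ u + 1` multiplies it by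
`Real.exp 1`. On an odd one it is `-exp (-u)`, and the step `u ↦ u - 1` does the same. The half
turns counted by `i` do not change lines. -/
theorem quarterStep_identity {w w' : ℝ} {j j' : ℤ} {i : ℤ} (hj : j' = j + 2 * i)
    (h : QuarterStep w w' (if Even j then 1 else -1)) :
    Real.cos (Real.pi * ((j + w) / 2)) * Real.sin (Real.pi * ((j' + w') / 2)) =
      Real.exp 1 * (Real.sin (Real.pi * ((j + w) / 2)) * Real.cos (Real.pi * ((j' + w') / 2))) := by
  have hshift : ∀ (a : ℝ) (m : ℤ), Real.sin (Real.pi * (a + m)) = (-1) ^ m * Real.sin (Real.pi * a) ∧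
      Real.cos (Real.pi * (a + m)) = (-1) ^ m * Real.cos (Real.pi * a) := fun a m => by
    rw [show Real.pi * (a + m) = Real.pi * a + m * Real.pi by ring, Real.sin_add_int_mul_pi,
      Real.cos_add_int_mul_pi]
    exact ⟨rfl, rfl⟩
  have key : Real.cos (Real.pi * ((j + w) / 2)) * Real.sin (Real.pi * ((j + w') / 2)) =
      Real.exp 1 * (Real.sin (Real.pi * ((j + w) / 2)) * Real.cos (Real.pi * ((j + w') / 2))) := by
    rcases Int.even_or_odd' j with ⟨m, rfl | rfl⟩
    · rw [if_pos (even_two_mul m)] at h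
      have e : ∀ v : ℝ, (((2 * m : ℤ) : ℝ) + v) / 2 = v / 2 + m := fun v => by push_cast; ring
      rw [e, e, (hshift _ m).1, (hshift _ m).2, (hshift _ m).1, (hshift _ m).2]
      have hlocal : Real.cos (Real.pi * (w / 2)) * Real.sin (Real.pi * (w' / 2)) =
          Real.exp 1 * (Real.sin (Real.pi * (w / 2)) * Real.cos (Real.pi * (w' / 2))) := by
        cases h with
        | fix => simp
        | move u =>
          rw [sin_quarter, sin_quarter, Int.cast_one, Real.exp_add]; ring
      linear_combination ((-1) ^ m * (-1) ^ m) * hlocal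
    · rw [if_neg (by simp)] at h
      have e : ∀ v : ℝ, (((2 * m + 1 : ℤ) : ℝ) + v) / 2 = (v / 2 + 1 / 2) + m := fun v => by
        push_cast; ring
      have e2 : ∀ v : ℝ, Real.pi * (v + 1 / 2) = Real.pi * v + Real.pi / 2 := fun v => by ring
      rw [e, e, (hshift _ m).1, (hshift _ m).2, (hshift _ m).1, (hshift _ m).2, e2, e2,
        Real.sin_add_pi_div_two, Real.sin_add_pi_div_two, Real.cos_add_pi_div_two,
        Real.cos_add_pi_div_two]
      have hlocal : Real.sin (Real.pi * (w / 2)) * Real.cos (Real.pi * (w' / 2)) =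
          Real.exp 1 * (Real.cos (Real.pi * (w / 2)) * Real.sin (Real.pi * (w' / 2))) := by
        cases h with
        | fix => simp
        | move u =>
          have h1 : Real.exp u = Real.exp 1 * Real.exp (u + ((-1 : ℤ) : ℝ)) := by
            rw [← Real.exp_add]; push_cast; ring_nf
          rw [sin_quarter, sin_quarter]
          linear_combination (Real.cos (Real.pi * (quarter u / 2)) *
            Real.cos (Real.pi * (quarter (u + ((-1 : ℤ) : ℝ)) / 2))) * h1
      linear_combination (-(-1) ^ m * (-1) ^ m) * hlocal
  have e : ((j' : ℝ) + w') / 2 = (j + w') / 2 + i := by rw [hj]; push_cast; ring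
  rw [e, (hshift _ i).1, (hshift _ i).2]
  linear_combination ((-1) ^ i) * key

section

variable {A : Lft} {q : ℕ} {s : ℤ} {e : ℤ → ℝ} {N : ℤ}

local notation "P" => perSet A q s

/-- The position of a point inside its gap, between `0` and `1`. -/
def gapPos (A : Lft) (q : ℕ) (s : ℤ) (x : ℝ) : ℝ :=
  open Classical in if x ∈ perSet A q s then 0 else quarter (coord A q s x)

theorem gapPos_of_mem {x : ℝ} (hx : x ∈ P) : gapPos A q s x = 0 := if_pos hx
theorem gapPos_of_not_mem {x : ℝ} (hx : x ∉ P) : gapPos A q s x = quarter (coord A q s x) := if_neg hx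

theorem gapPos_nonneg (x : ℝ) : 0 ≤ gapPos A q s x := by
  by_cases hx : x ∈ P
  · rw [gapPos_of_mem hx]
  · rw [gapPos_of_not_mem hx]; exact (quarter_pos _).le

theorem gapPos_lt_one (x : ℝ) : gapPos A q s x < 1 := by
  by_cases hx : x ∈ P
  · rw [gapPos_of_mem hx]; norm_num
  · rw [gapPos_of_not_mem hx]; exact quarter_lt_one _

/-- The lift that sends the `i`-th point of the periodic set to `i / N` and is adapted to the
coordinate in the gaps. -/
theorem exists_straighten (hA : RatLift A q s) (he : Enumerates e P N) :
    ∃ g : Lft, ∀ i x, e i ≤ x → x < e (i + 1) → g x = (i + gapPos A q s x) / N := by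
  have hP := hA.perSet
  have hN : (0 : ℝ) < N := by exact_mod_cast he.pos
  choose idx hi0 hi1 hi2 using he.exists_index hP
  have huniq : ∀ i x, e i ≤ x → x < e (i + 1) → idx x = i := fun i x h1 h2 => by
    have h3 := he.strictMono.lt_iff_lt.mp ((hi1 x).trans_lt h2)
    have h4 := he.strictMono.lt_iff_lt.mp (h1.trans_lt (hi2 x))
    omega
  let f : ℝ → ℝ := fun x => (idx x + gapPos A q s x) / N
  have hfm : StrictMono f := by
    intro x y hxy
    refine div_lt_div_of_pos_right ?_ hN
    have h1 : idx x ≤ idx y := by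
      have := he.strictMono.lt_iff_lt.mp ((hi1 x).trans_lt (hxy.trans (hi2 y)))
      omega
    rcases h1.lt_or_eq with h2 | h2
    · have h3 : (idx x : ℝ) + 1 ≤ idx y := by exact_mod_cast h2
      linarith [gapPos_lt_one (A := A) (q := q) (s := s) x,
        gapPos_nonneg (A := A) (q := q) (s := s) y]
    · have hy : y ∉ P := he.not_mem (h2 ▸ (hi1 x).trans_lt hxy) (hi2 y)
      rw [h2]
      by_cases hx : x ∈ P
      · rw [gapPos_of_mem hx, gapPos_of_not_mem hy]
        linarith [quarter_pos (coord A q s y)]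
      · rw [gapPos_of_not_mem hx, gapPos_of_not_mem hy]
        have hyx := hP.mem_gap_of_lo_eq hx hy (by rw [← hi0, ← hi0, h2])
        have := quarter_strictMono (coord_strictMonoOn hA hx (hP.self_mem_gap hx) hyx hxy)
        linarith
  have hfs : Function.Surjective f := by
    intro t
    set i := ⌊t * N⌋ with hi
    have h1 := Int.floor_le (t * N)
    have h2 := Int.lt_floor_add_one (t * N)
    suffices ∃ x, e i ≤ x ∧ x < e (i + 1) ∧ gapPos A q s x = t * N - i by
      obtain ⟨x, hx1, hx2, hx3⟩ := this
      refine ⟨x, ?_⟩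
      simp only [f, huniq i x hx1 hx2, hx3]
      field_simp
      ring
    have hlt := he.strictMono (show i < i + 1 by omega)
    rcases h1.eq_or_lt with h3 | h3
    · refine ⟨e i, le_rfl, hlt, ?_⟩
      rw [gapPos_of_mem (he.mem i)]; linarith
    · obtain ⟨u, hu⟩ := exists_quarter_eq (sub_pos.mpr h3) (by linarith)
      obtain ⟨c, hc1, hc2⟩ := exists_between hlt
      have hc := he.not_mem hc1 hc2
      have hm := coordInv_mem hA hc u
      have hcc := coord_coordInv hA hc u
      have hmP : coordInv A q s c u ∉ P := PerSet.not_mem_of_gap hm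
      rw [he.lo_eq hP hc1.le hc2, he.hi_eq hP hc1 hc2.le] at hm
      exact ⟨_, hm.1.le, hm.2, by rw [gapPos_of_not_mem hmP, hcc, hu]⟩
  refine ⟨ofSurj f hfm hfs fun x => ?_, fun i x h1 h2 => ?_⟩
  · have h1 : idx (x + 1) = idx x + N := huniq _ _ (by rw [he.add_period]; linarith [hi1 x]) (by
      rw [show idx x + N + 1 = idx x + 1 + N by ring, he.add_period]; linarith [hi2 x])
    have h2 : gapPos A q s (x + 1) = gapPos A q s x := by
      by_cases hx : x ∈ P
      · rw [gapPos_of_mem hx, gapPos_of_mem ((hP.add_one x).mpr hx)]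
      · rw [gapPos_of_not_mem hx, gapPos_of_not_mem (by rwa [hP.add_one])]
        have := coord_add_int hA hx 1
        rw [Int.cast_one] at this
        rw [this]
    simp only [f, h1, h2]
    push_cast
    field_simp
    ring
  · change f x = _
    simp only [f, huniq i x h1 h2]

/-- If the return map moves the successive gaps alternately forwards and backwards, then the
homeomorphism is conjugate to a hyperbolic element. -/
theorem exists_conj_hyperbolic (hA : RatLift A q s) {k : ℕ} (he : Enumerates e P (2 * k))
    (hsg : ∀ i x, e i < x → x < e (i + 1) → sg (ret A q s) x = if Even i then 1 else -1) :
    ∃ f : PSLk k, IsHyperbolicPSLk k f ∧ IsConj (f : HomeoPlus) (proj A) := by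
  have hP := hA.perSet
  have hk : (0 : ℝ) < k := by
    have := he.pos
    have : 0 < k := by omega
    exact_mod_cast this
  obtain ⟨g, hg⟩ := exists_straighten hA he
  obtain ⟨c, hc⟩ := exists_shift_of_preserves he.strictMono he.range_eq
    (fun x => self_mem_perSet_iff (A := A) (q := q) (s := s) x)
  -- `A` commutes with its return map and so preserves the sign of the displacement; an odd shift of
  -- the gaps would reverse it.
  have hceven : Even c := by
    obtain ⟨x, hx1, hx2⟩ := exists_between (he.strictMono (show (0 : ℤ) < 0 + 1 by omega))
    have h1 := hsg 0 x hx1 hx2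
    have h2 := hsg (0 + c) (A x) (by rw [← hc]; exact A.lt_iff.mpr hx1) (by
      rw [show 0 + c + 1 = 0 + 1 + c by ring, ← hc]; exact A.lt_iff.mpr hx2)
    rw [sg_map (commute_ret A q s), h1, if_pos (by simp)] at h2
    by_contra hodd
    rw [zero_add, if_neg hodd] at h2
    norm_num at h2
  have hlift : Lifts k (proj (g * A * g⁻¹)) hypMatrix := by
    intro u t h
    obtain ⟨x, rfl⟩ := g.surjective u
    rw [proj_coe, mul_apply, mul_apply, inv_apply_self] at h
    obtain ⟨n, rfl⟩ := coe_eq_coe_iff.mp h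
    obtain ⟨i, -, hi1, hi2⟩ := he.exists_index hP x
    obtain ⟨d, hd⟩ := hceven
    have hgx := hg i x hi1 hi2
    have hgA := hg (i + c) (A x) (by rw [← hc]; exact A.le_iff.mpr hi1) (by
      rw [show i + c + 1 = i + 1 + c by ring, ← hc]; exact A.lt_iff.mpr hi2)
    refine hypMatrix_mulVec_lineDir ?_
    -- With `N = 2 * k`, each gap becomes a quarter turn in the projective angle.
    have e1 : k * g x = (i + gapPos A q s x) / 2 := by
      rw [hgx]; push_cast; field_simp
    have e2 : k * (g (A x) + n) = ((i + 2 * (d + k * n) : ℤ) + gapPos A q s (A x)) / 2 := by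
      rw [hgA, hd]; push_cast; field_simp; ring
    rw [e1, e2]
    refine quarterStep_identity rfl ?_
    by_cases hx : x ∈ P
    · rw [gapPos_of_mem hx, gapPos_of_mem ((self_mem_perSet_iff x).mpr hx)]
      exact QuarterStep.fix _
    · rw [gapPos_of_not_mem hx, gapPos_of_not_mem (by rwa [self_mem_perSet_iff]), coord_map hA hx,
        hsg i x (hi1.lt_of_ne fun h => hx (h ▸ he.mem i)) hi2]
      exact QuarterStep.move _ _
  refine ⟨⟨proj (g * A * g⁻¹), hypMatrix, hlift⟩, ⟨hypMatrix, hlift, hypMatrix_isHyperbolic⟩, ?_⟩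
  rw [isConj_iff]
  refine ⟨(proj g)⁻¹, ?_⟩
  simp only [map_mul, map_inv]
  group

end

end CircleAction
end

open scoped unitInterval
noncomputable section
namespace CircleAction
open Filter Topology Set Lft

/-! ## Alternating periodic points -/

theorem eq_ite_even_of_alternating {w : ℤ → ℤ} (h : ∀ i, w (i + 1) = -w i) (h0 : w 0 = 1) (i : ℤ) :
    w i = if Even i then 1 else -1 := by
  induction i with
  | zero => simp [h0]
  | succ i ih =>
    have h3 : Even ((i : ℤ) + 1) ↔ ¬ Even (i : ℤ) := Int.even_add_one
    rw [h, ih]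
    by_cases h2 : Even (i : ℤ)
    · rw [if_pos h2, if_neg (by rw [h3]; exact not_not.mpr h2)]
    · rw [if_neg h2, if_pos (h3.mpr h2), neg_neg]
  | pred i ih =>
    have h1 := h (-i - 1)
    rw [sub_add_cancel, ih] at h1
    have h3 : Even (-(i : ℤ) - 1) ↔ ¬ Even (-(i : ℤ)) := Int.even_sub_one
    by_cases h2 : Even (-(i : ℤ))
    · rw [if_pos h2] at h1; rw [if_neg (by rw [h3]; exact not_not.mpr h2)]; omega
    · rw [if_neg h2] at h1; rw [if_pos (h3.mpr h2)]; omega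

/-- If the return map of `A` moves successive points of an interlaced set in opposite directions,
then `A` is conjugate to a hyperbolic element. -/
theorem exists_conj_hyperbolic_of_alternating {A : Lft} {q : ℕ} {s : ℤ} (hA : RatLift A q s)
    {e e' : ℤ → ℝ} {N : ℤ} (he : Enumerates e (perSet A q s) N)
    (he'N : ∀ i, e' (i + N) = e' i + 1) (hl : ∀ i, e i < e' i) (hr : ∀ i, e' i < e (i + 1))
    (halt : ∀ i, sg (ret A q s) (e' (i + 1)) = -sg (ret A q s) (e' i)) :
    Even N ∧ ∀ k : ℕ, N = 2 * k →
      ∃ f : PSLk k, IsHyperbolicPSLk k f ∧ IsConj (f : HomeoPlus) (proj A) := by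
  -- Shifting both enumerations by one exchanges the signs.
  wlog h0 : sg (ret A q s) (e' 0) = 1 generalizing e e'
  · refine this he.shift (e' := fun i => e' (i + 1))
      (fun i => by rw [show i + N + 1 = i + 1 + N by ring, he'N]) (fun i => hl _) (fun i => hr _)
      (fun i => halt _) ?_
    have h1 := halt 0
    rcases sg_eq_one_or (e' 0) (he.not_mem (hl 0) (hr 0)) with h2 | h2
    · exact absurd h2 h0
    · rw [h1, h2]; rfl
  have hsg := eq_ite_even_of_alternating (w := fun i => sg (ret A q s) (e' i)) halt h0
  refine ⟨?_, ?_⟩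
  -- The unit translation shifts the index by `N` and preserves the sign, so the alternation forces
  -- `N` to be even.
  · have h1 := sg_map ((ret A q s).commute_tr' 1) (e' 0)
    rw [tr_apply, Int.cast_one, ← he'N, zero_add, hsg N, h0] at h1
    by_contra hcon
    rw [if_neg hcon] at h1
    norm_num at h1
  · rintro k rfl
    refine exists_conj_hyperbolic hA he fun i x h1 h2 => ?_
    rw [← hsg i]
    refine sg_eq_of_gap hA (he.not_mem (hl i) (hr i)) ?_
    rw [he.lo_eq hA.perSet (hl i).le (hr i), he.hi_eq hA.perSet (hl i) (hr i).le]
    exact ⟨h1, h2⟩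

/-- The return map of `A` moves successive periodic points of `B` in opposite directions. -/
theorem BendPair.sg_alternate {A B : Lft} {q : ℕ} {s : ℤ} {p : ℕ} {r : ℤ}
    (H : BendPair B A p r q s) {e e' : ℤ → ℝ} {N : ℤ} (he : Enumerates e (perSet A q s) N)
    (he' : Enumerates e' (perSet B p r) N) (hl : ∀ i, e i < e' i) (hr : ∀ i, e' i < e (i + 1))
    (i : ℤ) : sg (ret A q s) (e' (i + 1)) = -sg (ret A q s) (e' i) := by
  have h := H.ends (he.mem (i + 1))
  rw [he'.lo_eq H.left.perSet (hr i).le (hl (i + 1)), he'.hi_eq H.left.perSet (hr i) (hl (i + 1)).le]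
    at h
  rcases h with ⟨h1, h2⟩ | ⟨h1, h2⟩
  · rw [sg_of_lt h1, sg_of_gt h2]
  · rw [sg_of_gt h1, sg_of_lt h2]; rfl

/-- Both pairs `(A, B)` and `(B, A)` bend. Uniqueness in gaps in both directions interlaces the
periodic sets, so the same `N`, hence the same `k`, serves for `a` and `b`. -/
theorem exists_propertyS {g : ℕ} {ρ : SurfaceGroup g →* HomeoPlus} (hrigid : PathRigid ρ)
    (hmin : IsMinimalRep ρ) {a b : SurfaceGroup g} (hab : IsStandardPair a b)
    (hPer : Per (ρ a) ∩ Per (ρ b) = ∅) : ∃ k : ℕ, 1 ≤ k ∧ PropertyS ρ k a b := by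
  obtain ⟨A, hA⟩ := proj_surjective (ρ a)
  obtain ⟨B, hB⟩ := proj_surjective (ρ b)
  obtain ⟨q, s, hAr⟩ := exists_ratLift hrigid hmin hab hA
  obtain ⟨p, r, hBr⟩ := exists_ratLift_right hrigid hmin hab hB
  obtain ⟨hb1, hb2⟩ := bend_of_isStandardPair hrigid hmin hab hA hB
  have hd : ∀ x ∈ perSet A q s, x ∉ perSet B p r := fun x h1 h2 => by
    have : (x : S1) ∈ Per (ρ a) ∩ Per (ρ b) := by
      rw [← hA, ← hB]
      exact ⟨(mem_Per_iff_mem_perSet hAr).mpr h1, (mem_Per_iff_mem_perSet hBr).mpr h2⟩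
    rwa [hPer] at this
  have hd' : ∀ x ∈ perSet B p r, x ∉ perSet A q s := fun x h1 h2 => hd x h2 h1
  have H : BendPair A B q s p r := ⟨hAr, hBr, hd, hb1⟩
  have H' : BendPair B A p r q s := ⟨hBr, hAr, hd', hb2⟩
  have hgQ : ∀ x ∈ perSet B p r, ∀ y ∈ perSet B p r,
      y ∈ Ioo (lo (perSet A q s) x) (hi (perSet A q s) x) → x = y :=
    fun x hx y hy h => H.eq_of_gap hx hy h
  have hgP : ∀ x ∈ perSet A q s, ∀ y ∈ perSet A q s,
      y ∈ Ioo (lo (perSet B p r) x) (hi (perSet B p r) x) → x = y :=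
    fun x hx y hy h => H'.eq_of_gap hx hy h
  obtain ⟨e, N, he⟩ := hAr.perSet.exists_enumerates (finite_of_gap hAr.perSet hBr.perSet hd hgP)
  obtain ⟨e', he', h⟩ := he.interlace hAr.perSet hBr.perSet hd hgP hgQ
  obtain ⟨hN, hAc⟩ := exists_conj_hyperbolic_of_alternating hAr he he'.add_period
    (fun i => (h i).1) (fun i => (h i).2)
    (H'.sg_alternate he he' (fun i => (h i).1) fun i => (h i).2)
  obtain ⟨-, hBc⟩ := exists_conj_hyperbolic_of_alternating hBr he' he.shift.add_period
    (fun i => (h i).2) (fun i => (h (i + 1)).1)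
    (H.sg_alternate he' he.shift (fun i => (h i).2) fun i => (h (i + 1)).1)
  obtain ⟨k, hk⟩ : ∃ k : ℕ, N = 2 * k := by
    obtain ⟨m, hm⟩ := hN
    have := he.pos
    exact ⟨m.toNat, by omega⟩
  have hN0 := he.pos
  refine ⟨k, by omega, hab, hA ▸ hAc k hk, hB ▸ hBc k hk, ?_, ?_⟩
  · rw [← hA, ← hB]
    exact separatedBy_of_between hAr hBr fun x hx y hy =>
      exists_between_of_gap hBr.perSet hd hgP hx hy
  · rw [← hA, ← hB]
    exact separatedBy_of_between hBr hAr fun x hx y hy =>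
      exists_between_of_gap hAr.perSet hd' hgQ hx hy

end CircleAction
end

theorem mainTheorem6 (g : ℕ) (hg : 2 ≤ g)
    (ρ : CircleAction.SurfaceGroup g →* CircleAction.HomeoPlus)
    (hrigid : CircleAction.PathRigid ρ) (hmin : CircleAction.IsMinimalRep ρ)
    (a b : CircleAction.SurfaceGroup g) (hab : CircleAction.IsStandardPair a b)
    (hPer : CircleAction.Per (ρ a) ∩ CircleAction.Per (ρ b) = ∅) :
    ∃ k : ℕ, 1 ≤ k ∧ CircleAction.PropertyS ρ k a b :=
  CircleAction.exists_propertyS hrigid hmin hab hPer
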